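/- Let $\varepsilon_0\ge 0$, $\varepsilon_1,\lambda\in\mathbb R$, $a>b>0$, and put $p^2=a^2+b^2$, $r^2=a^2-b^2$. On $\mathbb R^9(\mathbf M,\boldsymbol\alpha,\boldsymbol\beta)$ consider the Euler equations on $e(3,2)^*$ $$\dot{\mathbf M}=\mathbf M\times\tfrac{\partial H}{\partial\mathbf M}+\boldsymbol\alpha\times\tfrac{\partial H}{\partial\boldsymbol\alpha}+\boldsymbol\beta\times\tfrac{\partial H}{\partial\boldsymbol\beta},\qquad \dot{\boldsymbol\alpha}=\boldsymbol\alpha\times\tfrac{\partial H}{\partial\mathbf M},\qquad \dot{\boldsymbol\beta}=\boldsymbol\beta\times\tfrac{\partial H}{\partial\mathbf M}$$ of the Sokolov–Tsiganov generalized two-field gyrostat, $$H=\tfrac14(M_1^2+M_2^2)+\tfrac12(M_3-\lambda)^2-\varepsilon_1[(\alpha_2M_3-\alpha_3M_2)+(\beta_3M_1-\beta_1M_3)]-\varepsilon_0(\alpha_1+\beta_2),$$ on the phase space $\mathcal P^6=\{\boldsymbol\alpha^2=a^2,\ \boldsymbol\beta^2=b^2,\ \boldsymbol\alpha\cdot\boldsymbol\beta=0\}$.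 Its further integrals are, with $\mathbf e_i$ the standard basis vectors, $$\begin{aligned}K={}&\bigl[\tfrac14(M_1^2-M_2^2)+\varepsilon_0(\alpha_1-\beta_2)+\varepsilon_1\bigl((\boldsymbol\alpha\times\mathbf M)\cdot\mathbf e_1-(\boldsymbol\beta\times\mathbf M)\cdot\mathbf e_2-\varepsilon_1(\boldsymbol\alpha^2-\boldsymbol\beta^2)\bigr)\bigr]^2\\&+\bigl[\tfrac12M_1M_2+\varepsilon_0(\alpha_2+\beta_1)+\varepsilon_1\bigl((\boldsymbol\alpha\times\mathbf M)\cdot\mathbf e_2+(\boldsymbol\beta\times\mathbf M)\cdot\mathbf e_1-2\varepsilon_1\boldsymbol\alpha\cdot\boldsymbol\beta\bigr)\bigr]^2\\&+2\lambda\bigl[\tfrac14(M_1^2+M_2^2)(M_3-2\lambda)+\varepsilon_0(\alpha_3M_1+\beta_3M_2)\bigr]\\&-2\varepsilon_1\lambda\bigl[\alpha_2M_1^2-\beta_1M_2^2-(\alpha_1-\beta_2)M_1M_2+\varepsilon_1(\boldsymbol\alpha^2+\boldsymbol\beta^2)M_3-2\varepsilon_1(\boldsymbol\alpha\times\boldsymbol\beta)\cdot\mathbf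 M\bigr],\end{aligned}$$ $$\begin{aligned}G={}&\tfrac14[(\mathbf M\cdot\boldsymbol\alpha)^2+(\mathbf M\cdot\boldsymbol\beta)^2]+\tfrac12(M_3-2\lambda)(\boldsymbol\alpha\times\boldsymbol\beta)\cdot\mathbf M-\varepsilon_0[\boldsymbol\beta^2\alpha_1+\boldsymbol\alpha^2\beta_2-(\boldsymbol\alpha\cdot\boldsymbol\beta)(\alpha_2+\beta_1)]\\&-\varepsilon_1\bigl[\boldsymbol\beta^2(\boldsymbol\alpha\times\mathbf M)\cdot\mathbf e_1+\boldsymbol\alpha^2(\boldsymbol\beta\times\mathbf M)\cdot\mathbf e_2-(\boldsymbol\alpha\cdot\boldsymbol\beta)\bigl((\boldsymbol\alpha\times\mathbf M)\cdot\mathbf e_2+(\boldsymbol\beta\times\mathbf M)\cdot\mathbf e_1\bigr)\bigr].\end{aligned}$$ Put $x_{1,2}=(\alpha_1-\beta_2)\pm i(\alpha_2+\beta_1)$, $z_{1,2}=\alpha_3\pm i\beta_3$, $w_{1,2}=\tfrac12(M_1\pm iM_2)$ and, where $w_1w_2\ne0$, $$U_1=\frac{\mathbf M\cdot\boldsymbol\alpha+i\,\mathbf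 M\cdot\boldsymbol\beta}{M_1+iM_2}-\frac{\mathbf M\cdot\boldsymbol\alpha-i\,\mathbf M\cdot\boldsymbol\beta}{M_1-iM_2},\qquad U_2=4w_1w_2\,U_1',$$ where the prime is $d/d(it)$ along the system. Let $\mathfrak M_3$ be the closure of the set $\{U_1=0,\ U_2=0\}$ in $\mathcal P^6\cap\{w_1w_2\neq0\}$. Then: 1. $\mathfrak M_3$ is a non-empty invariant subset of $\mathcal P^6$: every trajectory that meets it stays in it. 2. Every point of $\mathfrak M_3$ is a critical point of the integral map $H\times K\times G:\mathcal P^6\to\mathbb R^3$ (its differential on the tangent space of $\mathcal P^6$ has rank less than $3$). 3. $\mathfrak M_3$ is almost everywhere a smooth 4-dimensional manifold: the points near which it is a smooth embedded 4-dimensional submanifold are dense in $\mathfrak M_3$, and the remaining points form a set of zero 4-dimensional Hausdorff measure. 4. The functions $$S=-\frac12\left[\frac{\mathbf M\cdot\boldsymbol\alpha+i\,\mathbf M\cdot\boldsymbol\beta}{M_1+iM_2}+\frac{\mathbf M\cdot\boldsymbol\alpha-i\,\mathbf M\cdot\boldsymbol\beta}{M_1-iM_2}\right],$$ $$T=x_1x_2+z_1z_2-\frac{2S}{\varepsilon_0+2\varepsilon_1^2S}\bigl[(w_1+i\varepsilon_1z_1)(w_2-i\varepsilon_1z_2)+\varepsilon_1^2x_1x_2\bigr]$$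 are partial integrals on $\mathfrak M_3$: along each trajectory in $\mathfrak M_3$, $S$ has the same value at all times at which $w_1w_2\ne0$, and so has $T$ if moreover $\varepsilon_0+2\varepsilon_1^2S\ne0$. If $\varepsilon_0>0$, then $S\neq0$ at all points of $\mathfrak M_3$ with $w_1w_2\ne0$. 5. At all points of $\mathfrak M_3$ at which $S$, $T$ are defined (that is, $w_1w_2\ne0$, $\varepsilon_0+2\varepsilon_1^2S\neq0$) and $S\neq0$, $$H=\varepsilon_0S+\frac{\varepsilon_0}{2S}(p^2-T)-\varepsilon_1^2T+\frac{\lambda^2}2,\qquad K=\frac{(\varepsilon_0+2\varepsilon_1^2S)^2\,[r^4+T(T+4S^2-2p^2)]}{4S^2},$$ $$G=\frac{\varepsilon_0(p^4-r^4+2p^2S^2)}{4S}-\frac12S(\varepsilon_0+2\varepsilon_1^2S)T.$$ -/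

import Mathlib

open scoped Matrix ContDiff

noncomputable section

namespace GTFG

/-! ### The space `e(3,2)* ≅ ℝ⁹(M, α, β)` and the Euler equations -/

/-- The space `ℝ³(M) × ℝ³(α) × ℝ³(β)`. Coordinates are indexed by `0, 1, 2`. -/
abbrev Phase : Type := (Fin 3 → ℝ) × (Fin 3 → ℝ) × (Fin 3 → ℝ)

/-- The kinetic momentum `M`. -/
abbrev mom (u : Phase) : Fin 3 → ℝ := u.1

/-- The first field intensity `α`. -/
abbrev fa (u : Phase) : Fin 3 → ℝ := u.2.1

/-- The second field intensity `β`. -/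
abbrev fb (u : Phase) : Fin 3 → ℝ := u.2.2

/-- The partial gradient `∂f/∂M`. -/
def gradM (f : Phase → ℝ) (u : Phase) : Fin 3 → ℝ :=
  fun i => fderiv ℝ f u (Pi.single i 1, 0, 0)

/-- The partial gradient `∂f/∂α`. -/
def gradA (f : Phase → ℝ) (u : Phase) : Fin 3 → ℝ :=
  fun i => fderiv ℝ f u (0, Pi.single i 1, 0)

/-- The partial gradient `∂f/∂β`. -/
def gradB (f : Phase → ℝ) (u : Phase) : Fin 3 → ℝ :=
  fun i => fderiv ℝ f u (0, 0, Pi.single i 1)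

/-- The right-hand side of the Euler equations on `e(3,2)*` with the Hamilton function `f`:
`M' = M × ∂f/∂M + α × ∂f/∂α + β × ∂f/∂β`, `α' = α × ∂f/∂M`, `β' = β × ∂f/∂M`. -/
def eulerField (f : Phase → ℝ) (u : Phase) : Phase :=
  (mom u ⨯₃ gradM f u + fa u ⨯₃ gradA f u + fb u ⨯₃ gradB f u,
    fa u ⨯₃ gradM f u, fb u ⨯₃ gradM f u)

/-- The Casimir functions `(α·α, β·β, α·β)`. -/
def casimir (u : Phase) : ℝ × ℝ × ℝ :=
  (fa u ⬝ᵥ fa u, fb u ⬝ᵥ fb u, fa u ⬝ᵥ fb u)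

/-- The phase space `α·α = a²`, `β·β = b²`, `α·β = 0`. -/
def phaseSpace (a b : ℝ) : Set Phase := {u | casimir u = (a ^ 2, b ^ 2, 0)}

/-- The tangent space at `u` of the common level of the Casimir functions through `u`. -/
def tangentSpace (u : Phase) : Submodule ℝ Phase :=
  LinearMap.ker (fderiv ℝ casimir u : Phase →ₗ[ℝ] ℝ × ℝ × ℝ)

/-! ### The generalized two-field gyrostat -/

/-- The Hamilton function. -/
def hamH (ε₀ ε₁ lam : ℝ) (u : Phase) : ℝ :=
  1 / 4 * (mom u 0 ^ 2 + mom u 1 ^ 2) + 1 / 2 * (mom u 2 - lam) ^ 2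
    - ε₁ * ((fa u 1 * mom u 2 - fa u 2 * mom u 1) + (fb u 2 * mom u 0 - fb u 0 * mom u 2))
    - ε₀ * (fa u 0 + fb u 1)

/-- The first integral `K`. -/
def intK (ε₀ ε₁ lam : ℝ) (u : Phase) : ℝ :=
  (1 / 4 * (mom u 0 ^ 2 - mom u 1 ^ 2) + ε₀ * (fa u 0 - fb u 1)
      + ε₁ * ((fa u ⨯₃ mom u) 0 - (fb u ⨯₃ mom u) 1
        - ε₁ * (fa u ⬝ᵥ fa u - fb u ⬝ᵥ fb u))) ^ 2
    + (1 / 2 * mom u 0 * mom u 1 + ε₀ * (fa u 1 + fb u 0)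
      + ε₁ * ((fa u ⨯₃ mom u) 1 + (fb u ⨯₃ mom u) 0 - 2 * ε₁ * (fa u ⬝ᵥ fb u))) ^ 2
    + 2 * lam * (1 / 4 * (mom u 0 ^ 2 + mom u 1 ^ 2) * (mom u 2 - 2 * lam)
      + ε₀ * (fa u 2 * mom u 0 + fb u 2 * mom u 1))
    - 2 * ε₁ * lam * (fa u 1 * mom u 0 ^ 2 - fb u 0 * mom u 1 ^ 2
      - (fa u 0 - fb u 1) * mom u 0 * mom u 1
      + ε₁ * (fa u ⬝ᵥ fa u + fb u ⬝ᵥ fb u) * mom u 2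
      - 2 * ε₁ * ((fa u ⨯₃ fb u) ⬝ᵥ mom u))

/-- The first integral `G`. -/
def intG (ε₀ ε₁ lam : ℝ) (u : Phase) : ℝ :=
  1 / 4 * ((mom u ⬝ᵥ fa u) ^ 2 + (mom u ⬝ᵥ fb u) ^ 2)
    + 1 / 2 * (mom u 2 - 2 * lam) * ((fa u ⨯₃ fb u) ⬝ᵥ mom u)
    - ε₀ * ((fb u ⬝ᵥ fb u) * fa u 0 + (fa u ⬝ᵥ fa u) * fb u 1
      - (fa u ⬝ᵥ fb u) * (fa u 1 + fb u 0))
    - ε₁ * ((fb u ⬝ᵥ fb u) * (fa u ⨯₃ mom u) 0 + (fa u ⬝ᵥ fa u) * (fb u ⨯₃ mom u) 1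
      - (fa u ⬝ᵥ fb u) * ((fa u ⨯₃ mom u) 1 + (fb u ⨯₃ mom u) 0))

/-- The vector field of the generalized two-field gyrostat. -/
def gyroField (ε₀ ε₁ lam : ℝ) : Phase → Phase := eulerField (hamH ε₀ ε₁ lam)

/-- The integral map `J = H × K × G`. -/
def integralMap (ε₀ ε₁ lam : ℝ) (u : Phase) : ℝ × ℝ × ℝ :=
  (hamH ε₀ ε₁ lam u, intK ε₀ ε₁ lam u, intG ε₀ ε₁ lam u)

/-- `u` is a critical point of the restriction of the integral map to the phase space:
the differential restricted to the tangent space of the phase space has rank less than `3`. -/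
def IsCriticalPoint (ε₀ ε₁ lam : ℝ) (u : Phase) : Prop :=
  Module.finrank ℝ ((tangentSpace u).map
    (fderiv ℝ (integralMap ε₀ ε₁ lam) u : Phase →ₗ[ℝ] ℝ × ℝ × ℝ)) < 3

/-! ### Complex variables and the invariant relations -/

/-- `x₁ = (α₁ - β₂) + i (α₂ + β₁)`. -/
def x₁ (u : Phase) : ℂ := ((fa u 0 - fb u 1 : ℝ) : ℂ) + Complex.I * ((fa u 1 + fb u 0 : ℝ) : ℂ)

/-- `x₂ = (α₁ - β₂) - i (α₂ + β₁)`. -/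
def x₂ (u : Phase) : ℂ := ((fa u 0 - fb u 1 : ℝ) : ℂ) - Complex.I * ((fa u 1 + fb u 0 : ℝ) : ℂ)

/-- `z₁ = α₃ + i β₃`. -/
def z₁ (u : Phase) : ℂ := (fa u 2 : ℂ) + Complex.I * (fb u 2 : ℂ)

/-- `z₂ = α₃ - i β₃`. -/
def z₂ (u : Phase) : ℂ := (fa u 2 : ℂ) - Complex.I * (fb u 2 : ℂ)

/-- `w₁ = (M₁ + i M₂) / 2`. -/
def w₁ (u : Phase) : ℂ := 1 / 2 * ((mom u 0 : ℂ) + Complex.I * (mom u 1 : ℂ))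

/-- `w₂ = (M₁ - i M₂) / 2`. -/
def w₂ (u : Phase) : ℂ := 1 / 2 * ((mom u 0 : ℂ) - Complex.I * (mom u 1 : ℂ))

/-- The ratio `(M·α + i M·β) / (M₁ + i M₂)`. -/
def ratioPlus (u : Phase) : ℂ :=
  (((mom u ⬝ᵥ fa u : ℝ) : ℂ) + Complex.I * ((mom u ⬝ᵥ fb u : ℝ) : ℂ)) /
    ((mom u 0 : ℂ) + Complex.I * (mom u 1 : ℂ))

/-- The ratio `(M·α - i M·β) / (M₁ - i M₂)`. -/
def ratioMinus (u : Phase) : ℂ :=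
  (((mom u ⬝ᵥ fa u : ℝ) : ℂ) - Complex.I * ((mom u ⬝ᵥ fb u : ℝ) : ℂ)) /
    ((mom u 0 : ℂ) - Complex.I * (mom u 1 : ℂ))

/-- The function `U₁`, meaningful where `w₁ w₂ ≠ 0`. -/
def U₁ (u : Phase) : ℂ := ratioPlus u - ratioMinus u

/-- The derivative `f' = df/d(it) = -i df/dt` along the gyrostat system. -/
def primeDeriv (ε₀ ε₁ lam : ℝ) (f : Phase → ℂ) (u : Phase) : ℂ :=
  -Complex.I * fderiv ℝ f u (gyroField ε₀ ε₁ lam u)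

/-- The function `U₂ = 4 w₁ w₂ U₁'`. -/
def U₂ (ε₀ ε₁ lam : ℝ) (u : Phase) : ℂ := 4 * w₁ u * w₂ u * primeDeriv ε₀ ε₁ lam U₁ u

/-- The set given by `U₁ = 0`, `U₂ = 0` in the domain `w₁ w₂ ≠ 0` of the phase space. -/
def relationSet (ε₀ ε₁ lam a b : ℝ) : Set Phase :=
  {u | u ∈ phaseSpace a b ∧ w₁ u * w₂ u ≠ 0 ∧ U₁ u = 0 ∧ U₂ ε₀ ε₁ lam u = 0}

/-- The closure of the set `U₁ = 0`, `U₂ = 0` (the phase space is closed in `Phase`). -/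
def setM₃ (ε₀ ε₁ lam a b : ℝ) : Set Phase := closure (relationSet ε₀ ε₁ lam a b)

/-- The function `S`, meaningful where `w₁ w₂ ≠ 0`. -/
def intS (u : Phase) : ℂ := -(1 / 2) * (ratioPlus u + ratioMinus u)

/-- The denominator `ε₀ + 2 ε₁² S` in the definition of `T`. -/
def denT (ε₀ ε₁ : ℝ) (u : Phase) : ℂ := (ε₀ : ℂ) + 2 * (ε₁ : ℂ) ^ 2 * intS u

/-- The function `T`, meaningful where `w₁ w₂ ≠ 0` and `ε₀ + 2 ε₁² S ≠ 0`. -/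
def intT (ε₀ ε₁ : ℝ) (u : Phase) : ℂ :=
  x₁ u * x₂ u + z₁ u * z₂ u - 2 * intS u / denT ε₀ ε₁ u *
    ((w₁ u + Complex.I * ε₁ * z₁ u) * (w₂ u - Complex.I * ε₁ * z₂ u)
      + (ε₁ : ℂ) ^ 2 * (x₁ u * x₂ u))

end GTFG

/-! ### Trajectories, invariant sets, smooth points of a set -/

/-- `γ` solves `γ' = X(γ)` on the set of times `I` (used for intervals `I` of any kind). -/
def IsTrajectoryOn {E : Type*} [NormedAddCommGroup E] [NormedSpace ℝ E]
    (X : E → E) (I : Set ℝ) (γ : ℝ → E) : Prop :=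
  ∀ t ∈ I, HasDerivWithinAt γ (X (γ t)) I t

/-- A trajectory that meets `N` stays in `N`, both forward and backward in time. -/
def IsInvariantSet {E : Type*} [NormedAddCommGroup E] [NormedSpace ℝ E]
    (X : E → E) (N : Set E) : Prop :=
  ∀ (I : Set ℝ) (γ : ℝ → E), I.OrdConnected → IsTrajectoryOn X I γ →
    ∀ t₀ ∈ I, γ t₀ ∈ N → ∀ t ∈ I, γ t ∈ N

/-- Near its point `p` the set `N` is a smooth embedded `k`-dimensional submanifold of `E`:
it is the zero set of a smooth map to `ℝᶜ`, `c = dim E - k`, with surjective differential. -/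
def IsSmoothPoint {E : Type*} [NormedAddCommGroup E] [NormedSpace ℝ E]
    (N : Set E) (k : ℕ) (p : E) : Prop :=
  p ∈ N ∧ ∃ (c : ℕ) (U : Set E) (f : E → Fin c → ℝ),
    k + c = Module.finrank ℝ E ∧ IsOpen U ∧ p ∈ U ∧ ContDiffOn ℝ ∞ f U ∧
    (∀ q ∈ N ∩ U, Function.Surjective (fderiv ℝ f q)) ∧
    N ∩ U = {q | q ∈ U ∧ f q = 0}

end

/-!
Put `A = α + S e₁`, `B = β + S e₂` and `D = M₃ / 2 - λ - ε₁ (α₂ - β₁)`. At a point with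
`M₁² + M₂² ≠ 0` the equations `U₁ = U₂ = 0` say that, for one real number `S`, namely the `S` of
the theorem, `M ⬝ A = 0`, `M ⬝ B = 0` and `ε₀ A × B = S D M`. With `S` frozen, the left sides of
these relations satisfy a homogeneous linear system along every trajectory, so the relations
persist and `S` is a first integral. By continuous dependence on the initial data the closure of
such points is invariant as well; passages through `M₁ = M₂ = 0` are controlled by a second
homogeneous linear system, for `(M₁, M₂, ε₀ α₃, ε₀ β₃)`.

Where `ε₀ = S δ`, the last relation may be divided by `S`, and `4 K` is then a polynomial in `H`,
`G` and the Casimir functions, linear in `G`, plus a quadratic form in the left sides of the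
relations. Hence `dK` is a combination of `dH` and `dG` along the phase space, and the values of
`H`, `K`, `G` follow.

The relations cut out a 4-dimensional manifold wherever their first variation, taken over the
tangent space of the phase space and over `S`, is non-degenerate. The degenerate points are limits
of regular ones along explicit curves, and together with the points `M₁ = M₂ = 0` they lie in
finitely many sets cut out by independent equations, of dimension at most 3.
-/

noncomputable section

open Filter
open scoped Topology

/-! ### Linear systems, invariant sets, smooth points -/

theorem exists_sq_eq_one_mul_nonneg (x : ℝ) : ∃ s : ℝ, s ^ 2 = 1 ∧ 0 ≤ s * x := by
  rcases le_total 0 x with h | h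
  · exact ⟨1, one_pow 2, by rwa [one_mul]⟩
  · exact ⟨-1, by norm_num, by rwa [neg_one_mul, neg_nonneg]⟩

theorem exists_sq_eq_two_mul_add {x : ℝ} (c : ℝ) (hx : 0 < x) :
    ∃ μ : ℝ, μ ≠ 0 ∧ μ ^ 2 = 2 * c * μ + 2 * x := by
  have hsq := Real.sq_sqrt (by positivity : 0 ≤ c ^ 2 + 2 * x)
  have h : (c + √(c ^ 2 + 2 * x)) ^ 2 = 2 * c * (c + √(c ^ 2 + 2 * x)) + 2 * x := by
    linear_combination hsq
  refine ⟨_, fun h0 => ?_, h⟩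
  rw [h0] at h
  linarith

theorem tendsto_nhdsNE_of_continuousAt {T X : Type*} [TopologicalSpace T] [TopologicalSpace X]
    {γ : T → X} {t : T} {x : X} (hγ : ContinuousAt γ t) (h : γ t = x) :
    Tendsto γ (𝓝[≠] t) (𝓝 x) :=
  h ▸ hγ.tendsto.mono_left nhdsWithin_le_nhds

@[fun_prop]
theorem contDiff_vec3 {E : Type*} [NormedAddCommGroup E] [NormedSpace ℝ E] {k : WithTop ℕ∞}
    {f g h : E → ℝ} (hf : ContDiff ℝ k f) (hg : ContDiff ℝ k g) (hh : ContDiff ℝ k h) :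
    ContDiff ℝ k fun x => ![f x, g x, h x] :=
  contDiff_pi.2 fun i => by
    fin_cases i
    exacts [hf, hg, hh]

section Trajectories

variable {E : Type*} [NormedAddCommGroup E] [NormedSpace ℝ E] {I : Set ℝ}

theorem eq_zero_of_norm_deriv_le_of_le {y y' : ℝ → E} {K : ℝ → ℝ} {t₀ t : ℝ} (ht : t₀ ≤ t)
    (hK : ContinuousOn K (Set.Icc t₀ t))
    (hy : ∀ s ∈ Set.Icc t₀ t, HasDerivWithinAt y (y' s) (Set.Icc t₀ t) s)
    (hle : ∀ s ∈ Set.Icc t₀ t, ‖y' s‖ ≤ K s * ‖y s‖) (h0 : y t₀ = 0) : y t = 0 := by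
  obtain ⟨C, hC⟩ := isCompact_Icc.exists_bound_of_continuousOn hK
  refine eq_zero_of_abs_deriv_le_mul_abs_self_of_eq_zero_right (f' := y') (K := C)
    (fun s hs => (hy s hs).continuousWithinAt) (fun s hs => ?_) h0 (fun s hs => ?_) t ⟨ht, le_rfl⟩
  · exact (hy s (Set.Ico_subset_Icc_self hs)).mono_of_mem_nhdsWithin
      (mem_of_superset (Icc_mem_nhdsGE hs.2) (Set.Icc_subset_Icc_left hs.1))
  · have hs' := Set.Ico_subset_Icc_self hs
    refine (hle s hs').trans ?_
    gcongr
    exact (le_abs_self _).trans (hC s hs')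

theorem eq_zero_of_norm_deriv_le (hI : I.OrdConnected) {y y' : ℝ → E} {K : ℝ → ℝ}
    (hK : ContinuousOn K I) (hy : ∀ t ∈ I, HasDerivWithinAt y (y' t) I t)
    (hle : ∀ t ∈ I, ‖y' t‖ ≤ K t * ‖y t‖) {t₀ t : ℝ} (ht₀ : t₀ ∈ I) (ht : t ∈ I)
    (h0 : y t₀ = 0) : y t = 0 := by
  rcases le_total t₀ t with h | h
  · have hsub := hI.out ht₀ ht
    exact eq_zero_of_norm_deriv_le_of_le h (hK.mono hsub)
      (fun s hs => (hy s (hsub hs)).mono hsub) (fun s hs => hle s (hsub hs)) h0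
  · have hsub : Set.MapsTo Neg.neg (Set.Icc (-t₀) (-t)) I := fun s hs =>
      hI.out ht ht₀ ⟨le_neg.1 hs.2, neg_le.1 hs.1⟩
    have hrev := eq_zero_of_norm_deriv_le_of_le (y := fun s => y (-s)) (y' := fun s => -y' (-s))
      (K := fun s => K (-s)) (neg_le_neg h) (hK.comp continuousOn_neg hsub) (fun s hs => ?_)
      (fun s hs => by simpa only [norm_neg] using hle (-s) (hsub hs)) (by simpa only [neg_neg])
    · simpa only [neg_neg] using hrev
    · exact ((hy (-s) (hsub hs)).scomp s (hasDerivAt_neg s).hasDerivWithinAt hsub).congr_deriv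
        (neg_one_smul ℝ _)

theorem eq_zero_of_linear_system {ι : Type*} [Fintype ι] (hI : I.OrdConnected)
    {y : ℝ → ι → ℝ} {A : ℝ → Matrix ι ι ℝ} (hA : ContinuousOn A I)
    (hy : ∀ t ∈ I, HasDerivWithinAt y (A t *ᵥ y t) I t) {t₀ t : ℝ} (ht₀ : t₀ ∈ I) (ht : t ∈ I)
    (h0 : y t₀ = 0) : y t = 0 := by
  classical
  let toCLM : Matrix ι ι ℝ →ₗ[ℝ] (ι → ℝ) →L[ℝ] (ι → ℝ) :=
    LinearMap.toContinuousLinearMap.toLinearMap ∘ₗ Matrix.toLin'.toLinearMap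
  have hcont : Continuous toCLM := LinearMap.continuous_of_finiteDimensional toCLM
  exact eq_zero_of_norm_deriv_le hI (K := fun t => ‖toCLM (A t)‖) (hcont.comp_continuousOn hA).norm
    hy (fun t _ => (toCLM (A t)).le_opNorm (y t)) ht₀ ht h0

theorem eq_of_hasDerivWithinAt_zero (hI : I.OrdConnected) {y : ℝ → E}
    (hy : ∀ t ∈ I, HasDerivWithinAt y 0 I t) {t₀ t : ℝ} (ht₀ : t₀ ∈ I) (ht : t ∈ I) :
    y t = y t₀ :=
  sub_eq_zero.1 <| eq_zero_of_norm_deriv_le hI (y := fun s => y s - y t₀) (y' := 0)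
    (K := fun _ => 0) continuousOn_const (fun s hs => (hy s hs).sub_const _) (by simp) ht₀ ht
    (sub_self _)

namespace IsTrajectoryOn

variable {X : E → E} {J : Set ℝ} {γ γ' : ℝ → E}

theorem mono (h : IsTrajectoryOn X I γ) (hJ : J ⊆ I) : IsTrajectoryOn X J γ :=
  fun t ht => (h t (hJ ht)).mono hJ

theorem continuousOn (h : IsTrajectoryOn X I γ) : ContinuousOn γ I :=
  fun t ht => (h t ht).continuousWithinAt

theorem hasDerivWithinAt_comp {F : Type*} [NormedAddCommGroup F] [NormedSpace ℝ F]
    (h : IsTrajectoryOn X I γ) {f : E → F} (hf : Differentiable ℝ f) {t : ℝ} (ht : t ∈ I) :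
    HasDerivWithinAt (fun s => f (γ s)) (fderiv ℝ f (γ t) (X (γ t))) I t :=
  (hf (γ t)).hasFDerivAt.comp_hasDerivWithinAt t (h t ht)

variable [FiniteDimensional ℝ E]

theorem eqOn (hX : ContDiff ℝ 1 X) (hI : I.OrdConnected) (h : IsTrajectoryOn X I γ)
    (h' : IsTrajectoryOn X I γ') {t₀ : ℝ} (ht₀ : t₀ ∈ I) (h0 : γ t₀ = γ' t₀) :
    Set.EqOn γ γ' I := by
  have : ProperSpace E := FiniteDimensional.proper ℝ E
  intro t ht
  have hsub : Set.uIcc t₀ t ⊆ I := hI.uIcc_subset ht₀ ht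
  have hcomp : IsCompact (Set.uIcc t₀ t) := isCompact_uIcc
  obtain ⟨R, hR⟩ := hcomp.exists_bound_of_continuousOn (h.mono hsub).continuousOn
  obtain ⟨R', hR'⟩ := hcomp.exists_bound_of_continuousOn (h'.mono hsub).continuousOn
  obtain ⟨C, hC⟩ := (isCompact_closedBall (0 : E) (max R R')).exists_bound_of_continuousOn
    (hX.continuous_fderiv one_ne_zero).continuousOn
  refine sub_eq_zero.1 <| eq_zero_of_norm_deriv_le Set.ordConnected_uIcc
    (y := fun s => γ s - γ' s) (K := fun _ => C) continuousOn_const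
    (fun s hs => (h.mono hsub s hs).sub (h'.mono hsub s hs)) (fun s hs => ?_)
    Set.left_mem_uIcc Set.right_mem_uIcc (sub_eq_zero.2 h0)
  exact (convex_closedBall (0 : E) (max R R')).norm_image_sub_le_of_norm_fderiv_le
    (fun z _ => hX.differentiable one_ne_zero z) hC
    (mem_closedBall_zero_iff.2 ((hR' s hs).trans (le_max_right _ _)))
    (mem_closedBall_zero_iff.2 ((hR s hs).trans (le_max_left _ _)))

theorem eventually_mem_closure (hX : ContDiff ℝ 1 X) {N : Set E}
    (hN : ∀ (I : Set ℝ) (γ : ℝ → E), I.OrdConnected → IsTrajectoryOn X I γ →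
      ∀ t₀ ∈ I, γ t₀ ∈ N → ∀ t ∈ I, γ t ∈ closure N)
    (hI : I.OrdConnected) (h : IsTrajectoryOn X I γ) {t₀ : ℝ} (ht₀ : t₀ ∈ I)
    (h0 : γ t₀ ∈ closure N) : ∀ᶠ t in 𝓝[I] t₀, γ t ∈ closure N := by
  have : CompleteSpace E := FiniteDimensional.complete ℝ E
  obtain ⟨ε, hε, a, r, L, K, hr, hPL⟩ :=
    IsPicardLindelof.of_contDiffAt_one (hX.contDiffAt (x := γ t₀))
  obtain ⟨Φ, hΦ, L', hLip⟩ :=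
    (hPL t₀).exists_forall_mem_closedBall_eq_hasDerivWithinAt_lipschitzOnWith
  have hself : γ t₀ ∈ Metric.closedBall (γ t₀) r := Metric.mem_closedBall_self r.2
  have hmid : t₀ ∈ Set.Icc (t₀ - ε) (t₀ + ε) := ⟨by linarith, by linarith⟩
  filter_upwards [self_mem_nhdsWithin, mem_nhdsWithin_of_mem_nhds
    (Icc_mem_nhds (sub_lt_self t₀ hε) (lt_add_of_pos_right t₀ hε))] with t htI ht
  have hflow : γ t = Φ (γ t₀) t :=
    eqOn hX (hI.inter Set.ordConnected_Icc) (h.mono Set.inter_subset_left)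
      (mono (hΦ _ hself).2 Set.inter_subset_right) ⟨ht₀, hmid⟩ (hΦ _ hself).1.symm ⟨htI, ht⟩
  have hpres : Set.MapsTo (fun x => Φ x t) (Metric.closedBall (γ t₀) r ∩ N) (closure N) :=
    fun x hx => hN _ (Φ x) Set.ordConnected_Icc (hΦ x hx.1).2 t₀ hmid
      (by rw [(hΦ x hx.1).1]; exact hx.2) t ht
  have hcl : γ t₀ ∈ closure (Metric.closedBall (γ t₀) r ∩ N) :=
    mem_closure_iff_frequently.2 <| (mem_closure_iff_frequently.1 h0).and_eventually
      (Metric.closedBall_mem_nhds (γ t₀) hr) |>.mono fun _ => And.symm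
  rw [hflow, ← isClosed_closure.closure_eq]
  exact ((((hLip t ht).continuousOn) _ hself).mono Set.inter_subset_left).mem_closure hcl hpres

end IsTrajectoryOn

theorem isInvariantSet_setOf_eq_zero {ι : Type*} [Fintype ι] {X : E → E} {f : E → ι → ℝ}
    {A : E → Matrix ι ι ℝ} (hf : Differentiable ℝ f) (hA : Continuous A)
    (h : ∀ u i, fderiv ℝ (fun q => f q i) u (X u) = (A u *ᵥ f u) i) :
    IsInvariantSet X {u | f u = 0} := fun _ _ hI hγ _ ht₀ h0 _ ht =>
  eq_zero_of_linear_system hI (hA.comp_continuousOn hγ.continuousOn) (fun _ hs =>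
    hasDerivWithinAt_pi.2 fun i =>
      (hγ.hasDerivWithinAt_comp (differentiable_pi.1 hf i) hs).congr_deriv (h _ i)) ht₀ ht h0

theorem isInvariantSet_setOf_eq_of_fderiv_eq_zero {X : E → E} {F : Type*} [NormedAddCommGroup F]
    [NormedSpace ℝ F] {f : E → F} (hf : Differentiable ℝ f) (h : ∀ u, fderiv ℝ f u (X u) = 0)
    (c : F) : IsInvariantSet X {u | f u = c} := fun _ _ hI hγ _ ht₀ h0 _ ht =>
  (eq_of_hasDerivWithinAt_zero hI (fun _ hs =>
    (hγ.hasDerivWithinAt_comp hf hs).congr_deriv (h _)) ht₀ ht).trans h0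

theorem isInvariantSet_closure [FiniteDimensional ℝ E] {X : E → E} (hX : ContDiff ℝ 1 X)
    {N : Set E} (hN : ∀ (I : Set ℝ) (γ : ℝ → E), I.OrdConnected → IsTrajectoryOn X I γ →
      ∀ t₀ ∈ I, γ t₀ ∈ N → ∀ t ∈ I, γ t ∈ closure N) :
    IsInvariantSet X (closure N) := by
  intro I γ hI hγ t₀ ht₀ h0 t ht
  refine (hI.isPreconnected.induction₂ (fun s s' => γ s ∈ closure N ↔ γ s' ∈ closure N)
    (fun s hs => ?_) (fun _ _ _ _ _ _ => Iff.trans) (fun _ _ _ _ => Iff.symm) ht₀ ht).1 h0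
  by_cases hsN : γ s ∈ closure N
  · filter_upwards [hγ.eventually_mem_closure hX hN hI hs hsN] with s' hs'
    exact iff_of_true hsN hs'
  · filter_upwards [hγ.continuousOn s hs (isClosed_closure.isOpen_compl.mem_nhds hsN)] with s' hs'
    exact iff_of_false hsN hs'

end Trajectories

section SmoothPoints

variable {E F G : Type*} [NormedAddCommGroup E] [NormedSpace ℝ E]
  [NormedAddCommGroup F] [NormedSpace ℝ F] [NormedAddCommGroup G] [NormedSpace ℝ G]

theorem isOpen_setOf_clm_surjective [FiniteDimensional ℝ F] :
    IsOpen {A : E →L[ℝ] F | Function.Surjective A} := by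
  have hrank : {A : E →L[ℝ] F | Function.Surjective A} =
      {A : E →L[ℝ] F | ((Module.finrank ℝ F : ℕ) : Cardinal) ≤ (A : E →ₗ[ℝ] F).rank} := by
    ext A
    rw [Set.mem_ofPred_eq, Set.mem_ofPred_eq, LinearMap.rank, ← Module.finrank_eq_rank, Nat.cast_le,
      ← ContinuousLinearMap.coe_coe, ← LinearMap.range_eq_top]
    exact ⟨fun h => by rw [h, finrank_top],
      fun h => Submodule.eq_top_of_finrank_eq ((Submodule.finrank_le _).antisymm h)⟩
  rw [hrank]
  exact isOpen_setOfPred_nat_le_rank _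

theorem isOpen_setOf_fderiv_surjective [FiniteDimensional ℝ F] {f : E → F}
    (hf : ContDiff ℝ 1 f) : IsOpen {x | Function.Surjective (fderiv ℝ f x)} :=
  isOpen_setOf_clm_surjective.preimage (hf.continuous_fderiv one_ne_zero)

theorem fderiv_prodMk_surjective {f : E → F} {g : E → G} {x : E} (hf : DifferentiableAt ℝ f x)
    (hg : DifferentiableAt ℝ g x) (hfs : Function.Surjective (fderiv ℝ f x))
    (hgs : ∀ z, ∃ v, fderiv ℝ f x v = 0 ∧ fderiv ℝ g x v = z) :
    Function.Surjective (fderiv ℝ (fun y => (f y, g y)) x) := by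
  rintro ⟨y, z⟩
  obtain ⟨v, rfl⟩ := hfs y
  obtain ⟨w, hfw, hgw⟩ := hgs (z - fderiv ℝ g x v)
  refine ⟨v + w, ?_⟩
  rw [hf.fderiv_prodMk hg, ContinuousLinearMap.prod_apply, map_add, map_add, hfw, hgw, add_zero,
    add_sub_cancel]

theorem isSmoothPoint_of_fderiv_surjective [FiniteDimensional ℝ F] {N U : Set E}
    {f : E → F} {k : ℕ} {p : E} (hk : k + Module.finrank ℝ F = Module.finrank ℝ E) (hU : IsOpen U)
    (hp : p ∈ N) (hpU : p ∈ U) (hf : ContDiff ℝ ∞ f) (hs : Function.Surjective (fderiv ℝ f p))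
    (hN : ∀ q ∈ U, q ∈ N ↔ f q = 0) : IsSmoothPoint N k p := by
  let φ : F ≃L[ℝ] (Fin (Module.finrank ℝ F) → ℝ) := ContinuousLinearEquiv.ofFinrankEq (by simp)
  have hopen := isOpen_setOf_fderiv_surjective (hf.of_le (by simp))
  refine ⟨hp, _, U ∩ {q | Function.Surjective (fderiv ℝ f q)}, φ ∘ f, hk, hU.inter hopen,
    ⟨hpU, hs⟩, (φ.contDiff.comp hf).contDiffOn, ?_, ?_⟩
  · rintro q ⟨-, -, hq⟩
    rw [φ.comp_fderiv]
    exact φ.surjective.comp hq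
  · ext q
    constructor
    · rintro ⟨hqN, hqU⟩
      exact ⟨hqU, by rw [Function.comp_apply, (hN q hqU.1).1 hqN, map_zero]⟩
    · rintro ⟨hqU, hq⟩
      exact ⟨(hN q hqU.1).2 (φ.map_eq_zero_iff.1 hq), hqU⟩

theorem dimH_le_of_fderiv_surjective [FiniteDimensional ℝ E] [FiniteDimensional ℝ F] {Z : Set E}
    {f : E → F} (hf : ContDiff ℝ 1 f) (hZ : ∀ x ∈ Z, f x = 0)
    (hs : ∀ x ∈ Z, Function.Surjective (fderiv ℝ f x)) :
    dimH Z ≤ (Module.finrank ℝ E - Module.finrank ℝ F : ℕ) := by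
  have : CompleteSpace E := FiniteDimensional.complete ℝ E
  by_contra! hlt
  obtain ⟨x, hxZ, hx⟩ := exists_mem_nhdsWithin_lt_dimH_of_lt_dimH hlt
  have hd := hf.contDiffAt.hasStrictFDerivAt (x := x) one_ne_zero
  have hrange := LinearMap.range_eq_top.2 (hs x hxZ)
  let e := hd.implicitToOpenPartialHomeomorph f (fderiv ℝ f x) hrange
  let φ := hd.implicitFunction f (fderiv ℝ f x) hrange (f x)
  obtain ⟨C, V, hV, hLip⟩ := (hd.to_implicitFunction hrange).exists_lipschitzOnWith
  have hcont : Tendsto (fun y => (e y).2) (𝓝 x) (𝓝 0) := by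
    have he := e.continuousAt (hd.mem_implicitToOpenPartialHomeomorph_source hrange)
    simpa only [ContinuousAt, e, hd.implicitToOpenPartialHomeomorph_self] using he.snd
  have hker : Module.finrank ℝ (fderiv ℝ f x).ker = Module.finrank ℝ E - Module.finrank ℝ F := by
    have := (fderiv ℝ f x : E →ₗ[ℝ] F).finrank_range_add_finrank_ker
    rw [hrange, finrank_top] at this
    exact Nat.eq_sub_of_add_eq' this
  refine (hx (φ '' V) ?_).not_ge ?_
  · filter_upwards [self_mem_nhdsWithin, mem_nhdsWithin_of_mem_nhds (hcont hV),
      mem_nhdsWithin_of_mem_nhds (hd.eq_implicitFunction hrange)] with y hyZ hyV hy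
    exact ⟨(e y).2, hyV, by simpa only [φ, e, hZ y hyZ, hZ x hxZ] using hy⟩
  · calc dimH (φ '' V) ≤ dimH V := hLip.dimH_image_le
      _ ≤ dimH Set.univ := dimH_mono (Set.subset_univ V)
      _ = _ := by rw [Real.dimH_univ_eq_finrank, hker]

end SmoothPoints

/-! ### The invariant relations in real form -/

namespace GTFG

section Cross

variable {A B v w : Fin 3 → ℝ}

theorem cross_cross_eq_zero_of_dot (hA : w ⬝ᵥ A = 0) (hB : w ⬝ᵥ B = 0) : A ⨯₃ B ⨯₃ w = 0 := by
  rw [cross_cross_eq_smul_sub_smul, dotProduct_comm A, dotProduct_comm B, hA, hB, zero_smul,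
    zero_smul, sub_zero]

theorem dot_cross_smul_cross (hA : w ⬝ᵥ A = 0) (hB : w ⬝ᵥ B = 0) :
    (w ⬝ᵥ A ⨯₃ B) • (A ⨯₃ B) = (A ⨯₃ B ⬝ᵥ A ⨯₃ B) • w := by
  have h := cross_cross_eq_smul_sub_smul (A ⨯₃ B) w (A ⨯₃ B)
  rw [cross_cross_eq_zero_of_dot hA hB, map_zero, LinearMap.zero_apply] at h
  exact (sub_eq_zero.1 h.symm).symm

theorem eq_zero_of_cross_eq_zero (h : v ⨯₃ w = 0)
    (hw : w 0 ^ 2 + w 1 ^ 2 ≠ 0) (hd : w 0 * v 0 + w 1 * v 1 = 0) : v = 0 := by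
  have h0 := congr_fun h 0
  have h1 := congr_fun h 1
  have h2 := congr_fun h 2
  simp only [cross_apply, Matrix.cons_val, Pi.zero_apply] at h0 h1 h2
  ext i
  refine mul_left_cancel₀ hw ?_
  fin_cases i <;> simp only [Fin.zero_eta, Fin.mk_one, Fin.reduceFinMk, Pi.zero_apply, mul_zero]
  · linear_combination w 0 * hd + w 1 * h2
  · linear_combination w 1 * hd - w 0 * h2
  · linear_combination w 2 * hd + w 0 * h1 - w 1 * h0

end Cross

section Coordinates

variable (i : Fin 3) (u v : Phase)

theorem fderiv_mom_apply : fderiv ℝ (fun q : Phase => q.1 i) u v = v.1 i :=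
  DFunLike.congr_fun (((ContinuousLinearMap.proj (R := ℝ) (φ := fun _ : Fin 3 => ℝ) i).comp
    (.fst ℝ _ ((Fin 3 → ℝ) × (Fin 3 → ℝ)))).fderiv) v

theorem fderiv_fa_apply : fderiv ℝ (fun q : Phase => q.2.1 i) u v = v.2.1 i :=
  DFunLike.congr_fun ((((ContinuousLinearMap.proj (R := ℝ) (φ := fun _ : Fin 3 => ℝ) i).comp
    (.fst ℝ _ (Fin 3 → ℝ))).comp (.snd ℝ (Fin 3 → ℝ) _)).fderiv) v

theorem fderiv_fb_apply : fderiv ℝ (fun q : Phase => q.2.2 i) u v = v.2.2 i :=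
  DFunLike.congr_fun ((((ContinuousLinearMap.proj (R := ℝ) (φ := fun _ : Fin 3 => ℝ) i).comp
    (.snd ℝ (Fin 3 → ℝ) _)).comp (.snd ℝ (Fin 3 → ℝ) _)).fderiv) v

end Coordinates

theorem contDiff_hamH (ε₀ ε₁ lam : ℝ) : ContDiff ℝ ∞ (hamH ε₀ ε₁ lam) := by
  unfold hamH mom fa fb
  fun_prop

theorem contDiff_casimir : ContDiff ℝ ∞ casimir := by
  unfold casimir
  simp only [dotProduct, Fin.sum_univ_three]
  fun_prop

theorem fderiv_hamH (ε₀ ε₁ lam : ℝ) (u v : Phase) :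
    fderiv ℝ (hamH ε₀ ε₁ lam) u v =
      1 / 2 * (mom u 0 * mom v 0 + mom u 1 * mom v 1) + (mom u 2 - lam) * mom v 2
        - ε₁ * (fa v 1 * mom u 2 - fa v 2 * mom u 1 + fb v 2 * mom u 0 - fb v 0 * mom u 2
          + fa u 1 * mom v 2 - fa u 2 * mom v 1 + fb u 2 * mom v 0 - fb u 0 * mom v 2)
        - ε₀ * (fa v 0 + fb v 1) := by
  unfold hamH
  simp (disch := fun_prop) only [fderiv_fun_add, fderiv_fun_sub, fderiv_fun_mul, fderiv_fun_pow,
    fderiv_fun_const, fderiv_mom_apply, fderiv_fa_apply, fderiv_fb_apply, Pi.zero_apply,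
    add_apply, sub_apply, smul_apply, zero_apply, smul_eq_mul]
  ring

theorem fderiv_casimir (u v : Phase) :
    fderiv ℝ casimir u v =
      (2 * (fa u ⬝ᵥ fa v), 2 * (fb u ⬝ᵥ fb v), fa u ⬝ᵥ fb v + fb u ⬝ᵥ fa v) := by
  unfold casimir
  simp only [dotProduct, Fin.sum_univ_three]
  rw [DifferentiableAt.fderiv_prodMk (by fun_prop) (by fun_prop),
    DifferentiableAt.fderiv_prodMk (by fun_prop) (by fun_prop)]
  simp (disch := fun_prop) only [ContinuousLinearMap.prod_apply, fderiv_fun_add, fderiv_fun_mul,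
    fderiv_fa_apply, fderiv_fb_apply, add_apply, smul_apply, smul_eq_mul, Prod.mk.injEq]
  exact ⟨by ring, by ring, by ring⟩

/-- The angular velocity `∂H/∂M` of the gyrostat. -/
def angVel (ε₁ lam : ℝ) (u : Phase) : Fin 3 → ℝ :=
  ![mom u 0 / 2 - ε₁ * fb u 2, mom u 1 / 2 + ε₁ * fa u 2,
    mom u 2 - lam - ε₁ * (fa u 1 - fb u 0)]

theorem gyroField_eq (ε₀ ε₁ lam : ℝ) (u : Phase) :
    gyroField ε₀ ε₁ lam u =
      (![mom u 1 * (mom u 2 / 2 - lam + ε₁ * fb u 0) - ε₁ * fb u 1 * mom u 0 + ε₀ * fb u 2,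
        mom u 0 * (lam - mom u 2 / 2 + ε₁ * fa u 1) - ε₁ * fa u 0 * mom u 1 - ε₀ * fa u 2,
        ε₁ * (mom u 0 * fa u 2 + mom u 1 * fb u 2 - (fa u 0 + fb u 1) * mom u 2)
          + ε₀ * (fa u 1 - fb u 0)],
      fa u ⨯₃ angVel ε₁ lam u, fb u ⨯₃ angVel ε₁ lam u) := by
  have hM : gradM (hamH ε₀ ε₁ lam) u = angVel ε₁ lam u := by
    ext i
    fin_cases i <;> simp [gradM, fderiv_hamH, angVel, mom, fa, fb] <;> ring
  have hA : gradA (hamH ε₀ ε₁ lam) u = ![-ε₀, -ε₁ * mom u 2, ε₁ * mom u 1] := by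
    ext i
    fin_cases i <;> simp [gradA, fderiv_hamH, mom, fa, fb]
  have hB : gradB (hamH ε₀ ε₁ lam) u = ![ε₁ * mom u 2, -ε₀, -ε₁ * mom u 0] := by
    ext i
    fin_cases i <;> simp [gradB, fderiv_hamH, mom, fa, fb]
  simp only [gyroField, eulerField, hM, hA, hB, Prod.mk.injEq, and_true]
  ext i
  fin_cases i <;> simp [cross_apply, angVel] <;> ring

theorem mem_phaseSpace_iff {a b : ℝ} {u : Phase} :
    u ∈ phaseSpace a b ↔ fa u ⬝ᵥ fa u = a ^ 2 ∧ fb u ⬝ᵥ fb u = b ^ 2 ∧ fa u ⬝ᵥ fb u = 0 := by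
  simp only [phaseSpace, casimir, Set.mem_ofPred_eq, Prod.mk.injEq]

theorem mem_phaseSpace_iff_coord {a b : ℝ} {u : Phase} :
    u ∈ phaseSpace a b ↔ fa u 0 ^ 2 + fa u 1 ^ 2 + fa u 2 ^ 2 = a ^ 2 ∧
      fb u 0 ^ 2 + fb u 1 ^ 2 + fb u 2 ^ 2 = b ^ 2 ∧
      fa u 0 * fb u 0 + fa u 1 * fb u 1 + fa u 2 * fb u 2 = 0 := by
  simp only [mem_phaseSpace_iff, dotProduct, Fin.sum_univ_three, sq]

theorem isClosed_phaseSpace (a b : ℝ) : IsClosed (phaseSpace a b) :=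
  isClosed_eq contDiff_casimir.continuous continuous_const

/-- The squared length `M₁² + M₂²` of the horizontal momentum; it equals `4 w₁ w₂`. -/
def planarSq (u : Phase) : ℝ := mom u 0 ^ 2 + mom u 1 ^ 2

/-- The reduced axial momentum `M₃ / 2 - λ - ε₁ (α₂ - β₁)`, the factor in front of `M` in the
invariant relations. -/
def redMom (ε₁ lam : ℝ) (u : Phase) : ℝ := mom u 2 / 2 - lam - ε₁ * (fa u 1 - fb u 0)

/-- The shifted field `α + S e₁`. -/
def shiftA (S : ℝ) (u : Phase) : Fin 3 → ℝ := ![fa u 0 + S, fa u 1, fa u 2]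

/-- The shifted field `β + S e₂`. -/
def shiftB (S : ℝ) (u : Phase) : Fin 3 → ℝ := ![fb u 0, fb u 1 + S, fb u 2]

/-- The vector `c A × B - s D M` built from the shifted fields `A = α + S e₁`, `B = β + S e₂`
and the reduced axial momentum `D`. -/
def relCross (ε₁ lam c s S : ℝ) (u : Phase) : Fin 3 → ℝ :=
  c • (shiftA S u ⨯₃ shiftB S u) - (s * redMom ε₁ lam u) • mom u

/-- The real vector form of the invariant relations: `M` is orthogonal to both shifted fields
`A = α + S e₁`, `B = β + S e₂`, and `c A × B = s D M` with the reduced axial momentum `D`. The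
system `U₁ = U₂ = 0` corresponds to `(c, s) = (ε₀, S)`. A pair of coefficients is kept because
the same points satisfy the relation with `(c, s) = (δ, 1)`, `ε₀ = S δ`, which is stronger when
`ε₀ = S = 0`. -/
structure Rel (ε₁ lam c s S : ℝ) (u : Phase) : Prop where
  dot_shiftA : mom u ⬝ᵥ shiftA S u = 0
  dot_shiftB : mom u ⬝ᵥ shiftB S u = 0
  relCross_eq_zero : relCross ε₁ lam c s S u = 0

theorem rel_iff_coord {ε₁ lam c s S : ℝ} {u : Phase} :
    Rel ε₁ lam c s S u ↔
      mom u 0 * (fa u 0 + S) + mom u 1 * fa u 1 + mom u 2 * fa u 2 = 0 ∧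
      mom u 0 * fb u 0 + mom u 1 * (fb u 1 + S) + mom u 2 * fb u 2 = 0 ∧
      c * (fa u 1 * fb u 2 - fa u 2 * (fb u 1 + S)) = s * redMom ε₁ lam u * mom u 0 ∧
      c * (fa u 2 * fb u 0 - (fa u 0 + S) * fb u 2) = s * redMom ε₁ lam u * mom u 1 ∧
      c * ((fa u 0 + S) * (fb u 1 + S) - fa u 1 * fb u 0) = s * redMom ε₁ lam u * mom u 2 := by
  constructor
  · rintro ⟨ha, hb, hc⟩
    simp only [shiftA, shiftB, dotProduct, Fin.sum_univ_three] at ha hb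
    rw [relCross, sub_eq_zero] at hc
    exact ⟨ha, hb, congr_fun hc 0, congr_fun hc 1, congr_fun hc 2⟩
  · rintro ⟨ha, hb, hx, hy, hz⟩
    refine ⟨?_, ?_, sub_eq_zero.2 <| funext fun i => ?_⟩
    · simpa only [shiftA, dotProduct, Fin.sum_univ_three, Matrix.cons_val] using ha
    · simpa only [shiftB, dotProduct, Fin.sum_univ_three, Matrix.cons_val] using hb
    · fin_cases i
      exacts [hx, hy, hz]

/-- `M₂ (M·α) - M₁ (M·β)`, a multiple of `U₁`. -/
def polyU (u : Phase) : ℝ := mom u 1 * (mom u ⬝ᵥ fa u) - mom u 0 * (mom u ⬝ᵥ fb u)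

/-- `M₁ (M·α) + M₂ (M·β)`, a multiple of `S`. -/
def polyS (u : Phase) : ℝ := mom u 0 * (mom u ⬝ᵥ fa u) + mom u 1 * (mom u ⬝ᵥ fb u)

theorem contDiff_planarSq : ContDiff ℝ ∞ planarSq := by
  unfold planarSq mom
  fun_prop

theorem contDiff_polyU : ContDiff ℝ ∞ polyU := by
  unfold polyU
  simp only [dotProduct, Fin.sum_univ_three]
  fun_prop

theorem fderiv_polyU (u v : Phase) :
    fderiv ℝ polyU u v =
      mom v 1 * (mom u ⬝ᵥ fa u) + mom u 1 * (mom v ⬝ᵥ fa u + mom u ⬝ᵥ fa v)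
        - mom v 0 * (mom u ⬝ᵥ fb u) - mom u 0 * (mom v ⬝ᵥ fb u + mom u ⬝ᵥ fb v) := by
  unfold polyU
  simp only [dotProduct, Fin.sum_univ_three]
  simp (disch := fun_prop) only [fderiv_fun_add, fderiv_fun_sub, fderiv_fun_mul,
    fderiv_mom_apply, fderiv_fa_apply, fderiv_fb_apply, add_apply, sub_apply, smul_apply,
    smul_eq_mul]
  ring

theorem isOpen_setOf_planarSq_ne_zero : IsOpen {u : Phase | planarSq u ≠ 0} :=
  isOpen_ne_fun contDiff_planarSq.continuous continuous_const

theorem ofReal_planarSq (u : Phase) : (planarSq u : ℂ) =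
    (mom u 0 + Complex.I * mom u 1) * (mom u 0 - Complex.I * mom u 1) := by
  simp only [planarSq]
  push_cast
  linear_combination (mom u 1 : ℂ) ^ 2 * Complex.I_sq

theorem w₁_mul_w₂ (u : Phase) : w₁ u * w₂ u = (planarSq u : ℂ) / 4 := by
  rw [ofReal_planarSq, w₁, w₂]
  ring

theorem w₁_mul_w₂_ne_zero_iff {u : Phase} : w₁ u * w₂ u ≠ 0 ↔ planarSq u ≠ 0 := by
  simp [w₁_mul_w₂]

section Planar

variable {u : Phase}

theorem ratioPlus_eq (h : planarSq u ≠ 0) :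
    ratioPlus u = (polyS u - Complex.I * polyU u) / planarSq u := by
  have h' : (planarSq u : ℂ) ≠ 0 := mod_cast h
  rw [ofReal_planarSq] at h' ⊢
  rw [ratioPlus, div_eq_div_iff (left_ne_zero_of_mul h') h']
  simp only [polyS, polyU]
  push_cast
  linear_combination -(mom u 0 + Complex.I * mom u 1) * mom u 1 * (mom u ⬝ᵥ fb u : ℝ) *
    Complex.I_sq

theorem ratioMinus_eq (h : planarSq u ≠ 0) :
    ratioMinus u = (polyS u + Complex.I * polyU u) / planarSq u := by
  have h' : (planarSq u : ℂ) ≠ 0 := mod_cast h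
  rw [ofReal_planarSq] at h' ⊢
  rw [ratioMinus, div_eq_div_iff (right_ne_zero_of_mul h') h']
  simp only [polyS, polyU]
  push_cast
  linear_combination -(mom u 0 - Complex.I * mom u 1) * mom u 1 * (mom u ⬝ᵥ fb u : ℝ) *
    Complex.I_sq

theorem U₁_eq (h : planarSq u ≠ 0) : U₁ u = polyU u • (-2 * Complex.I / planarSq u) := by
  rw [U₁, ratioPlus_eq h, ratioMinus_eq h, Complex.real_smul]
  ring

theorem intS_eq (h : planarSq u ≠ 0) : intS u = ((-polyS u / planarSq u : ℝ) : ℂ) := by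
  rw [intS, ratioPlus_eq h, ratioMinus_eq h]
  push_cast
  ring

theorem U₁_eq_zero_iff (h : planarSq u ≠ 0) : U₁ u = 0 ↔ polyU u = 0 := by
  simp [U₁_eq h, h]

theorem fderiv_U₁ (h : planarSq u ≠ 0) (hU : polyU u = 0) (v : Phase) :
    fderiv ℝ U₁ u v = fderiv ℝ polyU u v • (-2 * Complex.I / planarSq u) := by
  have hev : U₁ =ᶠ[𝓝 u] fun q => polyU q • (-2 * Complex.I / planarSq q) :=
    eventually_of_mem (isOpen_setOf_planarSq_ne_zero.mem_nhds h) fun q hq => U₁_eq hq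
  have hP : DifferentiableAt ℝ (fun q => -2 * Complex.I / (planarSq q : ℂ)) u := by
    have := Complex.ofRealCLM.differentiableAt.comp u (contDiff_planarSq.differentiable (by simp) u)
    simp only [div_eq_mul_inv]
    exact (this.inv (Complex.ofReal_ne_zero.2 h)).const_mul _
  rw [hev.fderiv_eq, fderiv_fun_smul (contDiff_polyU.differentiable (by simp) u) hP, hU, zero_smul,
    zero_add, ContinuousLinearMap.smulRight_apply]

theorem U₂_eq (ε₀ ε₁ lam : ℝ) (h : planarSq u ≠ 0) (hU : polyU u = 0) :
    U₂ ε₀ ε₁ lam u = ((-2 * fderiv ℝ polyU u (gyroField ε₀ ε₁ lam u) : ℝ) : ℂ) := by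
  have h' : (planarSq u : ℂ) ≠ 0 := mod_cast h
  rw [U₂, primeDeriv, fderiv_U₁ h hU, mul_assoc 4, w₁_mul_w₂, Complex.real_smul]
  field_simp
  push_cast
  linear_combination 2 * (fderiv ℝ polyU u (gyroField ε₀ ε₁ lam u) : ℂ) * Complex.I_sq

end Planar

theorem fderiv_polyU_gyroField {ε₀ ε₁ lam S : ℝ} {u : Phase} (ha : mom u ⬝ᵥ shiftA S u = 0)
    (hb : mom u ⬝ᵥ shiftB S u = 0) :
    fderiv ℝ polyU u (gyroField ε₀ ε₁ lam u) =
      S * redMom ε₁ lam u * planarSq u - ε₀ * (mom u 0 * (shiftA S u ⨯₃ shiftB S u) 0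
        + mom u 1 * (shiftA S u ⨯₃ shiftB S u) 1) := by
  rw [fderiv_polyU, gyroField_eq]
  simp only [shiftA, shiftB, angVel, redMom, planarSq, cross_apply, dotProduct, mom, fa, fb,
    Fin.sum_univ_three, Matrix.cons_val] at *
  linear_combination
    (mom u 0 * (lam - mom u 2 / 2 + ε₁ * (fa u 1 - fb u 0)) - ε₁ * (fa u 0 + fb u 1) * mom u 1
        - ε₀ * fa u 2) * ha
      - (mom u 1 * (mom u 2 / 2 - lam - ε₁ * (fa u 1 - fb u 0))
        - ε₁ * (fa u 0 + fb u 1) * mom u 0 + ε₀ * fb u 2) * hb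

theorem polyU_eq_zero_and_polyS_eq {S : ℝ} {u : Phase} (ha : mom u ⬝ᵥ shiftA S u = 0)
    (hb : mom u ⬝ᵥ shiftB S u = 0) : polyU u = 0 ∧ polyS u = -S * planarSq u := by
  simp only [shiftA, shiftB, polyU, polyS, planarSq, dotProduct, Fin.sum_univ_three,
    Matrix.cons_val] at *
  constructor
  · linear_combination mom u 1 * ha - mom u 0 * hb
  · linear_combination mom u 0 * ha + mom u 1 * hb

theorem intS_eq_of_dot_shift {S : ℝ} {u : Phase} (h : planarSq u ≠ 0)
    (ha : mom u ⬝ᵥ shiftA S u = 0) (hb : mom u ⬝ᵥ shiftB S u = 0) : intS u = S := by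
  rw [intS_eq h, (polyU_eq_zero_and_polyS_eq ha hb).2, neg_mul, neg_neg, mul_div_cancel_right₀ _ h]

theorem dot_shift_eq_zero_of_polyU {S : ℝ} {u : Phase} (h : planarSq u ≠ 0) (hU : polyU u = 0)
    (hS : polyS u = -S * planarSq u) : mom u ⬝ᵥ shiftA S u = 0 ∧ mom u ⬝ᵥ shiftB S u = 0 := by
  simp only [shiftA, shiftB, polyU, polyS, planarSq, dotProduct, Fin.sum_univ_three,
    Matrix.cons_val] at *
  constructor <;> refine mul_left_cancel₀ h ?_
  · linear_combination mom u 1 * hU + mom u 0 * hS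
  · linear_combination -mom u 0 * hU + mom u 1 * hS

theorem relCross_cross_mom (ε₁ lam c s : ℝ) {S : ℝ} {u : Phase}
    (ha : mom u ⬝ᵥ shiftA S u = 0) (hb : mom u ⬝ᵥ shiftB S u = 0) :
    relCross ε₁ lam c s S u ⨯₃ mom u = 0 := by
  rw [relCross, map_sub, map_smul, map_smul, LinearMap.sub_apply, LinearMap.smul_apply,
    LinearMap.smul_apply, cross_cross_eq_zero_of_dot ha hb, cross_self, smul_zero, smul_zero,
    sub_zero]

/-- The second invariant relation `U₂ = 0` as a polynomial equation, modulo `U₁ = 0`. -/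
def polyV (ε₀ ε₁ lam : ℝ) (u : Phase) : ℝ :=
  ε₀ * planarSq u * (mom u 0 * (fa u ⨯₃ fb u) 0 + mom u 1 * (fa u ⨯₃ fb u) 1)
    + ε₀ * polyS u * (mom u 0 * fa u 2 + mom u 1 * fb u 2)
    + planarSq u * polyS u * redMom ε₁ lam u

theorem contDiff_polyV (ε₀ ε₁ lam : ℝ) : ContDiff ℝ ∞ (polyV ε₀ ε₁ lam) := by
  unfold polyV polyS planarSq redMom
  simp only [dotProduct, Fin.sum_univ_three, cross_apply, Matrix.cons_val]
  fun_prop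

section Relations

variable {ε₀ ε₁ lam S : ℝ} {u : Phase}

theorem polyV_eq (hS : polyS u = -S * planarSq u) : polyV ε₀ ε₁ lam u = planarSq u *
    (mom u 0 * relCross ε₁ lam ε₀ S S u 0 + mom u 1 * relCross ε₁ lam ε₀ S S u 1) := by
  simp only [polyV, hS, relCross, shiftA, shiftB, planarSq, cross_apply, Matrix.cons_val,
    Pi.sub_apply, Pi.smul_apply, smul_eq_mul]
  ring

theorem rel_iff_polyV_eq_zero (h : planarSq u ≠ 0) (hU : polyU u = 0)
    (hS : polyS u = -S * planarSq u) : Rel ε₁ lam ε₀ S S u ↔ polyV ε₀ ε₁ lam u = 0 := by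
  obtain ⟨ha, hb⟩ := dot_shift_eq_zero_of_polyU h hU hS
  rw [polyV_eq hS, mul_eq_zero, or_iff_right h]
  refine ⟨fun hr => ?_, fun hV => ⟨ha, hb, ?_⟩⟩
  · simp [hr.relCross_eq_zero]
  · exact eq_zero_of_cross_eq_zero (relCross_cross_mom _ _ _ _ ha hb) h hV

theorem exists_rel_iff (h : planarSq u ≠ 0) :
    (∃ S, Rel ε₁ lam ε₀ S S u) ↔ polyU u = 0 ∧ polyV ε₀ ε₁ lam u = 0 := by
  constructor
  · rintro ⟨S, hS⟩
    obtain ⟨hU, hp⟩ := polyU_eq_zero_and_polyS_eq hS.dot_shiftA hS.dot_shiftB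
    exact ⟨hU, (rel_iff_polyV_eq_zero h hU hp).1 hS⟩
  · rintro ⟨hU, hV⟩
    exact ⟨-polyS u / planarSq u, (rel_iff_polyV_eq_zero h hU (by field_simp)).2 hV⟩

theorem polyV_eq_of_polyU_eq_zero (h : planarSq u ≠ 0) (hU : polyU u = 0) :
    polyV ε₀ ε₁ lam u =
      -planarSq u * fderiv ℝ polyU u (gyroField ε₀ ε₁ lam u) := by
  have hS : polyS u = -(-polyS u / planarSq u) * planarSq u := by field_simp
  obtain ⟨ha, hb⟩ := dot_shift_eq_zero_of_polyU h hU hS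
  rw [fderiv_polyU_gyroField ha hb, polyV_eq hS, relCross]
  simp only [planarSq, Pi.sub_apply, Pi.smul_apply, smul_eq_mul]
  ring

theorem mem_relationSet_iff {a b : ℝ} : u ∈ relationSet ε₀ ε₁ lam a b ↔
    u ∈ phaseSpace a b ∧ planarSq u ≠ 0 ∧ polyU u = 0 ∧ polyV ε₀ ε₁ lam u = 0 := by
  simp only [relationSet, Set.mem_ofPred_eq, w₁_mul_w₂_ne_zero_iff]
  refine and_congr_right fun _ => and_congr_right fun h => ?_
  rw [U₁_eq_zero_iff h]
  refine and_congr_right fun hU => ?_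
  rw [U₂_eq ε₀ ε₁ lam h hU, polyV_eq_of_polyU_eq_zero h hU]
  simp [h]

theorem mem_relationSet_iff_exists_rel {a b : ℝ} : u ∈ relationSet ε₀ ε₁ lam a b ↔
    u ∈ phaseSpace a b ∧ planarSq u ≠ 0 ∧ ∃ S, Rel ε₁ lam ε₀ S S u := by
  rw [mem_relationSet_iff]
  exact and_congr_right fun _ => and_congr_right fun h => (exists_rel_iff h).symm

theorem planarSq_ne_zero_of_mem_relationSet {a b : ℝ} (hu : u ∈ relationSet ε₀ ε₁ lam a b) :
    planarSq u ≠ 0 :=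
  w₁_mul_w₂_ne_zero_iff.1 hu.2.1

end Relations

section SetM₃

variable {ε₀ ε₁ lam a b : ℝ} {u : Phase}

theorem mem_phaseSpace_of_mem_setM₃ (hu : u ∈ setM₃ ε₀ ε₁ lam a b) : u ∈ phaseSpace a b :=
  closure_minimal (fun _ hu => hu.1) (isClosed_phaseSpace a b) hu

theorem poly_eq_zero_of_mem_setM₃ (hu : u ∈ setM₃ ε₀ ε₁ lam a b) :
    polyU u = 0 ∧ polyV ε₀ ε₁ lam u = 0 :=
  closure_minimal (t := {u | polyU u = 0 ∧ polyV ε₀ ε₁ lam u = 0})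
    (fun _ hv => (mem_relationSet_iff.1 hv).2.2)
    ((isClosed_eq contDiff_polyU.continuous continuous_const).inter
      (isClosed_eq (contDiff_polyV ε₀ ε₁ lam).continuous continuous_const)) hu

theorem mem_relationSet_of_mem_setM₃ (hu : u ∈ setM₃ ε₀ ε₁ lam a b) (h : planarSq u ≠ 0) :
    u ∈ relationSet ε₀ ε₁ lam a b :=
  mem_relationSet_iff.2 ⟨mem_phaseSpace_of_mem_setM₃ hu, h, poly_eq_zero_of_mem_setM₃ hu⟩

end SetM₃

/-! ### The general integrals on the relation set -/

theorem Rel.ne_zero {ε₀ ε₁ lam a b S : ℝ} {u : Phase} (h : Rel ε₁ lam ε₀ S S u)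
    (hu : u ∈ phaseSpace a b) (ha : a ≠ 0) (hb : b ≠ 0) (hε : ε₀ ≠ 0) : S ≠ 0 := by
  rintro rfl
  have hc : fa u ⨯₃ fb u = 0 := by
    have h0 := h.relCross_eq_zero
    rw [relCross, zero_mul, zero_smul, sub_zero, smul_eq_zero_iff_right hε] at h0
    simpa [shiftA, shiftB, cross_apply] using h0
  obtain ⟨hA, hB, hAB⟩ := mem_phaseSpace_iff.1 hu
  have hN := cross_dot_cross (fa u) (fb u) (fa u) (fb u)
  rw [hc, hA, hB, hAB, zero_mul, sub_zero, zero_dotProduct, zero_eq_mul] at hN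
  simp [ha, hb] at hN

/-- Where `S ≠ 0` one divides the relations by `S`; where `S = 0` (so `ε₀ = 0`), both `M` and
`α × β` are orthogonal to `α` and `β`, hence parallel. -/
theorem Rel.exists_div {ε₀ ε₁ lam a b S : ℝ} {u : Phase} (h : Rel ε₁ lam ε₀ S S u)
    (hu : u ∈ phaseSpace a b) (ha : a ≠ 0) (hb : b ≠ 0) :
    ∃ δ, ε₀ = S * δ ∧ Rel ε₁ lam δ 1 S u := by
  rcases eq_or_ne S 0 with rfl | hS
  · have hε : ε₀ = 0 := not_imp_comm.1 (h.ne_zero hu ha hb) (by simp)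
    obtain ⟨hA, hB, hAB⟩ := mem_phaseSpace_iff.1 hu
    have hsA : shiftA 0 u = fa u := by ext i; fin_cases i <;> simp [shiftA]
    have hsB : shiftB 0 u = fb u := by ext i; fin_cases i <;> simp [shiftB]
    have hpar := dot_cross_smul_cross h.dot_shiftA h.dot_shiftB
    have hN : a ^ 2 * b ^ 2 ≠ 0 := by positivity
    rw [hsA, hsB, cross_dot_cross, hA, hB, hAB, zero_mul, sub_zero] at hpar
    refine ⟨redMom ε₁ lam u * (mom u ⬝ᵥ fa u ⨯₃ fb u) / (a ^ 2 * b ^ 2), by simp [hε],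
      h.dot_shiftA, h.dot_shiftB, ?_⟩
    rw [relCross, hsA, hsB, mul_div_right_comm, mul_smul, hpar, smul_smul, one_mul,
      div_mul_cancel₀ _ hN, sub_self]
  · refine ⟨ε₀ / S, by field_simp, h.dot_shiftA, h.dot_shiftB, ?_⟩
    refine (smul_eq_zero_iff_right hS).1 (Eq.trans ?_ h.relCross_eq_zero)
    rw [relCross, relCross, smul_sub, smul_smul, smul_smul, mul_div_cancel₀ _ hS, one_mul]

/-- The product `(δ + 2 ε₁²) T`, where `ε₀ = S δ`. -/
def scaledT (ε₁ δ : ℝ) (u : Phase) : ℝ :=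
  δ * ((fa u 0 - fb u 1) ^ 2 + (fa u 1 + fb u 0) ^ 2 + (fa u 2 ^ 2 + fb u 2 ^ 2))
    - planarSq u / 2 + 2 * ε₁ * (fb u 2 * mom u 0 - fa u 2 * mom u 1)

section Integrals

variable (ε₁ lam S δ : ℝ) (u : Phase)

theorem hamH_eq : 2 * hamH (S * δ) ε₁ lam u =
    lam ^ 2 + 2 * S ^ 2 * δ + δ * (fa u ⬝ᵥ fa u + fb u ⬝ᵥ fb u) - scaledT ε₁ δ u
      - 2 * relCross ε₁ lam δ 1 S u 2 := by
  simp only [hamH, scaledT, relCross, shiftA, shiftB, redMom, planarSq, cross_apply, dotProduct,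
    Fin.sum_univ_three, Matrix.cons_val, Pi.sub_apply, Pi.smul_apply, smul_eq_mul]
  ring

theorem intG_eq : 2 * intG (S * δ) ε₁ lam u =
    2 * δ * ((fa u ⬝ᵥ fa u) * (fb u ⬝ᵥ fb u) - (fa u ⬝ᵥ fb u) ^ 2)
      + S ^ 2 * δ * (fa u ⬝ᵥ fa u + fb u ⬝ᵥ fb u) - S ^ 2 * scaledT ε₁ δ u
      - S * (mom u ⬝ᵥ shiftA S u * mom u 0 + mom u ⬝ᵥ shiftB S u * mom u 1)
      + ((mom u ⬝ᵥ shiftA S u) ^ 2 + (mom u ⬝ᵥ shiftB S u) ^ 2) / 2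
      - 2 * (fa u ⨯₃ fb u ⬝ᵥ relCross ε₁ lam δ 1 S u)
      + 2 * ε₁ * (((fa u ⨯₃ fb u) 1 + S * fb u 2) * (mom u ⬝ᵥ shiftA S u)
        - ((fa u ⨯₃ fb u) 0 + S * fa u 2) * (mom u ⬝ᵥ shiftB S u)) := by
  simp only [intG, scaledT, relCross, shiftA, shiftB, redMom, planarSq, cross_apply, dotProduct,
    Fin.sum_univ_three, Matrix.cons_val, Pi.sub_apply, Pi.smul_apply, smul_eq_mul]
  ring

/-- The quadratic form in the left sides of the relations by which, up to Casimir functions, `K`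
differs from a function of `H` and `G`. -/
def relQuad : ℝ :=
  2 * δ * ((mom u ⬝ᵥ shiftA S u) ^ 2 + (mom u ⬝ᵥ shiftB S u) ^ 2)
    + 8 * ε₁ * (mom u ⬝ᵥ shiftA S u * relCross ε₁ lam δ 1 S u 1
      - mom u ⬝ᵥ shiftB S u * relCross ε₁ lam δ 1 S u 0)
    - 4 * (relCross ε₁ lam δ 1 S u 0 ^ 2 + relCross ε₁ lam δ 1 S u 1 ^ 2
      + relCross ε₁ lam δ 1 S u 2 ^ 2)

theorem intK_eq : 4 * intK (S * δ) ε₁ lam u =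
    (2 * hamH (S * δ) ε₁ lam u - lam ^ 2 - 2 * S ^ 2 * δ
        + 2 * ε₁ ^ 2 * (fa u ⬝ᵥ fa u + fb u ⬝ᵥ fb u)) ^ 2
      - 8 * (δ + 2 * ε₁ ^ 2) * intG (S * δ) ε₁ lam u
      + 4 * (δ ^ 2 - 4 * ε₁ ^ 4) * ((fa u ⬝ᵥ fa u) * (fb u ⬝ᵥ fb u) - (fa u ⬝ᵥ fb u) ^ 2)
      + 4 * (δ + 2 * ε₁ ^ 2) * δ * S ^ 2 * (fa u ⬝ᵥ fa u + fb u ⬝ᵥ fb u)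
      + relQuad ε₁ lam S δ u := by
  simp only [intK, hamH, intG, relQuad, relCross, shiftA, shiftB, redMom, cross_apply, dotProduct,
    Fin.sum_univ_three, Matrix.cons_val, Pi.sub_apply, Pi.smul_apply, smul_eq_mul]
  ring

end Integrals

section Values

variable {ε₁ lam a b S δ : ℝ} {u : Phase}

theorem Rel.hamH_eq (h : Rel ε₁ lam δ 1 S u) (hu : u ∈ phaseSpace a b) :
    2 * hamH (S * δ) ε₁ lam u =
      lam ^ 2 + 2 * S ^ 2 * δ + δ * (a ^ 2 + b ^ 2) - scaledT ε₁ δ u := by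
  obtain ⟨hA, hB, -⟩ := mem_phaseSpace_iff.1 hu
  rw [GTFG.hamH_eq, h.relCross_eq_zero, hA, hB, Pi.zero_apply, mul_zero, sub_zero]

theorem Rel.intG_eq (h : Rel ε₁ lam δ 1 S u) (hu : u ∈ phaseSpace a b) :
    2 * intG (S * δ) ε₁ lam u =
      2 * δ * (a ^ 2 * b ^ 2) + S ^ 2 * δ * (a ^ 2 + b ^ 2) - S ^ 2 * scaledT ε₁ δ u := by
  obtain ⟨hA, hB, hAB⟩ := mem_phaseSpace_iff.1 hu
  rw [GTFG.intG_eq, h.relCross_eq_zero, h.dot_shiftA, h.dot_shiftB, dotProduct_zero, hA, hB, hAB]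
  ring

theorem Rel.intK_eq (h : Rel ε₁ lam δ 1 S u) (hu : u ∈ phaseSpace a b) :
    4 * intK (S * δ) ε₁ lam u =
      (δ + 2 * ε₁ ^ 2) ^ 2 * ((a ^ 2 - b ^ 2) ^ 2)
        + scaledT ε₁ δ u * (scaledT ε₁ δ u
          + (δ + 2 * ε₁ ^ 2) * (4 * S ^ 2 - 2 * (a ^ 2 + b ^ 2))) := by
  obtain ⟨hA, hB, hAB⟩ := mem_phaseSpace_iff.1 hu
  rw [GTFG.intK_eq, relQuad, h.relCross_eq_zero, h.dot_shiftA, h.dot_shiftB, h.hamH_eq hu,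
    Pi.zero_apply, Pi.zero_apply, Pi.zero_apply, hA, hB, hAB]
  linear_combination -4 * (δ + 2 * ε₁ ^ 2) * h.intG_eq hu

theorem denT_eq (hS : intS u = S) : denT (S * δ) ε₁ u = ((S * (δ + 2 * ε₁ ^ 2) : ℝ) : ℂ) := by
  rw [denT, hS]
  push_cast
  ring

theorem x₁_mul_x₂ (u : Phase) :
    x₁ u * x₂ u = (((fa u 0 - fb u 1) ^ 2 + (fa u 1 + fb u 0) ^ 2 : ℝ) : ℂ) := by
  simp only [x₁, x₂]
  push_cast
  linear_combination -((fa u 1 : ℂ) + fb u 0) ^ 2 * Complex.I_sq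

theorem z₁_mul_z₂ (u : Phase) : z₁ u * z₂ u = ((fa u 2 ^ 2 + fb u 2 ^ 2 : ℝ) : ℂ) := by
  simp only [z₁, z₂]
  push_cast
  linear_combination -(fb u 2 : ℂ) ^ 2 * Complex.I_sq

theorem w₁_add_mul_w₂_sub (ε₁ : ℝ) (u : Phase) :
    (w₁ u + Complex.I * ε₁ * z₁ u) * (w₂ u - Complex.I * ε₁ * z₂ u) =
      ((planarSq u / 4 + ε₁ ^ 2 * (fa u 2 ^ 2 + fb u 2 ^ 2)
        - ε₁ * (fb u 2 * mom u 0 - fa u 2 * mom u 1) : ℝ) : ℂ) := by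
  have hexp : (w₁ u + Complex.I * ε₁ * z₁ u) * (w₂ u - Complex.I * ε₁ * z₂ u) =
      w₁ u * w₂ u - Complex.I ^ 2 * ε₁ ^ 2 * (z₁ u * z₂ u)
        + Complex.I * ε₁ * (z₁ u * w₂ u - w₁ u * z₂ u) := by ring
  rw [hexp, w₁_mul_w₂, z₁_mul_z₂]
  simp only [z₁, z₂, w₁, w₂]
  push_cast
  linear_combination (-(ε₁ : ℂ) ^ 2 * ((fa u 2 : ℂ) ^ 2 + (fb u 2 : ℂ) ^ 2)
    + ε₁ * ((fb u 2 : ℂ) * mom u 0 - fa u 2 * mom u 1)) * Complex.I_sq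

theorem intT_eq (hS : intS u = S) (h0 : S ≠ 0) (hd : δ + 2 * ε₁ ^ 2 ≠ 0) :
    intT (S * δ) ε₁ u = ((scaledT ε₁ δ u / (δ + 2 * ε₁ ^ 2) : ℝ) : ℂ) := by
  rw [intT, denT_eq hS, x₁_mul_x₂, z₁_mul_z₂, w₁_add_mul_w₂_sub, hS]
  norm_cast
  obtain ⟨d, rfl⟩ : ∃ d, δ = d - 2 * ε₁ ^ 2 := ⟨_, (add_sub_cancel_right _ _).symm⟩
  rw [sub_add_cancel] at hd ⊢
  rw [scaledT]
  field_simp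
  ring

theorem Rel.integrals_eq {p r : ℝ} (h : Rel ε₁ lam δ 1 S u) (hu : u ∈ phaseSpace a b)
    (hW : planarSq u ≠ 0) (hS : S ≠ 0) (hd : δ + 2 * ε₁ ^ 2 ≠ 0)
    (hp : p ^ 2 = a ^ 2 + b ^ 2) (hr : r ^ 2 = a ^ 2 - b ^ 2) :
    (hamH (S * δ) ε₁ lam u : ℂ) = ((S * δ : ℝ) : ℂ) * intS u
        + ((S * δ : ℝ) : ℂ) / (2 * intS u) * ((p : ℂ) ^ 2 - intT (S * δ) ε₁ u)
        - (ε₁ : ℂ) ^ 2 * intT (S * δ) ε₁ u + (lam : ℂ) ^ 2 / 2 ∧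
    (intK (S * δ) ε₁ lam u : ℂ) = (((S * δ : ℝ) : ℂ) + 2 * (ε₁ : ℂ) ^ 2 * intS u) ^ 2 *
        ((r : ℂ) ^ 4 + intT (S * δ) ε₁ u * (intT (S * δ) ε₁ u + 4 * intS u ^ 2
          - 2 * (p : ℂ) ^ 2)) / (4 * intS u ^ 2) ∧
    (intG (S * δ) ε₁ lam u : ℂ) =
        ((S * δ : ℝ) : ℂ) * ((p : ℂ) ^ 4 - (r : ℂ) ^ 4 + 2 * (p : ℂ) ^ 2 * intS u ^ 2)
          / (4 * intS u)
        - 1 / 2 * intS u * (((S * δ : ℝ) : ℂ) + 2 * (ε₁ : ℂ) ^ 2 * intS u) *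
          intT (S * δ) ε₁ u := by
  have hiS := intS_eq_of_dot_shift hW h.dot_shiftA h.dot_shiftB
  obtain ⟨T, hT⟩ : ∃ T, T = scaledT ε₁ δ u / (δ + 2 * ε₁ ^ 2) := ⟨_, rfl⟩
  have hτ : scaledT ε₁ δ u = (δ + 2 * ε₁ ^ 2) * T := by rw [hT, mul_div_cancel₀ _ hd]
  have hp4 : p ^ 4 = (a ^ 2 + b ^ 2) ^ 2 := by rw [← hp]; ring
  have hr4 : r ^ 4 = (a ^ 2 - b ^ 2) ^ 2 := by rw [← hr]; ring
  have hH := h.hamH_eq hu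
  have hK := h.intK_eq hu
  have hG := h.intG_eq hu
  rw [hτ] at hH hK hG
  rw [intT_eq hiS hS hd, hiS, ← hT, one_div_mul_eq_div]
  norm_cast
  rw [hp, hp4, hr4]
  refine ⟨?_, ?_, ?_⟩ <;> field_simp
  · linear_combination hH
  · linear_combination hK
  · linear_combination 4 * hG

end Values

theorem fderiv_hamH_gyroField (ε₀ ε₁ lam : ℝ) (u : Phase) :
    fderiv ℝ (hamH ε₀ ε₁ lam) u (gyroField ε₀ ε₁ lam u) = 0 := by
  rw [gyroField_eq, fderiv_hamH]
  simp only [angVel, cross_apply, mom, fa, fb, Matrix.cons_val]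
  ring

/-! ### Invariance of `𝔐₃` -/

theorem planarSq_eq_zero_iff {u : Phase} : planarSq u = 0 ↔ mom u 0 = 0 ∧ mom u 1 = 0 := by
  rw [planarSq, add_eq_zero_iff_of_nonneg (sq_nonneg _) (sq_nonneg _), sq_eq_zero_iff,
    sq_eq_zero_iff]

theorem contDiff_gyroField (ε₀ ε₁ lam : ℝ) : ContDiff ℝ 1 (gyroField ε₀ ε₁ lam) := by
  rw [funext (gyroField_eq ε₀ ε₁ lam)]
  simp only [angVel, cross_apply, mom, fa, fb, Matrix.cons_val]
  fun_prop

theorem isInvariantSet_phaseSpace (ε₀ ε₁ lam a b : ℝ) :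
    IsInvariantSet (gyroField ε₀ ε₁ lam) (phaseSpace a b) := by
  refine isInvariantSet_setOf_eq_of_fderiv_eq_zero (contDiff_casimir.differentiable (by simp))
    (fun u => ?_) _
  have hskew : ∀ v w Ω : Fin 3 → ℝ, v ⬝ᵥ w ⨯₃ Ω + w ⬝ᵥ v ⨯₃ Ω = 0 := fun v w Ω => by
    simp only [cross_apply, dotProduct, Fin.sum_univ_three, Matrix.cons_val]
    ring
  rw [fderiv_casimir, gyroField_eq, dot_self_cross, dot_self_cross, hskew, mul_zero,
    Prod.mk_zero_zero, Prod.mk_zero_zero]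

theorem isInvariantSet_hamH_level (ε₀ ε₁ lam c : ℝ) :
    IsInvariantSet (gyroField ε₀ ε₁ lam) {u | hamH ε₀ ε₁ lam u = c} :=
  isInvariantSet_setOf_eq_of_fderiv_eq_zero ((contDiff_hamH _ _ _).differentiable (by simp))
    (fderiv_hamH_gyroField _ _ _) c

/-- The left sides of the invariant relations with coefficients `(c, s) = (ε₀, S)`. -/
def relMap (ε₀ ε₁ lam S : ℝ) (u : Phase) : Fin 5 → ℝ :=
  ![mom u ⬝ᵥ shiftA S u, mom u ⬝ᵥ shiftB S u, relCross ε₁ lam ε₀ S S u 0,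
    relCross ε₁ lam ε₀ S S u 1, relCross ε₁ lam ε₀ S S u 2]

/-- The matrix of the linear system satisfied by `relMap` along trajectories. -/
def relMatrix (ε₀ ε₁ lam S : ℝ) (u : Phase) : Matrix (Fin 5) (Fin 5) ℝ :=
  !![-ε₁ * fb u 1, ε₁ * fa u 1, 0, -1, 0;
    ε₁ * fb u 0, -ε₁ * fa u 0, 1, 0, 0;
    -S * ε₁ * redMom ε₁ lam u, S * ε₀ / 2, -S * ε₁, angVel ε₁ lam u 2, -angVel ε₁ lam u 1;
    -(S * ε₀ / 2), -S * ε₁ * redMom ε₁ lam u, -angVel ε₁ lam u 2, -S * ε₁, angVel ε₁ lam u 0;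
    0, 0, angVel ε₁ lam u 1, -angVel ε₁ lam u 0, 0]

section

variable (ε₀ ε₁ lam S : ℝ)

theorem relMap_eq_zero_iff {u : Phase} : relMap ε₀ ε₁ lam S u = 0 ↔ Rel ε₁ lam ε₀ S S u := by
  constructor
  · refine fun h => ⟨congr_fun h 0, congr_fun h 1, funext fun i => ?_⟩
    fin_cases i
    exacts [congr_fun h 2, congr_fun h 3, congr_fun h 4]
  · rintro ⟨ha, hb, hc⟩
    simp [relMap, ha, hb, hc]

theorem continuous_relMatrix : Continuous (relMatrix ε₀ ε₁ lam S) := by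
  refine continuous_matrix fun i j => ?_
  fin_cases i <;> fin_cases j <;>
  simp only [relMatrix, redMom, angVel, mom, fa, fb, Matrix.of_apply, Fin.zero_eta, Fin.mk_one,
    Fin.reduceFinMk, Matrix.cons_val] <;>
  fun_prop

theorem fderiv_relMap_gyroField (u : Phase) (i : Fin 5) :
    fderiv ℝ (fun q => relMap ε₀ ε₁ lam S q i) u (gyroField ε₀ ε₁ lam u) =
      (relMatrix ε₀ ε₁ lam S u *ᵥ relMap ε₀ ε₁ lam S u) i := by
  rw [gyroField_eq]
  fin_cases i <;>
  simp (disch := fun_prop) only [relMap, relMatrix, relCross, redMom, shiftA, shiftB, cross_apply,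
    Matrix.mulVec, dotProduct, Fin.sum_univ_succ, Fin.sum_univ_zero, Matrix.of_apply, angVel,
    Matrix.cons_val, Pi.sub_apply, Pi.smul_apply, Fin.reduceFinMk, Fin.zero_eta, Fin.mk_one,
    Fin.succ_zero_eq_one, Fin.succ_one_eq_two, Fin.reduceSucc, mom, fa, fb,
    fderiv_fun_add, fderiv_fun_sub, fderiv_fun_mul, fderiv_fun_const, fderiv_mom_apply,
    fderiv_fa_apply, fderiv_fb_apply, Pi.zero_apply, add_apply, sub_apply, smul_apply, zero_apply,
    smul_eq_mul, div_eq_mul_inv] <;>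
  ring

theorem isInvariantSet_rel :
    IsInvariantSet (gyroField ε₀ ε₁ lam) {u | Rel ε₁ lam ε₀ S S u} := by
  simp only [← relMap_eq_zero_iff]
  refine isInvariantSet_setOf_eq_zero (differentiable_pi.2 fun i => ?_)
    (continuous_relMatrix ε₀ ε₁ lam S) (fderiv_relMap_gyroField ε₀ ε₁ lam S)
  fin_cases i <;>
  simp only [relMap, relCross, redMom, shiftA, shiftB, cross_apply, dotProduct, Fin.sum_univ_three,
    Pi.sub_apply, Pi.smul_apply, smul_eq_mul, Fin.zero_eta, Fin.mk_one, Fin.reduceFinMk,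
    Matrix.cons_val, mom, fa, fb] <;>
  fun_prop

end

/-- The map `(M₁, M₂, ε₀ α₃, ε₀ β₃)`. It vanishes where `M₁`, `M₂` and their derivatives along
the system vanish, and it satisfies a linear system along trajectories. -/
def verticalMap (ε₀ : ℝ) (u : Phase) : Fin 4 → ℝ := ![mom u 0, mom u 1, ε₀ * fa u 2, ε₀ * fb u 2]

/-- The matrix of the linear system satisfied by `verticalMap` along trajectories. -/
def verticalMatrix (ε₀ ε₁ lam : ℝ) (u : Phase) : Matrix (Fin 4) (Fin 4) ℝ :=
  !![-ε₁ * fb u 1, mom u 2 / 2 - lam + ε₁ * fb u 0, 0, 1;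
    lam - mom u 2 / 2 + ε₁ * fa u 1, -ε₁ * fa u 0, -1, 0;
    -ε₀ * fa u 1 / 2, ε₀ * fa u 0 / 2, ε₁ * fa u 0, ε₁ * fa u 1;
    -ε₀ * fb u 1 / 2, ε₀ * fb u 0 / 2, ε₁ * fb u 0, ε₁ * fb u 1]

section

variable (ε₀ ε₁ lam : ℝ)

theorem continuous_verticalMatrix : Continuous (verticalMatrix ε₀ ε₁ lam) := by
  refine continuous_matrix fun i j => ?_
  fin_cases i <;> fin_cases j <;>
  simp only [verticalMatrix, mom, fa, fb, Matrix.of_apply, Fin.zero_eta, Fin.mk_one,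
    Fin.reduceFinMk, Matrix.cons_val] <;>
  fun_prop

theorem fderiv_verticalMap_gyroField (u : Phase) (i : Fin 4) :
    fderiv ℝ (fun q => verticalMap ε₀ q i) u (gyroField ε₀ ε₁ lam u) =
      (verticalMatrix ε₀ ε₁ lam u *ᵥ verticalMap ε₀ u) i := by
  rw [gyroField_eq]
  fin_cases i <;>
  simp (disch := fun_prop) only [verticalMap, verticalMatrix, cross_apply,
    Matrix.mulVec, dotProduct, Fin.sum_univ_succ, Fin.sum_univ_zero, Matrix.of_apply, angVel,
    Matrix.cons_val, Fin.reduceFinMk, Fin.zero_eta, Fin.mk_one,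
    Fin.succ_zero_eq_one, Fin.succ_one_eq_two, Fin.reduceSucc, mom, fa, fb, fderiv_fun_mul,
    fderiv_fun_const, fderiv_mom_apply, fderiv_fa_apply, fderiv_fb_apply, Pi.zero_apply,
    add_apply, smul_apply, zero_apply, smul_eq_mul] <;>
  ring

theorem isInvariantSet_verticalMap_eq_zero :
    IsInvariantSet (gyroField ε₀ ε₁ lam) {u | verticalMap ε₀ u = 0} := by
  refine isInvariantSet_setOf_eq_zero (differentiable_pi.2 fun i => ?_)
    (continuous_verticalMatrix ε₀ ε₁ lam) (fderiv_verticalMap_gyroField ε₀ ε₁ lam)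
  fin_cases i <;>
  simp only [verticalMap, mom, fa, fb, Fin.zero_eta, Fin.mk_one, Fin.reduceFinMk,
    Matrix.cons_val] <;>
  fun_prop

end

section Vertical

variable {ε₀ ε₁ lam : ℝ} {u : Phase}

theorem verticalMap_eq_zero (hW : planarSq u = 0)
    (h0 : mom (gyroField ε₀ ε₁ lam u) 0 = 0) (h1 : mom (gyroField ε₀ ε₁ lam u) 1 = 0) :
    verticalMap ε₀ u = 0 := by
  obtain ⟨hM0, hM1⟩ := planarSq_eq_zero_iff.1 hW
  simp only [gyroField_eq, mom, fa, fb, angVel, cross_apply, Matrix.cons_val] at hM0 hM1 h0 h1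
  funext i
  fin_cases i <;> simp only [verticalMap, mom, fa, fb, Fin.zero_eta, Fin.mk_one, Fin.reduceFinMk,
    Matrix.cons_val, Pi.zero_apply]
  · exact hM0
  · exact hM1
  · linear_combination (lam - u.1 2 / 2 + ε₁ * u.2.1 1) * hM0 - ε₁ * u.2.1 0 * hM1 - h1
  · linear_combination h0 - (u.1 2 / 2 - lam + ε₁ * u.2.2 0) * hM1 + ε₁ * u.2.2 1 * hM0

end Vertical

section Trajectories

variable {ε₀ ε₁ lam a b : ℝ} {γ : ℝ → Phase} {I : Set ℝ} {t₀ t : ℝ}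

theorem eventually_planarSq_ne_zero (hI : I.OrdConnected)
    (h : IsTrajectoryOn (gyroField ε₀ ε₁ lam) I γ) (ht₀ : t₀ ∈ I) (ht : t ∈ I)
    (h0 : planarSq (γ t₀) ≠ 0) (hW : planarSq (γ t) = 0) :
    ∀ᶠ s in 𝓝[I \ {t}] t, planarSq (γ s) ≠ 0 := by
  have hd : ∀ i, HasDerivWithinAt (fun s => mom (γ s) i) (mom (gyroField ε₀ ε₁ lam (γ t)) i) I t :=
    hasDerivWithinAt_pi.1 (h t ht).fst
  by_cases hd0 : mom (gyroField ε₀ ε₁ lam (γ t)) 0 = 0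
  · by_cases hd1 : mom (gyroField ε₀ ε₁ lam (γ t)) 1 = 0
    · have hv := isInvariantSet_verticalMap_eq_zero ε₀ ε₁ lam I γ hI h t ht
        (verticalMap_eq_zero hW hd0 hd1) t₀ ht₀
      exact absurd (planarSq_eq_zero_iff.2 ⟨congr_fun hv 0, congr_fun hv 1⟩) h0
    · filter_upwards [(hd 1).eventually_ne (c := 0) hd1] with s hs
      exact fun hc => hs (planarSq_eq_zero_iff.1 hc).2
  · filter_upwards [(hd 0).eventually_ne (c := 0) hd0] with s hs
    exact fun hc => hs (planarSq_eq_zero_iff.1 hc).1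

theorem mem_setM₃_of_isTrajectoryOn (hI : I.OrdConnected)
    (h : IsTrajectoryOn (gyroField ε₀ ε₁ lam) I γ) (ht₀ : t₀ ∈ I)
    (h0 : γ t₀ ∈ relationSet ε₀ ε₁ lam a b) (ht : t ∈ I) : γ t ∈ setM₃ ε₀ ε₁ lam a b := by
  obtain ⟨hp, hW, S, hS⟩ := mem_relationSet_iff_exists_rel.1 h0
  have hmem : ∀ s ∈ I, planarSq (γ s) ≠ 0 → γ s ∈ relationSet ε₀ ε₁ lam a b := fun s hs hWs =>
    mem_relationSet_iff_exists_rel.2 ⟨isInvariantSet_phaseSpace _ _ _ _ _ I γ hI h t₀ ht₀ hp s hs,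
      hWs, S, isInvariantSet_rel _ _ _ _ I γ hI h t₀ ht₀ hS s hs⟩
  by_cases hWt : planarSq (γ t) = 0
  · have hne : I.Nontrivial := ⟨t₀, ht₀, t, ht, by rintro rfl; exact hW hWt⟩
    have := accPt_principal_iff_nhdsWithin.1
      (hI.isPreconnected.preperfect_of_nontrivial hne t ht)
    refine mem_closure_of_tendsto
      ((h.continuousOn t ht).mono (Set.sdiff_subset (t := {t}))).tendsto ?_
    filter_upwards [eventually_planarSq_ne_zero hI h ht₀ ht hW hWt, self_mem_nhdsWithin]
      with s hs hsI
    exact hmem s hsI.1 hs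
  · exact subset_closure (hmem t ht hWt)

theorem isInvariantSet_setM₃ (ε₀ ε₁ lam a b : ℝ) :
    IsInvariantSet (gyroField ε₀ ε₁ lam) (setM₃ ε₀ ε₁ lam a b) :=
  isInvariantSet_closure (contDiff_gyroField ε₀ ε₁ lam)
    fun _ _ hI h _ ht₀ h0 _ ht => mem_setM₃_of_isTrajectoryOn hI h ht₀ h0 ht

theorem intS_intT_const (ha : a ≠ 0) (hb : b ≠ 0) (hI : I.OrdConnected)
    (h : IsTrajectoryOn (gyroField ε₀ ε₁ lam) I γ) (ht₀ : t₀ ∈ I) (ht : t ∈ I)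
    (h0 : γ t₀ ∈ relationSet ε₀ ε₁ lam a b) (hW : planarSq (γ t) ≠ 0) :
    intS (γ t₀) = intS (γ t) ∧
      (denT ε₀ ε₁ (γ t₀) ≠ 0 → intT ε₀ ε₁ (γ t₀) = intT ε₀ ε₁ (γ t)) := by
  obtain ⟨hp₀, hW₀, S, hS₀⟩ := mem_relationSet_iff_exists_rel.1 h0
  have hp := isInvariantSet_phaseSpace _ _ _ _ _ I γ hI h t₀ ht₀ hp₀ t ht
  have hS := isInvariantSet_rel _ _ _ _ I γ hI h t₀ ht₀ hS₀ t ht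
  have e₀ := intS_eq_of_dot_shift hW₀ hS₀.dot_shiftA hS₀.dot_shiftB
  have e := intS_eq_of_dot_shift hW hS.dot_shiftA hS.dot_shiftB
  refine ⟨e₀.trans e.symm, fun hden => ?_⟩
  obtain ⟨δ, rfl, hδ₀⟩ := hS₀.exists_div hp₀ ha hb
  obtain ⟨δ', hδ', hδ⟩ := hS.exists_div hp ha hb
  obtain ⟨hS0, hd⟩ : S ≠ 0 ∧ δ + 2 * ε₁ ^ 2 ≠ 0 := by
    rw [denT_eq e₀] at hden
    exact mul_ne_zero_iff.1 (mod_cast hden)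
  obtain rfl : δ = δ' := mul_left_cancel₀ hS0 hδ'
  have hH := isInvariantSet_hamH_level _ ε₁ lam _ I γ hI h t₀ ht₀ rfl t ht
  rw [Set.mem_ofPred_eq] at hH
  rw [intT_eq e₀ hS0 hd, intT_eq e hS0 hd,
    show scaledT ε₁ δ (γ t₀) = scaledT ε₁ δ (γ t) by
      linear_combination hδ₀.hamH_eq hp₀ - hδ.hamH_eq hp + 2 * hH]

end Trajectories

/-! ### Criticality -/

theorem contDiff_integralMap (ε₀ ε₁ lam : ℝ) : ContDiff ℝ ∞ (integralMap ε₀ ε₁ lam) := by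
  have hK : ContDiff ℝ ∞ (intK ε₀ ε₁ lam) := by
    unfold intK
    simp only [cross_apply, dotProduct, Fin.sum_univ_three, Matrix.cons_val, mom, fa, fb]
    fun_prop
  have hG : ContDiff ℝ ∞ (intG ε₀ ε₁ lam) := by
    unfold intG
    simp only [cross_apply, dotProduct, Fin.sum_univ_three, Matrix.cons_val, mom, fa, fb]
    fun_prop
  exact (contDiff_hamH ε₀ ε₁ lam).prodMk (hK.prodMk hG)

theorem fderiv_casimir_surjective {a b : ℝ} (ha : a ≠ 0) (hb : b ≠ 0) {u : Phase}
    (hu : u ∈ phaseSpace a b) : Function.Surjective (fderiv ℝ casimir u) := by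
  rintro ⟨p, q, r⟩
  obtain ⟨hA, hB, hAB⟩ := mem_phaseSpace_iff.1 hu
  refine ⟨(0, (p / (2 * a ^ 2)) • fa u + (r / b ^ 2) • fb u, (q / (2 * b ^ 2)) • fb u), ?_⟩
  simp only [fderiv_casimir, fa, fb, dotProduct_add, dotProduct_smul, smul_eq_mul] at hA hB hAB ⊢
  rw [dotProduct_comm u.2.2 u.2.1, hA, hB, hAB]
  simp only [Prod.mk.injEq, mul_zero, add_zero, zero_add]
  refine ⟨?_, ?_, ?_⟩ <;> field_simp

section CriticalPoints

variable {ε₀ ε₁ lam a b : ℝ} {u : Phase}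

theorem isCriticalPoint_of_not_surjective (ha : a ≠ 0) (hb : b ≠ 0) (hu : u ∈ phaseSpace a b)
    (h : ¬ Function.Surjective (fderiv ℝ (fun q => (casimir q, integralMap ε₀ ε₁ lam q)) u)) :
    IsCriticalPoint ε₀ ε₁ lam u := by
  refine not_le.1 fun hfin => h ?_
  have htop : (tangentSpace u).map (fderiv ℝ (integralMap ε₀ ε₁ lam) u : Phase →ₗ[ℝ] ℝ × ℝ × ℝ) =
      ⊤ :=
    Submodule.eq_top_of_finrank_eq (le_antisymm (Submodule.finrank_le _) (by simpa using hfin))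
  exact fderiv_prodMk_surjective (contDiff_casimir.differentiable (by simp) u)
    ((contDiff_integralMap _ _ _).differentiable (by simp) u) (fderiv_casimir_surjective ha hb hu)
    fun z => Submodule.mem_map.1 (htop ▸ Submodule.mem_top)

theorem fderiv_casimir_apply_eq_zero {v : Phase} (hv : fderiv ℝ casimir u v = 0) :
    fderiv ℝ (fun q => fa q ⬝ᵥ fa q) u v = 0 ∧ fderiv ℝ (fun q => fb q ⬝ᵥ fb q) u v = 0 ∧
      fderiv ℝ (fun q => fa q ⬝ᵥ fb q) u v = 0 := by
  have hc := (contDiff_casimir.differentiable (by simp) u).hasFDerivAt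
  rw [show (fun q => fa q ⬝ᵥ fa q) = fun q => (casimir q).1 from rfl,
    show (fun q => fb q ⬝ᵥ fb q) = fun q => (casimir q).2.1 from rfl,
    show (fun q => fa q ⬝ᵥ fb q) = fun q => (casimir q).2.2 from rfl,
    hc.fst.fderiv, hc.snd.fst.fderiv, hc.snd.snd.fderiv]
  simp [hv]

theorem Rel.fderiv_relQuad {S δ : ℝ} (h : Rel ε₁ lam δ 1 S u) :
    DifferentiableAt ℝ (relQuad ε₁ lam S δ) u ∧ fderiv ℝ (relQuad ε₁ lam S δ) u = 0 := by
  have hA : DifferentiableAt ℝ (fun q => mom q ⬝ᵥ shiftA S q) u := by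
    simp only [shiftA, dotProduct, Fin.sum_univ_three, Matrix.cons_val]; fun_prop
  have hB : DifferentiableAt ℝ (fun q => mom q ⬝ᵥ shiftB S q) u := by
    simp only [shiftB, dotProduct, Fin.sum_univ_three, Matrix.cons_val]; fun_prop
  have hC : ∀ i, DifferentiableAt ℝ (fun q => relCross ε₁ lam δ 1 S q i) u := fun i => by
    fin_cases i <;>
    simp only [relCross, redMom, shiftA, shiftB, cross_apply, Pi.sub_apply, Pi.smul_apply,
      smul_eq_mul, Fin.zero_eta, Fin.mk_one, Fin.reduceFinMk, Matrix.cons_val] <;>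
    fun_prop
  have h0 := h.dot_shiftA
  have h1 := h.dot_shiftB
  have h2 : ∀ i, relCross ε₁ lam δ 1 S u i = 0 := fun i => congr_fun h.relCross_eq_zero i
  unfold relQuad
  refine ⟨by fun_prop, ?_⟩
  simp (disch := fun_prop) only [fderiv_fun_add, fderiv_fun_sub, fderiv_fun_mul, fderiv_fun_pow,
    fderiv_fun_const, h0, h1, h2]
  simp

theorem Rel.fderiv_intK {S δ : ℝ} (h : Rel ε₁ lam δ 1 S u) {v : Phase}
    (hv : fderiv ℝ casimir u v = 0) :
    fderiv ℝ (intK (S * δ) ε₁ lam) u v =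
      (2 * hamH (S * δ) ε₁ lam u - lam ^ 2 - 2 * S ^ 2 * δ
          + 2 * ε₁ ^ 2 * (fa u ⬝ᵥ fa u + fb u ⬝ᵥ fb u)) * fderiv ℝ (hamH (S * δ) ε₁ lam) u v
        - 2 * (δ + 2 * ε₁ ^ 2) * fderiv ℝ (intG (S * δ) ε₁ lam) u v := by
  obtain ⟨dH, dK, dG⟩ : DifferentiableAt ℝ (hamH (S * δ) ε₁ lam) u ∧
    DifferentiableAt ℝ (intK (S * δ) ε₁ lam) u ∧ DifferentiableAt ℝ (intG (S * δ) ε₁ lam) u := by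
    have := (contDiff_integralMap (S * δ) ε₁ lam).differentiable (by simp) u
    exact ⟨this.fst, this.snd.fst, this.snd.snd⟩
  obtain ⟨dA, dB, dC⟩ : DifferentiableAt ℝ (fun q => fa q ⬝ᵥ fa q) u ∧
    DifferentiableAt ℝ (fun q => fb q ⬝ᵥ fb q) u ∧
      DifferentiableAt ℝ (fun q => fa q ⬝ᵥ fb q) u := by
    have := contDiff_casimir.differentiable (by simp) u
    exact ⟨this.fst, this.snd.fst, this.snd.snd⟩
  obtain ⟨dQ, hQ⟩ := h.fderiv_relQuad
  obtain ⟨hA, hB, hC⟩ := fderiv_casimir_apply_eq_zero hv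
  have key := congr_arg (fun f => fderiv ℝ f u v) (funext (GTFG.intK_eq ε₁ lam S δ))
  simp (disch := fun_prop) only [fderiv_fun_add, fderiv_fun_sub, fderiv_fun_mul, fderiv_fun_pow,
    fderiv_fun_const, hA, hB, hC, Pi.zero_apply, add_apply, sub_apply, smul_apply, zero_apply,
    smul_eq_mul] at key
  rw [hQ, zero_apply] at key
  linear_combination key / 4

theorem not_surjective_of_mem_relationSet (ha : a ≠ 0) (hb : b ≠ 0)
    (hu : u ∈ relationSet ε₀ ε₁ lam a b) :
    ¬ Function.Surjective (fderiv ℝ (fun q => (casimir q, integralMap ε₀ ε₁ lam q)) u) := by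
  intro hs
  obtain ⟨hp, -, S, hS⟩ := mem_relationSet_iff_exists_rel.1 hu
  obtain ⟨δ, rfl, hδ⟩ := hS.exists_div hp ha hb
  have hJ := (contDiff_integralMap (S * δ) ε₁ lam).differentiable (by simp) u
  obtain ⟨v, hv⟩ := hs (0, 0, 1, 0)
  rw [(contDiff_casimir.differentiable (by simp) u).fderiv_prodMk hJ,
    ContinuousLinearMap.prod_apply, Prod.mk.injEq] at hv
  have hK := hδ.fderiv_intK hv.1
  rw [show hamH (S * δ) ε₁ lam = fun q => (integralMap (S * δ) ε₁ lam q).1 from rfl,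
    show intK (S * δ) ε₁ lam = fun q => (integralMap (S * δ) ε₁ lam q).2.1 from rfl,
    show intG (S * δ) ε₁ lam = fun q => (integralMap (S * δ) ε₁ lam q).2.2 from rfl,
    hJ.hasFDerivAt.fst.fderiv, hJ.hasFDerivAt.snd.fst.fderiv, hJ.hasFDerivAt.snd.snd.fderiv] at hK
  simp [hv.2] at hK

theorem isCriticalPoint_of_mem_setM₃ (ha : a ≠ 0) (hb : b ≠ 0) (hu : u ∈ setM₃ ε₀ ε₁ lam a b) :
    IsCriticalPoint ε₀ ε₁ lam u :=
  isCriticalPoint_of_not_surjective ha hb (mem_phaseSpace_of_mem_setM₃ hu) <|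
    closure_minimal (fun _ hv => not_surjective_of_mem_relationSet ha hb hv)
      (isOpen_setOf_fderiv_surjective ((contDiff_casimir.prodMk
        (contDiff_integralMap ε₀ ε₁ lam)).of_le (by simp))).isClosed_compl hu

end CriticalPoints

/-! ### First variation of the relations -/

section Variations

/-- The differential of the reduced axial momentum `redMom`. -/
def redMomVar (ε₁ : ℝ) (v : Phase) : ℝ := mom v 2 / 2 - ε₁ * (fa v 1 - fb v 0)

/-- The first variation of the second invariant relation in the direction `v`, divided by
`M₁² + M₂²`, when `v` changes `M` times the shifted fields by `-σ M₁` and `-σ M₂`: keeping the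
first relation, it changes `S` at the rate `σ`. -/
def relVar (ε₀ ε₁ lam S σ : ℝ) (u v : Phase) : ℝ :=
  ε₀ * (mom u 0 * (fa v ⨯₃ shiftB S u + shiftA S u ⨯₃ fb v) 0
      + mom u 1 * (fa v ⨯₃ shiftB S u + shiftA S u ⨯₃ fb v) 1)
    - S * (redMomVar ε₁ v * planarSq u
      + redMom ε₁ lam u * (mom u 0 * mom v 0 + mom u 1 * mom v 1))
    - σ * (ε₀ * (mom u 0 * fa u 2 + mom u 1 * fb u 2) + redMom ε₁ lam u * planarSq u)

variable {ε₀ ε₁ lam S σ : ℝ} {u v : Phase}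

theorem fderiv_polyU_of_dot_shift (ha : mom u ⬝ᵥ shiftA S u = 0) (hb : mom u ⬝ᵥ shiftB S u = 0)
    (v : Phase) : fderiv ℝ polyU u v =
      mom u 1 * (mom v ⬝ᵥ shiftA S u + mom u ⬝ᵥ fa v)
        - mom u 0 * (mom v ⬝ᵥ shiftB S u + mom u ⬝ᵥ fb v) := by
  rw [fderiv_polyU]
  simp only [shiftA, shiftB, dotProduct, Fin.sum_univ_three, Matrix.cons_val] at *
  linear_combination mom v 1 * ha - mom v 0 * hb

theorem contDiff_polyS : ContDiff ℝ ∞ polyS := by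
  unfold polyS
  simp only [dotProduct, Fin.sum_univ_three]
  fun_prop

theorem fderiv_planarSq (u v : Phase) :
    fderiv ℝ planarSq u v = 2 * (mom u 0 * mom v 0 + mom u 1 * mom v 1) := by
  unfold planarSq
  simp (disch := fun_prop) only [fderiv_fun_add, fderiv_fun_pow, fderiv_mom_apply, add_apply,
    smul_apply, smul_eq_mul]
  ring

theorem fderiv_redMom (ε₁ lam : ℝ) (u v : Phase) :
    fderiv ℝ (redMom ε₁ lam) u v = redMomVar ε₁ v := by
  unfold redMom redMomVar
  simp (disch := fun_prop) only [div_eq_mul_inv, fderiv_fun_sub, fderiv_fun_mul, fderiv_fun_const,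
    fderiv_mom_apply, fderiv_fa_apply, fderiv_fb_apply, Pi.zero_apply, add_apply, sub_apply,
    smul_apply, zero_apply, smul_eq_mul]
  ring

theorem fderiv_polyS_of_dot_shift (ha : mom u ⬝ᵥ shiftA S u = 0) (hb : mom u ⬝ᵥ shiftB S u = 0)
    (hA : mom v ⬝ᵥ shiftA S u + mom u ⬝ᵥ fa v = -σ * mom u 0)
    (hB : mom v ⬝ᵥ shiftB S u + mom u ⬝ᵥ fb v = -σ * mom u 1) :
    fderiv ℝ polyS u v =
      -σ * planarSq u - 2 * S * (mom u 0 * mom v 0 + mom u 1 * mom v 1) := by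
  unfold polyS
  simp only [shiftA, shiftB, planarSq, dotProduct, Fin.sum_univ_three, Matrix.cons_val] at *
  simp (disch := fun_prop) only [fderiv_fun_add, fderiv_fun_mul, fderiv_mom_apply,
    fderiv_fa_apply, fderiv_fb_apply, add_apply, smul_apply, smul_eq_mul]
  linear_combination mom u 0 * hA + mom u 1 * hB + mom v 0 * ha + mom v 1 * hb

theorem fderiv_polyV (h : Rel ε₁ lam ε₀ S S u)
    (hA : mom v ⬝ᵥ shiftA S u + mom u ⬝ᵥ fa v = -σ * mom u 0)
    (hB : mom v ⬝ᵥ shiftB S u + mom u ⬝ᵥ fb v = -σ * mom u 1) :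
    fderiv ℝ (polyV ε₀ ε₁ lam) u v = planarSq u * relVar ε₀ ε₁ lam S σ u v := by
  obtain ⟨-, -, hx, hy, -⟩ := rel_iff_coord.1 h
  have hP : DifferentiableAt ℝ planarSq u := contDiff_planarSq.differentiable (by simp) u
  have hS : DifferentiableAt ℝ polyS u := contDiff_polyS.differentiable (by simp) u
  have hD : DifferentiableAt ℝ (redMom ε₁ lam) u := by
    unfold redMom
    fun_prop
  unfold polyV
  simp only [cross_apply, Matrix.cons_val]
  simp (disch := fun_prop) only [fderiv_fun_add, fderiv_fun_sub, fderiv_fun_mul,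
    fderiv_fun_const, fderiv_mom_apply, fderiv_fa_apply, fderiv_fb_apply, Pi.zero_apply, add_apply,
    sub_apply, smul_apply, zero_apply, smul_eq_mul, fderiv_planarSq, fderiv_redMom,
    fderiv_polyS_of_dot_shift h.dot_shiftA h.dot_shiftB hA hB,
    (polyU_eq_zero_and_polyS_eq h.dot_shiftA h.dot_shiftB).2]
  simp only [relVar, shiftA, shiftB, planarSq, cross_apply, Matrix.cons_val, Pi.add_apply]
  linear_combination (2 * (mom u 0 * mom v 0 + mom u 1 * mom v 1)) * (mom u 0 * hx + mom u 1 * hy)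
    + (mom u 0 ^ 2 + mom u 1 ^ 2) * (mom v 0 * hx + mom v 1 * hy)

end Variations

/-- The tangent vector of the phase space with momentum part `m` that rotates both fields with
angular velocity `n`. -/
def tangentVec (m n : Fin 3 → ℝ) (u : Phase) : Phase := (m, fa u ⨯₃ n, fb u ⨯₃ n)

theorem fderiv_casimir_tangentVec (m n : Fin 3 → ℝ) (u : Phase) :
    fderiv ℝ casimir u (tangentVec m n u) = 0 := by
  have hab : fa u ⬝ᵥ fb u ⨯₃ n + fb u ⬝ᵥ fa u ⨯₃ n = 0 := by
    rw [triple_product_permutation (fb u), ← dotProduct_add, cross_anticomm', dotProduct_zero]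
  rw [fderiv_casimir]
  exact Prod.ext (by simp [tangentVec, fa]) (Prod.ext (by simp [tangentVec, fb]) hab)

/-! ### Smooth points of the relation set -/

section SmoothPoints

variable {ε₀ ε₁ lam a b S : ℝ} {u : Phase}

theorem fderiv_polyU_tangentVec (ha : mom u ⬝ᵥ shiftA S u = 0) (hb : mom u ⬝ᵥ shiftB S u = 0)
    (m n : Fin 3 → ℝ) : fderiv ℝ polyU u (tangentVec m n u) =
      m ⬝ᵥ (mom u 1 • shiftA S u - mom u 0 • shiftB S u)
        + mom u ⬝ᵥ (mom u 1 • fa u - mom u 0 • fb u) ⨯₃ n := by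
  rw [fderiv_polyU_of_dot_shift ha hb]
  simp only [tangentVec, mom, fa, fb, dotProduct_sub, dotProduct_smul, map_sub, map_smul,
    LinearMap.sub_apply, LinearMap.smul_apply, smul_eq_mul]
  ring

theorem exists_fderiv_polyU_tangentVec_ne_zero (ha : a ≠ 0) (hb : b ≠ 0) (hu : u ∈ phaseSpace a b)
    (hW : planarSq u ≠ 0) (hA : mom u ⬝ᵥ shiftA S u = 0) (hB : mom u ⬝ᵥ shiftB S u = 0) :
    ∃ m n, fderiv ℝ polyU u (tangentVec m n u) ≠ 0 := by
  by_contra! h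
  simp only [fderiv_polyU_tangentVec hA hB] at h
  obtain ⟨h1, h2, h3⟩ := mem_phaseSpace_iff.1 hu
  have hV : mom u 1 • shiftA S u - mom u 0 • shiftB S u = 0 := by
    simpa only [map_zero, dotProduct_zero, add_zero, dotProduct_self_eq_zero] using
      h (mom u 1 • shiftA S u - mom u 0 • shiftB S u) 0
  have hV0 := congr_fun hV 0
  have hV1 := congr_fun hV 1
  have hV2 := congr_fun hV 2
  have hrot := h 0 ![0, 0, 1]
  simp only [shiftA, shiftB, planarSq, cross_apply, dotProduct, Fin.sum_univ_three,
    Pi.sub_apply, Pi.smul_apply, Pi.zero_apply, smul_eq_mul, Matrix.cons_val] at *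
  obtain rfl : S = 0 := mul_right_cancel₀ hW <| by
    linear_combination hrot + mom u 1 * hV0 - mom u 0 * hV1
  have hM1 : mom u 1 = 0 := mul_right_cancel₀ (pow_ne_zero 2 ha) <| by
    linear_combination fa u 0 * hV0 + fa u 1 * hV1 + fa u 2 * hV2 - mom u 1 * h1 + mom u 0 * h3
  have hM0 : mom u 0 = 0 := mul_right_cancel₀ (pow_ne_zero 2 hb) <| by
    linear_combination -fb u 0 * hV0 - fb u 1 * hV1 - fb u 2 * hV2 + mom u 1 * h3 - mom u 0 * h2
  exact hW (by rw [hM0, hM1]; ring)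

theorem isSmoothPoint_of_fderiv_polyV_ne_zero (ha : a ≠ 0) (hb : b ≠ 0)
    (hu : u ∈ relationSet ε₀ ε₁ lam a b) {v : Phase} (hv : fderiv ℝ casimir u v = 0)
    (hU : fderiv ℝ polyU u v = 0) (hV : fderiv ℝ (polyV ε₀ ε₁ lam) u v ≠ 0) :
    IsSmoothPoint (setM₃ ε₀ ε₁ lam a b) 4 u := by
  obtain ⟨hp, hW, S, h⟩ := mem_relationSet_iff_exists_rel.1 hu
  obtain ⟨m, n, hw⟩ :=
    exists_fderiv_polyU_tangentVec_ne_zero ha hb hp hW h.dot_shiftA h.dot_shiftB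
  have hcw := fderiv_casimir_tangentVec m n u
  set w := tangentVec m n u
  have hdU := contDiff_polyU.differentiable (by simp) u
  have hdV := (contDiff_polyV ε₀ ε₁ lam).differentiable (by simp) u
  have hdC := contDiff_casimir.differentiable (by simp) u
  refine isSmoothPoint_of_fderiv_surjective
    (f := fun q => (casimir q - (a ^ 2, b ^ 2, 0), (polyU q, polyV ε₀ ε₁ lam q))) (by simp)
    isOpen_setOf_planarSq_ne_zero (subset_closure hu) hW
    ((contDiff_casimir.sub contDiff_const).prodMk
      (contDiff_polyU.prodMk (contDiff_polyV ε₀ ε₁ lam)))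
    (fderiv_prodMk_surjective (hdC.sub_const _) (hdU.prodMk hdV) ?_ ?_) fun q hq => ?_
  · rw [fderiv_sub_const]
    exact fderiv_casimir_surjective ha hb hp
  · rintro ⟨y, z⟩
    rw [fderiv_sub_const, hdU.fderiv_prodMk hdV]
    refine ⟨(y / fderiv ℝ polyU u w) • w + ((z - y / fderiv ℝ polyU u w *
      fderiv ℝ (polyV ε₀ ε₁ lam) u w) / fderiv ℝ (polyV ε₀ ε₁ lam) u v) • v, ?_, ?_⟩
    · simp [hv, hcw]
    · simp [hU, hw, hV]
  · have hmem : q ∈ setM₃ ε₀ ε₁ lam a b ↔ q ∈ relationSet ε₀ ε₁ lam a b :=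
      ⟨fun h => mem_relationSet_of_mem_setM₃ h hq, fun h => subset_closure h⟩
    rw [hmem, mem_relationSet_iff, Prod.mk_eq_zero (x := casimir q - _), sub_eq_zero,
      Prod.mk_eq_zero]
    exact and_congr_right fun _ => and_iff_right hq

theorem isSmoothPoint_of_relVar_ne_zero (ha : a ≠ 0) (hb : b ≠ 0)
    (hu : u ∈ relationSet ε₀ ε₁ lam a b) (h : Rel ε₁ lam ε₀ S S u) (σ : ℝ) (m n : Fin 3 → ℝ)
    (hA : m ⬝ᵥ shiftA S u + mom u ⬝ᵥ fa u ⨯₃ n = -σ * mom u 0)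
    (hB : m ⬝ᵥ shiftB S u + mom u ⬝ᵥ fb u ⨯₃ n = -σ * mom u 1)
    (hV : relVar ε₀ ε₁ lam S σ u (tangentVec m n u) ≠ 0) :
    IsSmoothPoint (setM₃ ε₀ ε₁ lam a b) 4 u := by
  refine isSmoothPoint_of_fderiv_polyV_ne_zero ha hb hu (fderiv_casimir_tangentVec m n u) ?_ ?_
  · rw [fderiv_polyU_of_dot_shift h.dot_shiftA h.dot_shiftB]
    change mom u 1 * (m ⬝ᵥ shiftA S u + mom u ⬝ᵥ fa u ⨯₃ n)
      - mom u 0 * (m ⬝ᵥ shiftB S u + mom u ⬝ᵥ fb u ⨯₃ n) = 0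
    rw [hA, hB]
    ring
  · rw [fderiv_polyV h hA hB]
    exact mul_ne_zero (planarSq_ne_zero_of_mem_relationSet hu) hV

theorem isSmoothPoint_of_radial (ha : a ≠ 0) (hb : b ≠ 0) (hu : u ∈ relationSet ε₀ ε₁ lam a b)
    (h : Rel ε₁ lam ε₀ S S u) (hS : S ≠ 0) (hM : mom u 2 / 2 + redMom ε₁ lam u ≠ 0) :
    IsSmoothPoint (setM₃ ε₀ ε₁ lam a b) 4 u := by
  have hvar : relVar ε₀ ε₁ lam S 0 u (tangentVec (mom u) 0 u) =
      -(S * planarSq u * (mom u 2 / 2 + redMom ε₁ lam u)) := by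
    simp only [relVar, redMomVar, tangentVec, mom, fa, fb, map_zero, LinearMap.zero_apply,
      planarSq, Pi.zero_apply, Pi.add_apply]
    ring
  refine isSmoothPoint_of_relVar_ne_zero ha hb hu h 0 (mom u) 0 ?_ ?_ ?_
  · simp [h.dot_shiftA]
  · simp [h.dot_shiftB]
  · rw [hvar]
    exact neg_ne_zero.2 (mul_ne_zero (mul_ne_zero hS (planarSq_ne_zero_of_mem_relationSet hu)) hM)

/-- The momentum part of the variation that goes with the rotation of both fields with
angular velocity `D n` and preserves the relations as long as the reduced axial momentum `D` is
treated as a constant. -/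
def tiltMom (ε₀ ε₁ lam S : ℝ) (n : Fin 3 → ℝ) (u : Phase) : Fin 3 → ℝ :=
  redMom ε₁ lam u • (mom u ⨯₃ n) + ε₀ • (![n ⬝ᵥ shiftB S u, -(n ⬝ᵥ shiftA S u), 0]
    + (fa u 1 - fb u 0) • n)

section Tilt

variable (n : Fin 3 → ℝ)

theorem tiltMom_dot_shiftA (h : Rel ε₁ lam ε₀ S S u) : tiltMom ε₀ ε₁ lam S n u ⬝ᵥ shiftA S u
    + mom u ⬝ᵥ fa u ⨯₃ (redMom ε₁ lam u • n) = 0 := by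
  obtain ⟨-, -, -, hy, hz⟩ := rel_iff_coord.1 h
  simp only [tiltMom, shiftA, shiftB, cross_apply, dotProduct, Fin.sum_univ_three, Pi.add_apply,
    Pi.smul_apply, smul_eq_mul, Matrix.cons_val]
  linear_combination n 1 * hz - n 2 * hy

theorem tiltMom_dot_shiftB (h : Rel ε₁ lam ε₀ S S u) : tiltMom ε₀ ε₁ lam S n u ⬝ᵥ shiftB S u
    + mom u ⬝ᵥ fb u ⨯₃ (redMom ε₁ lam u • n) = 0 := by
  obtain ⟨-, -, hx, -, hz⟩ := rel_iff_coord.1 h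
  simp only [tiltMom, shiftA, shiftB, cross_apply, dotProduct, Fin.sum_univ_three, Pi.add_apply,
    Pi.smul_apply, smul_eq_mul, Matrix.cons_val]
  linear_combination n 2 * hx - n 0 * hz

theorem relVar_tilt (h : Rel ε₁ lam ε₀ S S u) :
    relVar ε₀ ε₁ lam S 0 u (tangentVec (tiltMom ε₀ ε₁ lam S n u) (redMom ε₁ lam u • n) u) =
      -(S * planarSq u *
        redMomVar ε₁ (tangentVec (tiltMom ε₀ ε₁ lam S n u) (redMom ε₁ lam u • n) u)) := by
  obtain ⟨-, -, hx, hy, hz⟩ := rel_iff_coord.1 h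
  simp only [relVar, tangentVec, mom, fa, fb, tiltMom, shiftA, shiftB, planarSq, cross_apply,
    dotProduct, Fin.sum_univ_three, Pi.add_apply, Pi.smul_apply, smul_eq_mul, Matrix.cons_val] at *
  linear_combination redMom ε₁ lam u * (u.1 0 * (n 2 * hy - n 1 * hz)
    + u.1 1 * (n 0 * hz - n 2 * hx))

theorem isSmoothPoint_of_tilt (ha : a ≠ 0) (hb : b ≠ 0) (hu : u ∈ relationSet ε₀ ε₁ lam a b)
    (h : Rel ε₁ lam ε₀ S S u) (hS : S ≠ 0) (hn : redMomVar ε₁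
      (tangentVec (tiltMom ε₀ ε₁ lam S n u) (redMom ε₁ lam u • n) u) ≠ 0) :
    IsSmoothPoint (setM₃ ε₀ ε₁ lam a b) 4 u := by
  refine isSmoothPoint_of_relVar_ne_zero ha hb hu h 0 (tiltMom ε₀ ε₁ lam S n u)
    (redMom ε₁ lam u • n) ?_ ?_ ?_
  · rw [tiltMom_dot_shiftA n h, neg_zero, zero_mul]
  · rw [tiltMom_dot_shiftB n h, neg_zero, zero_mul]
  · rw [relVar_tilt n h]
    exact neg_ne_zero.2
      (mul_ne_zero (mul_ne_zero hS (planarSq_ne_zero_of_mem_relationSet hu)) hn)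

end Tilt

/-- The graph over the field variables outside of which the points of the relation set with
`S ≠ 0` and nonzero reduced axial momentum are smooth points of `𝔐₃`. -/
def foldSet (ε₁ lam : ℝ) : Set Phase :=
  {u | mom u 0 = 2 * ε₁ * fb u 2 ∧ mom u 1 = -(2 * ε₁ * fa u 2) ∧
    mom u 2 = lam + ε₁ * (fa u 1 - fb u 0)}

theorem isSmoothPoint_or_mem_foldSet (ha : a ≠ 0) (hb : b ≠ 0)
    (hu : u ∈ relationSet ε₀ ε₁ lam a b) (h : Rel ε₁ lam ε₀ S S u) (hS : S ≠ 0)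
    (hD : redMom ε₁ lam u ≠ 0) :
    IsSmoothPoint (setM₃ ε₀ ε₁ lam a b) 4 u ∨ u ∈ foldSet ε₁ lam := by
  refine or_iff_not_imp_left.2 fun hs => ?_
  have hM := not_imp_comm.1 (isSmoothPoint_of_radial ha hb hu h hS) hs
  have htilt := fun n => not_imp_comm.1 (isSmoothPoint_of_tilt n ha hb hu h hS) hs
  have h0 := htilt ![0, 1, 0]
  have h1 := htilt ![1, 0, 0]
  simp only [redMomVar, tangentVec, mom, fa, fb, tiltMom, shiftA, shiftB, cross_apply,
    dotProduct, Fin.sum_univ_three, Pi.add_apply, Pi.smul_apply, smul_eq_mul,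
    Matrix.cons_val] at h0 h1
  refine ⟨mul_left_cancel₀ hD ?_, mul_left_cancel₀ hD ?_, ?_⟩
  · simp only [mom, fb]
    linear_combination 2 * h0
  · simp only [mom, fa]
    linear_combination -2 * h1
  · rw [redMom] at hM
    linear_combination hM

theorem isSmoothPoint_of_redMomVar_ne_zero (ha : a ≠ 0) (hb : b ≠ 0)
    (hu : u ∈ relationSet 0 ε₁ lam a b)
    (h : Rel ε₁ lam 0 S S u) (hS : S ≠ 0) (hD : redMom ε₁ lam u = 0) {m n : Fin 3 → ℝ}
    (hU : fderiv ℝ polyU u (tangentVec m n u) = 0) (hV : redMomVar ε₁ (tangentVec m n u) ≠ 0) :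
    IsSmoothPoint (setM₃ 0 ε₁ lam a b) 4 u := by
  have hW := planarSq_ne_zero_of_mem_relationSet hu
  have hU' : mom u 1 * (m ⬝ᵥ shiftA S u + mom u ⬝ᵥ fa u ⨯₃ n)
      - mom u 0 * (m ⬝ᵥ shiftB S u + mom u ⬝ᵥ fb u ⨯₃ n) = 0 :=
    (fderiv_polyU_of_dot_shift h.dot_shiftA h.dot_shiftB _).symm.trans hU
  set dA := m ⬝ᵥ shiftA S u + mom u ⬝ᵥ fa u ⨯₃ n with hdA
  set dB := m ⬝ᵥ shiftB S u + mom u ⬝ᵥ fb u ⨯₃ n with hdB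
  refine isSmoothPoint_of_relVar_ne_zero ha hb hu h
    (-(mom u 0 * dA + mom u 1 * dB) / planarSq u) m n ?_ ?_ ?_
  · rw [← hdA]
    field_simp
    rw [planarSq]
    linear_combination mom u 1 * hU'
  · rw [← hdB]
    field_simp
    rw [planarSq]
    linear_combination -mom u 0 * hU'
  · rw [relVar, hD]
    simpa using ⟨hS, hV, hW⟩

theorem fderiv_polyU_tangentVec_eq_of_not_isSmoothPoint (ha : a ≠ 0) (hb : b ≠ 0)
    (hu : u ∈ relationSet 0 ε₁ lam a b)
    (h : Rel ε₁ lam 0 S S u) (hS : S ≠ 0) (hD : redMom ε₁ lam u = 0)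
    (hs : ¬IsSmoothPoint (setM₃ 0 ε₁ lam a b) 4 u) (m n : Fin 3 → ℝ) :
    fderiv ℝ polyU u (tangentVec m n u) = 2 * (mom u 1 * fa u 2 - mom u 0 * fb u 2) *
      redMomVar ε₁ (tangentVec m n u) := by
  set c := mom u 1 * fa u 2 - mom u 0 * fb u 2 with hc
  have hlin : tangentVec (c • m - fderiv ℝ polyU u (tangentVec m n u) • ![0, 0, 1]) (c • n) u =
      c • tangentVec m n u - fderiv ℝ polyU u (tangentVec m n u) • tangentVec ![0, 0, 1] 0 u := by
    simp [tangentVec]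
  have hvert : fderiv ℝ polyU u (tangentVec ![0, 0, 1] 0 u) = c := by
    rw [fderiv_polyU_tangentVec h.dot_shiftA h.dot_shiftB]
    simp [shiftA, shiftB, dotProduct, Fin.sum_univ_three, hc]
  have hV := not_imp_comm.1 (isSmoothPoint_of_redMomVar_ne_zero ha hb hu h hS hD
    (m := c • m - fderiv ℝ polyU u (tangentVec m n u) • ![0, 0, 1]) (n := c • n)
    (by rw [hlin, map_sub, map_smul, map_smul, hvert, smul_eq_mul, smul_eq_mul]; ring)) hs
  rw [hlin] at hV
  set d := fderiv ℝ polyU u (tangentVec m n u)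
  simp only [redMomVar, tangentVec, mom, fa, fb, Prod.fst_sub, Prod.snd_sub, Prod.smul_fst,
    Prod.smul_snd, Pi.sub_apply, Pi.smul_apply, smul_eq_mul, map_zero, Pi.zero_apply,
    Matrix.cons_val] at hV ⊢
  linear_combination -2 * hV

theorem isSmoothPoint_of_shift_ne_zero (ha : a ≠ 0) (hb : b ≠ 0)
    (hu : u ∈ relationSet 0 ε₁ lam a b)
    (h : Rel ε₁ lam 0 S S u) (hS : S ≠ 0) : IsSmoothPoint (setM₃ 0 ε₁ lam a b) 4 u := by
  by_contra hs
  have hW := planarSq_ne_zero_of_mem_relationSet hu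
  obtain ⟨hA, hB, hx, hy, -⟩ := rel_iff_coord.1 h
  have hD : redMom ε₁ lam u = 0 := mul_right_cancel₀ hW <| mul_left_cancel₀ hS <| by
    rw [planarSq]
    linear_combination -mom u 0 * hx - mom u 1 * hy
  have hM2 : mom u 2 = 0 := by
    linear_combination 2 * not_imp_comm.1 (isSmoothPoint_of_radial ha hb hu h hS) hs - 2 * hD
  have hlagrange := fderiv_polyU_tangentVec_eq_of_not_isSmoothPoint ha hb hu h hS hD hs
  have hc : mom u 1 * fa u 2 - mom u 0 * fb u 2 ≠ 0 := fun hc => by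
    obtain ⟨m, n, hmn⟩ := exists_fderiv_polyU_tangentVec_ne_zero ha hb
      (mem_relationSet_iff_exists_rel.1 hu).1 hW h.dot_shiftA h.dot_shiftB
    exact hmn (by rw [hlagrange, hc, mul_zero, zero_mul])
  simp only [fderiv_polyU_tangentVec h.dot_shiftA h.dot_shiftB] at hlagrange
  have hm0 := hlagrange ![1, 0, 0] 0
  have hm1 := hlagrange ![0, 1, 0] 0
  have hn0 := hlagrange 0 ![1, 0, 0]
  have hn1 := hlagrange 0 ![0, 1, 0]
  have hn2 := hlagrange 0 ![0, 0, 1]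
  simp only [redMomVar, tangentVec, shiftA, shiftB, mom, fa, fb, cross_apply, dotProduct,
    Fin.sum_univ_three, Pi.sub_apply, Pi.smul_apply, Pi.zero_apply, smul_eq_mul, planarSq, map_zero,
    Matrix.cons_val] at *
  have hM1 : u.1 1 = -(2 * ε₁ * u.2.1 2) := mul_left_cancel₀ hc <| by
    linear_combination hn0 + (u.1 1 * u.2.1 1 - u.1 0 * u.2.2 1) * hM2
  have hM0 : u.1 0 = 2 * ε₁ * u.2.2 2 := mul_left_cancel₀ hc <| by
    linear_combination (u.1 1 * u.2.1 0 - u.1 0 * u.2.2 0) * hM2 - hn1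
  have htrace : u.2.1 0 + u.2.2 1 + S = 0 := mul_left_cancel₀ hW <| by
    linear_combination hn2 + (u.2.1 0 + u.2.2 1) * (u.1 0 * hM0 + u.1 1 * hM1)
      + u.1 1 * hm0 - u.1 0 * hm1
  have htrace' : u.2.1 0 + u.2.2 1 + 2 * S = 0 := mul_left_cancel₀ hW <| by
    linear_combination u.1 0 * (hA - hm1 - u.2.1 2 * hM2) + u.1 1 * (hB + hm0 - u.2.2 2 * hM2)
  exact hS (by linear_combination htrace' - htrace)

theorem isSmoothPoint_of_redMom_ne_zero (ha : a ≠ 0) (hb : b ≠ 0)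
    (hu : u ∈ relationSet 0 ε₁ lam a b)
    (h : Rel ε₁ lam 0 0 0 u) (hD : redMom ε₁ lam u ≠ 0) :
    IsSmoothPoint (setM₃ 0 ε₁ lam a b) 4 u := by
  have hW := planarSq_ne_zero_of_mem_relationSet hu
  obtain ⟨h1, h2, h3⟩ := mem_phaseSpace_iff.1 (mem_relationSet_iff_exists_rel.1 hu).1
  refine isSmoothPoint_of_relVar_ne_zero ha hb hu h (a ^ 2 * b ^ 2)
    (-(mom u 0 * b ^ 2) • fa u - (mom u 1 * a ^ 2) • fb u) 0 ?_ ?_ ?_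
  · simp only [shiftA, dotProduct, Fin.sum_univ_three, Pi.sub_apply, Pi.smul_apply, smul_eq_mul,
      map_zero, Pi.zero_apply, Matrix.cons_val] at *
    linear_combination -(mom u 0 * b ^ 2) * h1 - mom u 1 * a ^ 2 * h3
  · simp only [shiftB, dotProduct, Fin.sum_univ_three, Pi.sub_apply, Pi.smul_apply, smul_eq_mul,
      map_zero, Pi.zero_apply, Matrix.cons_val] at *
    linear_combination -(mom u 0 * b ^ 2) * h3 - mom u 1 * a ^ 2 * h2
  · simp [relVar, ha, hb, hD, hW]

/-- The points of the relation set with vanishing reduced axial momentum and `ε₀ ≠ 0` near which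
`𝔐₃` may fail to be smooth: the shifted fields are vertical, and the momentum is along `e₂`. -/
structure IsAxial (lam S : ℝ) (u : Phase) : Prop where
  lam_eq_zero : lam = 0
  mom_zero : mom u 0 = 0
  mom_two : mom u 2 = 0
  shiftA_zero : shiftA S u 0 = 0
  shiftA_one : shiftA S u 1 = 0
  shiftB_eq_zero : shiftB S u = 0

theorem isSmoothPoint_of_dot_eq_zero (ha : a ≠ 0) (hb : b ≠ 0)
    (hu : u ∈ relationSet ε₀ ε₁ lam a b) (h : Rel ε₁ lam ε₀ S S u) (hS : S ≠ 0)
    (hD : redMom ε₁ lam u = 0) {m : Fin 3 → ℝ} (hA : m ⬝ᵥ shiftA S u = 0)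
    (hB : m ⬝ᵥ shiftB S u = 0) (hm : m 2 ≠ 0) : IsSmoothPoint (setM₃ ε₀ ε₁ lam a b) 4 u := by
  have hW := planarSq_ne_zero_of_mem_relationSet hu
  refine isSmoothPoint_of_relVar_ne_zero ha hb hu h 0 m 0 (by simp [hA]) (by simp [hB]) ?_
  simpa [relVar, redMomVar, tangentVec, mom, fa, fb, hD] using ⟨hS, hm, hW⟩

theorem shift_eq_zero_of_not_isSmoothPoint (ha : a ≠ 0) (hb : b ≠ 0)
    (hu : u ∈ relationSet ε₀ ε₁ lam a b) (h : Rel ε₁ lam ε₀ S S u) (hε : ε₀ ≠ 0) (hS : S ≠ 0)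
    (hD : redMom ε₁ lam u = 0) (hs : ¬IsSmoothPoint (setM₃ ε₀ ε₁ lam a b) 4 u) :
    (shiftA S u 0 = 0 ∧ shiftA S u 1 = 0) ∧ shiftB S u 0 = 0 ∧ shiftB S u 1 = 0 := by
  have horth := fun m hA hB =>
    not_imp_comm.1 (isSmoothPoint_of_dot_eq_zero ha hb hu h hS hD (m := m) hA hB) hs
  obtain ⟨-, -, hx, hy, -⟩ := rel_iff_coord.1 h
  simp only [hD, mul_zero, zero_mul, mul_eq_zero, hε, false_or] at hx hy
  have hsq (x y : ℝ) (hxy : x ^ 2 + y ^ 2 = 0) : x = 0 ∧ y = 0 :=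
    ⟨by nlinarith [sq_nonneg x, sq_nonneg y], by nlinarith [sq_nonneg x, sq_nonneg y]⟩
  have hA := horth ![-(shiftA S u 0 * fa u 2), -(shiftA S u 1 * fa u 2),
    shiftA S u 0 ^ 2 + shiftA S u 1 ^ 2]
  have hB := horth ![-(shiftB S u 0 * fb u 2), -(shiftB S u 1 * fb u 2),
    shiftB S u 0 ^ 2 + shiftB S u 1 ^ 2]
  simp only [shiftA, shiftB, dotProduct, Fin.sum_univ_three, Matrix.cons_val] at hA hB ⊢
  exact ⟨hsq _ _ (hA (by ring) (by linear_combination fa u 1 * hx - (fa u 0 + S) * hy)),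
    hsq _ _ (hB (by linear_combination fb u 0 * hy - (fb u 1 + S) * hx) (by ring))⟩

theorem isSmoothPoint_or_isAxial (hb : 0 < b) (hab : b < a)
    (hu : u ∈ relationSet ε₀ ε₁ lam a b) (h : Rel ε₁ lam ε₀ S S u) (hε : ε₀ ≠ 0) (hS : S ≠ 0)
    (hD : redMom ε₁ lam u = 0) :
    IsSmoothPoint (setM₃ ε₀ ε₁ lam a b) 4 u ∨ IsAxial lam S u := by
  refine or_iff_not_imp_left.2 fun hs => ?_
  have ha : a ≠ 0 := (hb.trans hab).ne'
  have hM2 := not_imp_comm.1 (isSmoothPoint_of_radial ha hb.ne' hu h hS) hs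
  rw [hD, add_zero, div_eq_zero_iff, or_iff_left two_ne_zero] at hM2
  obtain ⟨⟨hA0, hA1⟩, hB0, hB1⟩ :=
    shift_eq_zero_of_not_isSmoothPoint ha hb.ne' hu h hε hS hD hs
  obtain ⟨h1, h2, h3⟩ := mem_phaseSpace_iff_coord.1 (mem_relationSet_iff_exists_rel.1 hu).1
  simp only [shiftA, shiftB, Matrix.cons_val] at hA0 hA1 hB0 hB1
  have hα0 : fa u 0 = -S := by linear_combination hA0
  have hβ1 : fb u 1 = -S := by linear_combination hB1
  rw [hα0, hA1] at h1
  rw [hB0, hβ1] at h2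
  have hβ2 : fb u 2 = 0 := by
    refine (mul_eq_zero.1 (by simpa only [hA1, hB0, mul_zero, zero_mul, zero_add] using h3 :
      fa u 2 * fb u 2 = 0)).resolve_left fun hα2 => ?_
    rw [hα2] at h1
    nlinarith [sq_nonneg (fb u 2)]
  have hM0 : mom u 0 = 0 := by
    refine not_imp_comm.1 (fun hM0 => isSmoothPoint_of_relVar_ne_zero ha hb.ne' hu h 0
      ![0, 0, mom u 0] ![0, 1, 0] ?_ ?_ ?_) hs
    · simp [shiftA, dotProduct, cross_apply, Fin.sum_univ_three, hM2]
    · simp [shiftB, dotProduct, cross_apply, Fin.sum_univ_three, hM2, hβ2]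
    · have hW := planarSq_ne_zero_of_mem_relationSet hu
      simp only [fa, fb, mom] at *
      simp [relVar, redMomVar, tangentVec, mom, fa, fb, shiftA, shiftB, cross_apply, *]
  refine ⟨?_, hM0, hM2, hA0, hA1, ?_⟩
  · rw [redMom, hM2, hA1, hB0] at hD
    linear_combination -hD
  · simp [shiftB, hB0, hB1, hβ2]

theorem isSmoothPoint_or (hb : 0 < b) (hab : b < a) (hu : u ∈ relationSet ε₀ ε₁ lam a b) :
    IsSmoothPoint (setM₃ ε₀ ε₁ lam a b) 4 u ∨ ∃ S, Rel ε₁ lam ε₀ S S u ∧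
      (ε₀ ≠ 0 ∧ S ≠ 0 ∧ redMom ε₁ lam u ≠ 0 ∧ u ∈ foldSet ε₁ lam ∨
        ε₀ ≠ 0 ∧ S ≠ 0 ∧ IsAxial lam S u ∨ ε₀ = 0 ∧ S = 0 ∧ redMom ε₁ lam u = 0) := by
  obtain ⟨hp, -, S, h⟩ := mem_relationSet_iff_exists_rel.1 hu
  have ha : a ≠ 0 := (hb.trans hab).ne'
  rcases eq_or_ne ε₀ 0 with rfl | hε
  · rcases eq_or_ne S 0 with rfl | hS
    · rcases eq_or_ne (redMom ε₁ lam u) 0 with hD | hD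
      · exact .inr ⟨0, h, .inr (.inr ⟨rfl, rfl, hD⟩)⟩
      · exact .inl (isSmoothPoint_of_redMom_ne_zero ha hb.ne' hu h hD)
    · exact .inl (isSmoothPoint_of_shift_ne_zero ha hb.ne' hu h hS)
  · have hS : S ≠ 0 := h.ne_zero hp ha hb.ne' hε
    rcases eq_or_ne (redMom ε₁ lam u) 0 with hD | hD
    · exact (isSmoothPoint_or_isAxial hb hab hu h hε hS hD).imp_right
        fun hax => ⟨S, h, .inr (.inl ⟨hε, hS, hax⟩)⟩
    · exact (isSmoothPoint_or_mem_foldSet ha hb.ne' hu h hS hD).imp_right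
        fun hf => ⟨S, h, .inl ⟨hε, hS, hD, hf⟩⟩

end SmoothPoints

/-! ### Curves of regular points through degenerate ones -/

section Rotation

/-- The image of `v` under the rotation about `n` by the angle `2 arctan (t |n|)`, in Cayley's
rational parametrization. -/
def cayleyRot (t : ℝ) (n v : Fin 3 → ℝ) : Fin 3 → ℝ :=
  v + (2 * t / (1 + t ^ 2 * (n ⬝ᵥ n))) • (n ⨯₃ v + t • n ⨯₃ (n ⨯₃ v))

variable (t : ℝ) (n v w : Fin 3 → ℝ)

theorem one_add_sq_mul_dot_pos : 0 < 1 + t ^ 2 * (n ⬝ᵥ n) := by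
  have h : 0 ≤ n ⬝ᵥ n := by simpa using dotProduct_star_self_nonneg n
  positivity

theorem cayleyRot_zero : cayleyRot 0 n v = v := by simp [cayleyRot]

theorem continuous_cayleyRot : Continuous fun t => cayleyRot t n v := by
  have h := fun t => (one_add_sq_mul_dot_pos t n).ne'
  unfold cayleyRot
  fun_prop (disch := exact h _)

theorem cayleyRot_dot_cayleyRot : cayleyRot t n v ⬝ᵥ cayleyRot t n w = v ⬝ᵥ w := by
  have hs := div_mul_cancel₀ (2 * t) (one_add_sq_mul_dot_pos t n).ne'
  unfold cayleyRot
  generalize 2 * t / (1 + t ^ 2 * (n ⬝ᵥ n)) = s at hs ⊢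
  simp only [dotProduct, Fin.sum_univ_three, Pi.add_apply, Pi.smul_apply, smul_eq_mul,
    cross_apply, Matrix.cons_val] at hs ⊢
  linear_combination s * ((n 1 * v 2 - n 2 * v 1) * (n 1 * w 2 - n 2 * w 1)
    + (n 2 * v 0 - n 0 * v 2) * (n 2 * w 0 - n 0 * w 2)
    + (n 0 * v 1 - n 1 * v 0) * (n 0 * w 1 - n 1 * w 0)) * hs

theorem cayleyRot_cross_cayleyRot :
    cayleyRot t n v ⨯₃ cayleyRot t n w = cayleyRot t n (v ⨯₃ w) := by
  have hs := div_mul_cancel₀ (2 * t) (one_add_sq_mul_dot_pos t n).ne'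
  unfold cayleyRot
  generalize 2 * t / (1 + t ^ 2 * (n ⬝ᵥ n)) = s at hs ⊢
  ext i
  simp only [dotProduct, Fin.sum_univ_three] at hs
  fin_cases i <;> simp only [Fin.zero_eta, Fin.mk_one, Fin.reduceFinMk, Pi.add_apply,
    Pi.smul_apply, smul_eq_mul, cross_apply, Matrix.cons_val]
  · linear_combination s * n 0 * (n 0 * (v 1 * w 2 - v 2 * w 1) + n 1 * (v 2 * w 0 - v 0 * w 2)
      + n 2 * (v 0 * w 1 - v 1 * w 0)) * hs
  · linear_combination s * n 1 * (n 0 * (v 1 * w 2 - v 2 * w 1) + n 1 * (v 2 * w 0 - v 0 * w 2)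
      + n 2 * (v 0 * w 1 - v 1 * w 0)) * hs
  · linear_combination s * n 2 * (n 0 * (v 1 * w 2 - v 2 * w 1) + n 1 * (v 2 * w 0 - v 0 * w 2)
      + n 2 * (v 0 * w 1 - v 1 * w 0)) * hs

end Rotation

section Curves

/-- The state whose three vectors are rotated about `n`. -/
def rotate (t : ℝ) (n : Fin 3 → ℝ) (u : Phase) : Phase :=
  (cayleyRot t n (mom u), cayleyRot t n (fa u), cayleyRot t n (fb u))

theorem rotate_zero (n : Fin 3 → ℝ) (u : Phase) : rotate 0 n u = u := by
  simp only [rotate, cayleyRot_zero]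

theorem continuous_rotate (n : Fin 3 → ℝ) (u : Phase) : Continuous fun t => rotate t n u :=
  (continuous_cayleyRot n _).prodMk ((continuous_cayleyRot n _).prodMk (continuous_cayleyRot n _))

theorem rotate_mem_phaseSpace {a b : ℝ} {u : Phase} (hu : u ∈ phaseSpace a b) (t : ℝ)
    (n : Fin 3 → ℝ) : rotate t n u ∈ phaseSpace a b := by
  simpa only [mem_phaseSpace_iff, rotate, fa, fb, cayleyRot_dot_cayleyRot] using hu

/-- The horizontal vector `e₃ × (α × β)`. -/
def foldAxis (u : Phase) : Fin 3 → ℝ := ![-(fa u ⨯₃ fb u) 1, (fa u ⨯₃ fb u) 0, 0]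

/-- The common factor of the increments of `α₂ - β₁` and `α₁ + β₂` under `rotate t (foldAxis u)`. -/
def foldRate (t : ℝ) (u : Phase) : ℝ :=
  2 * t / (1 + t ^ 2 * (foldAxis u ⬝ᵥ foldAxis u)) * (1 + t * (fa u ⨯₃ fb u) 2)

variable (t : ℝ) (u : Phase)

theorem rotate_foldAxis_skew :
    fa (rotate t (foldAxis u) u) 1 - fb (rotate t (foldAxis u) u) 0 = fa u 1 - fb u 0 +
      foldRate t u * ((fa u ⨯₃ fb u) 1 * fa u 2 - (fa u ⨯₃ fb u) 0 * fb u 2) := by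
  simp only [rotate, foldRate, fa, fb, cayleyRot]
  generalize 2 * t / (1 + t ^ 2 * (foldAxis u ⬝ᵥ foldAxis u)) = s
  simp only [foldAxis, fa, fb, Pi.add_apply, Pi.smul_apply, smul_eq_mul, cross_apply,
    Matrix.cons_val]
  ring

theorem rotate_foldAxis_trace :
    fa (rotate t (foldAxis u) u) 0 + fb (rotate t (foldAxis u) u) 1 = fa u 0 + fb u 1 +
      foldRate t u * ((fa u ⨯₃ fb u) 0 * fa u 2 + (fa u ⨯₃ fb u) 1 * fb u 2) := by
  simp only [rotate, foldRate, fa, fb, cayleyRot]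
  generalize 2 * t / (1 + t ^ 2 * (foldAxis u ⬝ᵥ foldAxis u)) = s
  simp only [foldAxis, fa, fb, Pi.add_apply, Pi.smul_apply, smul_eq_mul, cross_apply,
    Matrix.cons_val]
  ring

theorem rotate_foldAxis_cross :
    (fa (rotate t (foldAxis u) u) ⨯₃ fb (rotate t (foldAxis u) u)) 2 = (fa u ⨯₃ fb u) 2 -
      foldRate t u * ((fa u ⨯₃ fb u) 0 ^ 2 + (fa u ⨯₃ fb u) 1 ^ 2) := by
  simp only [rotate, foldRate, fa, fb, cayleyRot_cross_cayleyRot]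
  unfold cayleyRot
  generalize 2 * t / (1 + t ^ 2 * (foldAxis u ⬝ᵥ foldAxis u)) = s
  simp only [foldAxis, fa, fb, Pi.add_apply, Pi.smul_apply, smul_eq_mul, cross_apply,
    Matrix.cons_val]
  ring

/-- A curve through a point `u` of `foldSet` in the relation set that leaves `foldSet`: the fields
are rotated about `foldAxis u`, and the momentum is the multiple of the product of the shifted
fields that keeps `M₃`. -/
def foldCurve (S t : ℝ) (u : Phase) : Phase :=
  ((mom u 2 / (shiftA S (rotate t (foldAxis u) u) ⨯₃ shiftB S (rotate t (foldAxis u) u)) 2) •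
    (shiftA S (rotate t (foldAxis u) u) ⨯₃ shiftB S (rotate t (foldAxis u) u)),
    fa (rotate t (foldAxis u) u), fb (rotate t (foldAxis u) u))

theorem shift_cross_rotate_foldAxis (S : ℝ) :
    (shiftA S (rotate t (foldAxis u) u) ⨯₃ shiftB S (rotate t (foldAxis u) u)) 2 =
      (shiftA S u ⨯₃ shiftB S u) 2 + foldRate t u *
        (S * ((fa u ⨯₃ fb u) 0 * fa u 2 + (fa u ⨯₃ fb u) 1 * fb u 2)
          - ((fa u ⨯₃ fb u) 0 ^ 2 + (fa u ⨯₃ fb u) 1 ^ 2)) := by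
  have htrace := rotate_foldAxis_trace t u
  have hcross := rotate_foldAxis_cross t u
  generalize rotate t (foldAxis u) u = q at *
  simp only [shiftA, shiftB, cross_apply, Matrix.cons_val] at *
  linear_combination hcross + S * htrace

variable {t u} {ε₀ ε₁ lam S : ℝ}

theorem shift_cross_foldRate_eq (h : Rel ε₁ lam ε₀ S S u) (hf : u ∈ foldSet ε₁ lam) :
    ε₀ * (S * ((fa u ⨯₃ fb u) 0 * fa u 2 + (fa u ⨯₃ fb u) 1 * fb u 2)
      - ((fa u ⨯₃ fb u) 0 ^ 2 + (fa u ⨯₃ fb u) 1 ^ 2)) =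
    -(S * mom u 2 * ε₁ * ((fa u ⨯₃ fb u) 1 * fa u 2 - (fa u ⨯₃ fb u) 0 * fb u 2)) := by
  obtain ⟨-, -, hx, hy, -⟩ := rel_iff_coord.1 h
  obtain ⟨h0, h1, h2⟩ := hf
  rw [redMom] at hx hy
  simp only [cross_apply, Matrix.cons_val]
  linear_combination -(fa u 1 * fb u 2 - fa u 2 * fb u 1) * hx
    - (fa u 2 * fb u 0 - fa u 0 * fb u 2) * hy
    - S * ((fa u 1 * fb u 2 - fa u 2 * fb u 1) * mom u 0
      + (fa u 2 * fb u 0 - fa u 0 * fb u 2) * mom u 1) * h2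
    + S * mom u 2 / 2 * ((fa u 1 * fb u 2 - fa u 2 * fb u 1) * h0
      + (fa u 2 * fb u 0 - fa u 0 * fb u 2) * h1)

theorem skew_mul_eq (h : Rel ε₁ lam ε₀ S S u) (hf : u ∈ foldSet ε₁ lam) :
    ε₀ * (2 * ε₁ * ((fa u ⨯₃ fb u) 1 * fa u 2 - (fa u ⨯₃ fb u) 0 * fb u 2)) =
      -(S * redMom ε₁ lam u * planarSq u) := by
  obtain ⟨-, -, hx, hy, -⟩ := rel_iff_coord.1 h
  obtain ⟨h0, h1, -⟩ := hf
  simp only [cross_apply, Matrix.cons_val, planarSq]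
  linear_combination -mom u 0 * hx - mom u 1 * hy
    + ε₀ * (fa u 1 * fb u 2 - fa u 2 * fb u 1 - S * fa u 2) * h0
    + ε₀ * (fa u 2 * fb u 0 - fa u 0 * fb u 2 - S * fb u 2) * h1

theorem redMom_foldCurve (hC : (shiftA S (rotate t (foldAxis u) u) ⨯₃
    shiftB S (rotate t (foldAxis u) u)) 2 ≠ 0) :
    redMom ε₁ lam (foldCurve S t u) = redMom ε₁ lam u - ε₁ * (foldRate t u *
      ((fa u ⨯₃ fb u) 1 * fa u 2 - (fa u ⨯₃ fb u) 0 * fb u 2)) := by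
  have hskew := rotate_foldAxis_skew t u
  simp only [redMom, foldCurve, mom, fa, fb, Pi.smul_apply, smul_eq_mul, div_mul_cancel₀ _ hC] at *
  linear_combination -ε₁ * hskew

theorem rel_foldCurve (h : Rel ε₁ lam ε₀ S S u) (hf : u ∈ foldSet ε₁ lam)
    (hC : (shiftA S (rotate t (foldAxis u) u) ⨯₃ shiftB S (rotate t (foldAxis u) u)) 2 ≠ 0) :
    Rel ε₁ lam ε₀ S S (foldCurve S t u) := by
  have hcross : ε₀ * (shiftA S (rotate t (foldAxis u) u) ⨯₃
      shiftB S (rotate t (foldAxis u) u)) 2 =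
      S * redMom ε₁ lam (foldCurve S t u) * mom u 2 := by
    have h2 : ε₀ * (shiftA S u ⨯₃ shiftB S u) 2 = S * redMom ε₁ lam u * mom u 2 :=
      (rel_iff_coord.1 h).2.2.2.2
    rw [shift_cross_rotate_foldAxis, redMom_foldCurve hC]
    linear_combination h2 + foldRate t u * shift_cross_foldRate_eq h hf
  refine ⟨?_, ?_, ?_⟩
  · change (_ • _) ⬝ᵥ shiftA S (rotate t (foldAxis u) u) = 0
    rw [smul_dotProduct, dotProduct_comm, dot_self_cross, smul_zero]
  · change (_ • _) ⬝ᵥ shiftB S (rotate t (foldAxis u) u) = 0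
    rw [smul_dotProduct, dotProduct_comm, dot_cross_self, smul_zero]
  · change ε₀ • (shiftA S (rotate t (foldAxis u) u) ⨯₃ shiftB S (rotate t (foldAxis u) u)) -
      _ • _ • _ = 0
    rw [smul_smul, mul_div_assoc', ← hcross, mul_div_cancel_right₀ _ hC, sub_self]

theorem foldCurve_zero (h : Rel ε₁ lam ε₀ S S u) (hε : ε₀ ≠ 0)
    (hC : (shiftA S u ⨯₃ shiftB S u) 2 ≠ 0) : foldCurve S 0 u = u := by
  have hcross (i : Fin 3) : ε₀ * (shiftA S u ⨯₃ shiftB S u) i =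
      S * redMom ε₁ lam u * mom u i := congr_fun (sub_eq_zero.1 h.relCross_eq_zero) i
  rw [foldCurve, rotate_zero]
  refine Prod.ext (funext fun i => mul_left_cancel₀ hC ?_) rfl
  change _ * (mom u 2 / (shiftA S u ⨯₃ shiftB S u) 2 * (shiftA S u ⨯₃ shiftB S u) i) = _
  field_simp
  refine mul_left_cancel₀ hε ?_
  linear_combination mom u 2 * hcross i - mom u i * hcross 2

theorem continuous_shift_cross (S : ℝ) : Continuous fun q => shiftA S q ⨯₃ shiftB S q := by
  simp only [shiftA, shiftB, cross_apply]
  fun_prop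

theorem continuousAt_foldCurve (hC : (shiftA S u ⨯₃ shiftB S u) 2 ≠ 0) :
    ContinuousAt (fun t => foldCurve S t u) 0 := by
  have hN := continuous_shift_cross S
  have hN₂ := (continuous_apply (2 : Fin 3)).comp hN
  have hmap : ContinuousAt (fun q : Phase => ((mom u 2 / (shiftA S q ⨯₃ shiftB S q) 2) •
      (shiftA S q ⨯₃ shiftB S q), fa q, fb q)) u :=
    ((continuousAt_const.div hN₂.continuousAt hC).smul hN.continuousAt).prodMk (by fun_prop)
  exact hmap.comp_of_eq (continuous_rotate (foldAxis u) u).continuousAt (rotate_zero _ u)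

theorem eventually_foldRate_ne_zero (u : Phase) : ∀ᶠ t in 𝓝[≠] 0, foldRate t u ≠ 0 := by
  have h : ∀ᶠ t in 𝓝[≠] (0 : ℝ), 1 + t * (fa u ⨯₃ fb u) 2 ≠ 0 :=
    nhdsWithin_le_nhds <| ContinuousAt.eventually_ne (by fun_prop) (by simp)
  filter_upwards [h, self_mem_nhdsWithin] with t ht ht0
  exact mul_ne_zero (div_ne_zero (mul_ne_zero two_ne_zero ht0)
    (one_add_sq_mul_dot_pos t (foldAxis u)).ne') ht

end Curves

section Density

variable {ε₀ ε₁ lam a b S : ℝ} {u : Phase}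

theorem mem_closure_of_mem_foldSet (ha : a ≠ 0) (hb : b ≠ 0)
    (hu : u ∈ relationSet ε₀ ε₁ lam a b) (h : Rel ε₁ lam ε₀ S S u) (hε : ε₀ ≠ 0) (hS : S ≠ 0)
    (hD : redMom ε₁ lam u ≠ 0) (hf : u ∈ foldSet ε₁ lam) :
    u ∈ closure {q | IsSmoothPoint (setM₃ ε₀ ε₁ lam a b) 4 q} := by
  have hW := planarSq_ne_zero_of_mem_relationSet hu
  have hMD : mom u 2 / 2 + redMom ε₁ lam u = 0 := by
    rw [redMom]
    linear_combination hf.2.2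
  have hC : (shiftA S u ⨯₃ shiftB S u) 2 ≠ 0 := fun hC => by
    have h2 : ε₀ * (shiftA S u ⨯₃ shiftB S u) 2 = S * redMom ε₁ lam u * mom u 2 :=
      (rel_iff_coord.1 h).2.2.2.2
    rw [hC, mul_zero, eq_comm, mul_eq_zero, or_iff_right (mul_ne_zero hS hD)] at h2
    exact hD (by rw [← hMD, h2]; ring)
  have hx : ε₁ * ((fa u ⨯₃ fb u) 1 * fa u 2 - (fa u ⨯₃ fb u) 0 * fb u 2) ≠ 0 := fun hx =>
    mul_ne_zero (mul_ne_zero hS hD) hW <| by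
      linear_combination skew_mul_eq h hf - 2 * ε₀ * hx
  have htendsto :=
    tendsto_nhdsNE_of_continuousAt (continuousAt_foldCurve hC) (foldCurve_zero h hε hC)
  have hN : Continuous fun t => (shiftA S (rotate t (foldAxis u) u) ⨯₃
      shiftB S (rotate t (foldAxis u) u)) 2 :=
    (continuous_apply 2).comp ((continuous_shift_cross S).comp (continuous_rotate (foldAxis u) u))
  refine mem_closure_of_tendsto htendsto ?_
  filter_upwards [htendsto.eventually (isOpen_setOf_planarSq_ne_zero.mem_nhds hW),
    nhdsWithin_le_nhds (hN.continuousAt.eventually_ne (by rwa [rotate_zero])),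
    eventually_foldRate_ne_zero u] with t hWt hCt hrt
  have ht := rel_foldCurve h hf hCt
  refine isSmoothPoint_of_radial ha hb (mem_relationSet_iff_exists_rel.2
    ⟨rotate_mem_phaseSpace (mem_relationSet_iff_exists_rel.1 hu).1 t _, hWt, S, ht⟩) ht hS ?_
  have hmom : mom (foldCurve S t u) 2 = mom u 2 := div_mul_cancel₀ _ hCt
  rw [hmom, redMom_foldCurve hCt]
  intro h0
  exact mul_ne_zero hrt hx (by linear_combination hMD - h0)

theorem mem_closure_of_isAxial (hb : 0 < b) (hab : b < a) (hu : u ∈ relationSet ε₀ ε₁ lam a b)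
    (hε : ε₀ ≠ 0) (hx : IsAxial lam S u) :
    u ∈ closure {q | IsSmoothPoint (setM₃ ε₀ ε₁ lam a b) 4 q} := by
  obtain ⟨hp, hW, -⟩ := mem_relationSet_iff_exists_rel.1 hu
  obtain ⟨hlam, hM0, hM2, hA0, hA1, hB⟩ := hx
  have hB0 : fb u 0 = 0 := congr_fun hB 0
  have hB1 : fb u 1 + S = 0 := congr_fun hB 1
  have hB2 : fb u 2 = 0 := congr_fun hB 2
  simp only [shiftA, Matrix.cons_val] at hA0 hA1
  have hcont : Continuous fun t : ℝ => ((![t, mom u 1, 0], fa u, fb u) : Phase) := by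
    refine .prodMk (continuous_pi fun i => ?_) continuous_const
    fin_cases i
    exacts [continuous_id, continuous_const, continuous_const]
  have hzero : ((![0, mom u 1, 0], fa u, fb u) : Phase) = u := by
    refine Prod.ext (funext fun i => ?_) rfl
    fin_cases i
    exacts [hM0.symm, rfl, hM2.symm]
  have htendsto := tendsto_nhdsNE_of_continuousAt hcont.continuousAt hzero
  refine mem_closure_of_tendsto htendsto ?_
  filter_upwards [htendsto.eventually (isOpen_setOf_planarSq_ne_zero.mem_nhds hW),
    self_mem_nhdsWithin] with t hWt ht
  have hp' : (![t, mom u 1, 0], fa u, fb u) ∈ phaseSpace a b := hp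
  have hD : redMom ε₁ lam (![t, mom u 1, 0], fa u, fb u) = 0 := by
    change 0 / 2 - lam - ε₁ * (fa u 1 - fb u 0) = 0
    rw [hlam, hA1, hB0]
    ring
  have hrel : Rel ε₁ lam ε₀ S S (![t, mom u 1, 0], fa u, fb u) := by
    rw [rel_iff_coord, hD]
    simp only [mom, fa, fb, Matrix.cons_val] at *
    simp only [hA0, hA1, hB0, hB1, hB2, mul_zero, zero_mul, add_zero, sub_zero, and_self]
  obtain hs | ⟨S', -, ⟨-, -, hD', -⟩ | ⟨-, -, hx'⟩ | ⟨hε', -⟩⟩ := isSmoothPoint_or hb hab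
    (mem_relationSet_iff_exists_rel.2 ⟨hp', hWt, S, hrel⟩)
  exacts [hs, absurd hD hD', absurd hx'.mom_zero ht, absurd hε' hε]

theorem rel_zero_iff : Rel ε₁ lam 0 0 0 u ↔ mom u ⬝ᵥ fa u = 0 ∧ mom u ⬝ᵥ fb u = 0 := by
  simp [rel_iff_coord, dotProduct, Fin.sum_univ_three]

theorem mem_closure_of_mom_two_ne_zero (ha : a ≠ 0) (hb : b ≠ 0)
    (hu : u ∈ relationSet 0 ε₁ lam a b) (h : Rel ε₁ lam 0 0 0 u) (hM : mom u 2 ≠ 0) :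
    u ∈ closure {q | IsSmoothPoint (setM₃ 0 ε₁ lam a b) 4 q} := by
  rcases ne_or_eq (redMom ε₁ lam u) 0 with hD | hD
  · exact subset_closure (isSmoothPoint_of_redMom_ne_zero ha hb hu h hD)
  obtain ⟨hp, hW, -⟩ := mem_relationSet_iff_exists_rel.1 hu
  have hcont : Continuous fun t : ℝ => (((1 + t) • mom u, fa u, fb u) : Phase) := by fun_prop
  have hzero : (((1 + (0 : ℝ)) • mom u, fa u, fb u) : Phase) = u := by
    rw [add_zero, one_smul]
  have htendsto := tendsto_nhdsNE_of_continuousAt hcont.continuousAt hzero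
  refine mem_closure_of_tendsto htendsto ?_
  filter_upwards [htendsto.eventually (isOpen_setOf_planarSq_ne_zero.mem_nhds hW),
    self_mem_nhdsWithin] with t hWt ht
  have hrel : Rel ε₁ lam 0 0 0 ((1 + t) • mom u, fa u, fb u) := by
    rw [rel_zero_iff] at h ⊢
    change ((1 + t) • mom u) ⬝ᵥ fa u = 0 ∧ ((1 + t) • mom u) ⬝ᵥ fb u = 0
    rw [smul_dotProduct, smul_dotProduct, h.1, h.2, smul_zero, and_self]
  refine isSmoothPoint_of_redMom_ne_zero ha hb
    (mem_relationSet_iff_exists_rel.2 ⟨hp, hWt, 0, hrel⟩) hrel fun h0 => ?_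
  refine mul_ne_zero ht hM ?_
  simp only [redMom, mom, fa, fb, Pi.smul_apply, smul_eq_mul] at *
  linear_combination 2 * h0 - 2 * hD

theorem rel_zero_rotate (h : Rel ε₁ lam 0 0 0 u) (t : ℝ) (n : Fin 3 → ℝ) :
    Rel ε₁ lam 0 0 0 (rotate t n u) := by
  simpa only [rel_zero_iff, rotate, mom, fa, fb, cayleyRot_dot_cayleyRot] using h

theorem mom_rotate_two (t : ℝ) (h : mom u 2 = 0) :
    mom (rotate t ![-mom u 1, mom u 0, 0] u) 2 =
      -(2 * t / (1 + t ^ 2 * (![-mom u 1, mom u 0, 0] ⬝ᵥ ![-mom u 1, mom u 0, 0])) *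
        planarSq u) := by
  simp only [rotate, cayleyRot]
  generalize 2 * t / (1 + t ^ 2 * (![-mom u 1, mom u 0, 0] ⬝ᵥ ![-mom u 1, mom u 0, 0])) = s
  simp only [mom, planarSq, Pi.add_apply, Pi.smul_apply, smul_eq_mul, cross_apply,
    Matrix.cons_val] at *
  linear_combination (1 - s * t * (u.1 0 ^ 2 + u.1 1 ^ 2)) * h

theorem mem_closure_of_rel_zero (ha : a ≠ 0) (hb : b ≠ 0) (hu : u ∈ relationSet 0 ε₁ lam a b)
    (h : Rel ε₁ lam 0 0 0 u) : u ∈ closure {q | IsSmoothPoint (setM₃ 0 ε₁ lam a b) 4 q} := by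
  rcases ne_or_eq (mom u 2) 0 with hM | hM
  · exact mem_closure_of_mom_two_ne_zero ha hb hu h hM
  obtain ⟨hp, hW, -⟩ := mem_relationSet_iff_exists_rel.1 hu
  have htendsto := tendsto_nhdsNE_of_continuousAt
    (continuous_rotate ![-mom u 1, mom u 0, 0] u).continuousAt (rotate_zero _ u)
  rw [← closure_closure]
  refine mem_closure_of_tendsto htendsto ?_
  filter_upwards [htendsto.eventually (isOpen_setOf_planarSq_ne_zero.mem_nhds hW),
    self_mem_nhdsWithin] with t hWt ht
  have hrel := rel_zero_rotate h t ![-mom u 1, mom u 0, 0]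
  refine mem_closure_of_mom_two_ne_zero ha hb
    (mem_relationSet_iff_exists_rel.2 ⟨rotate_mem_phaseSpace hp t _, hWt, 0, hrel⟩) hrel ?_
  rw [mom_rotate_two t hM]
  exact neg_ne_zero.2 <| mul_ne_zero
    (div_ne_zero (mul_ne_zero two_ne_zero ht) (one_add_sq_mul_dot_pos t _).ne') hW

theorem setM₃_subset_closure_isSmoothPoint (hb : 0 < b) (hab : b < a) :
    setM₃ ε₀ ε₁ lam a b ⊆ closure {q | IsSmoothPoint (setM₃ ε₀ ε₁ lam a b) 4 q} := by
  refine closure_minimal (fun u hu => ?_) isClosed_closure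
  have ha : a ≠ 0 := (hb.trans hab).ne'
  obtain hs | ⟨S, h, ⟨hε, hS, hD, hf⟩ | ⟨hε, -, hx⟩ | ⟨rfl, rfl, -⟩⟩ := isSmoothPoint_or hb hab hu
  · exact subset_closure hs
  · exact mem_closure_of_mem_foldSet ha hb.ne' hu h hε hS hD hf
  · exact mem_closure_of_isAxial hb hab hu hε hx
  · exact mem_closure_of_rel_zero ha hb.ne' hu h

end Density

/-! ### The dimension of the degenerate set -/

section Dimension

variable {ε₀ ε₁ lam a b : ℝ} {Z : Set Phase}

theorem dimH_le_three {G : Type*} [NormedAddCommGroup G] [NormedSpace ℝ G]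
    [FiniteDimensional ℝ G] (hG : Module.finrank ℝ G = 3) {g : Phase → G} (hg : ContDiff ℝ 1 g)
    (ha : a ≠ 0) (hb : b ≠ 0) (hZ : ∀ u ∈ Z, u ∈ phaseSpace a b ∧ g u = 0)
    (hs : ∀ u ∈ Z, ∀ z, ∃ v, fderiv ℝ casimir u v = 0 ∧ fderiv ℝ g u v = z) : dimH Z ≤ 3 := by
  have hc : ContDiff ℝ 1 fun u => casimir u - (a ^ 2, b ^ 2, 0) :=
    (contDiff_casimir.of_le (by simp)).sub contDiff_const
  have h := dimH_le_of_fderiv_surjective (Z := Z) (hc.prodMk hg)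
    (fun u hu => Prod.ext (sub_eq_zero.2 (hZ u hu).1) (hZ u hu).2) fun u hu =>
    fderiv_prodMk_surjective (hc.differentiable one_ne_zero u) (hg.differentiable one_ne_zero u)
      (by simpa only [fderiv_sub_const] using fderiv_casimir_surjective ha hb (hZ u hu).1)
      (by simpa only [fderiv_sub_const] using hs u hu)
  simpa [hG] using h

theorem dimH_le_three_of_mom_eq {F : (Fin 3 → ℝ) × (Fin 3 → ℝ) → Fin 3 → ℝ}
    (hF : ContDiff ℝ 1 F) (ha : a ≠ 0) (hb : b ≠ 0)
    (hZ : ∀ u ∈ Z, u ∈ phaseSpace a b ∧ mom u = F u.2) : dimH Z ≤ 3 := by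
  have hF2 : ContDiff ℝ 1 fun u : Phase => F u.2 := hF.comp contDiff_snd
  refine dimH_le_three (g := fun u => u.1 - F u.2) (by simp) (contDiff_fst.sub hF2) ha hb
    (fun u hu => ⟨(hZ u hu).1, sub_eq_zero.2 (hZ u hu).2⟩) fun u _ z => ⟨(z, 0, 0), ?_, ?_⟩
  · simp [fderiv_casimir, fa, fb]
  · have h2 : HasFDerivAt (fun u : Phase => F u.2) _ u :=
      ((hF.differentiable one_ne_zero u.2).hasFDerivAt).comp u hasFDerivAt_snd
    rw [(hasFDerivAt_fst.fun_sub h2).fderiv]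
    change z - fderiv ℝ F u.2 0 = z
    rw [map_zero, sub_zero]

theorem dimH_mom_eq_zero (ha : a ≠ 0) (hb : b ≠ 0) :
    dimH {u | u ∈ phaseSpace a b ∧ mom u = 0} ≤ 3 :=
  dimH_le_three_of_mom_eq (F := 0) contDiff_const ha hb fun _ hu => hu

theorem dimH_redMom_eq_zero (ha : a ≠ 0) (hb : b ≠ 0) :
    dimH {u | u ∈ phaseSpace a b ∧ mom u 0 = 0 ∧ mom u 1 = 0 ∧ redMom ε₁ lam u = 0} ≤ 3 := by
  refine dimH_le_three_of_mom_eq (F := fun q => ![0, 0, 2 * (lam + ε₁ * (q.1 1 - q.2 0))])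
    (by fun_prop) ha hb fun u ⟨hp, h0, h1, hD⟩ => ⟨hp, funext fun i => ?_⟩
  have h2 : mom u 2 = 2 * (lam + ε₁ * (fa u 1 - fb u 0)) := by
    rw [redMom] at hD
    linear_combination 2 * hD
  fin_cases i
  exacts [h0, h1, h2]

theorem dimH_foldSet (ha : a ≠ 0) (hb : b ≠ 0) :
    dimH {u | u ∈ phaseSpace a b ∧ u ∈ foldSet ε₁ lam} ≤ 3 := by
  refine dimH_le_three_of_mom_eq (F := fun q =>
    ![2 * ε₁ * q.2 2, -(2 * ε₁ * q.1 2), lam + ε₁ * (q.1 1 - q.2 0)])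
    (by fun_prop) ha hb fun u ⟨hp, h0, h1, h2⟩ => ⟨hp, funext fun i => ?_⟩
  fin_cases i
  exacts [h0, h1, h2]

theorem dimH_mom_eq_zero_fb_eq_zero {i j : Fin 3} (hij : i ≠ j) (ha : a ≠ 0) (hb : b ≠ 0) :
    dimH {u | u ∈ phaseSpace a b ∧ mom u i = 0 ∧ mom u j = 0 ∧ fb u 2 = 0} ≤ 3 := by
  refine dimH_le_three (g := fun u => (mom u i, mom u j, fb u 2)) (by simp) (by fun_prop) ha hb
    (fun u ⟨hp, hi, hj, h2⟩ => ⟨hp, Prod.ext hi (Prod.ext hj h2)⟩) fun u ⟨hp, _, _, h2⟩ z =>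
    ⟨tangentVec (Pi.single i z.1 + Pi.single j z.2.1) ((z.2.2 / b ^ 2) • ![-fb u 1, fb u 0, 0]) u,
      fderiv_casimir_tangentVec _ _ u, ?_⟩
  have hB := (mem_phaseSpace_iff_coord.1 hp).2.1
  rw [DifferentiableAt.fderiv_prodMk (by fun_prop) (by fun_prop),
    DifferentiableAt.fderiv_prodMk (by fun_prop) (by fun_prop)]
  refine Prod.ext ?_ (Prod.ext ?_ ?_)
  · change fderiv ℝ (fun u => mom u i) u _ = z.1
    rw [fderiv_mom_apply]
    simp [tangentVec, hij]
  · change fderiv ℝ (fun u => mom u j) u _ = z.2.1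
    rw [fderiv_mom_apply]
    simp [tangentVec, hij.symm]
  · change fderiv ℝ (fun u => fb u 2) u _ = z.2.2
    rw [fderiv_fb_apply]
    change (fb u ⨯₃ _) 2 = _
    simp only [cross_apply, Pi.smul_apply, smul_eq_mul, Matrix.cons_val]
    field_simp
    linear_combination z.2.2 * hB - z.2.2 * fb u 2 * h2

theorem fderiv_mom_dot_fa (m n : Fin 3 → ℝ) (u : Phase) :
    fderiv ℝ (fun q => mom q ⬝ᵥ fa q) u (tangentVec (m + mom u ⨯₃ n) n u) = m ⬝ᵥ fa u := by
  simp only [dotProduct, Fin.sum_univ_three]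
  simp (disch := fun_prop) only [fderiv_fun_add, fderiv_fun_mul, fderiv_mom_apply, fderiv_fa_apply,
    add_apply, smul_apply, smul_eq_mul]
  simp only [tangentVec, mom, fa, cross_apply, Pi.add_apply, Matrix.cons_val]
  ring

theorem fderiv_mom_dot_fb (m n : Fin 3 → ℝ) (u : Phase) :
    fderiv ℝ (fun q => mom q ⬝ᵥ fb q) u (tangentVec (m + mom u ⨯₃ n) n u) = m ⬝ᵥ fb u := by
  simp only [dotProduct, Fin.sum_univ_three]
  simp (disch := fun_prop) only [fderiv_fun_add, fderiv_fun_mul, fderiv_mom_apply, fderiv_fb_apply,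
    add_apply, smul_apply, smul_eq_mul]
  simp only [tangentVec, mom, fb, cross_apply, Pi.add_apply, Matrix.cons_val]
  ring

theorem dimH_le_three_of_mom_dot_eq_zero {f : Phase → ℝ} (hf : ContDiff ℝ 1 f) (ha : a ≠ 0)
    (hb : b ≠ 0)
    (hZ : ∀ u ∈ Z, u ∈ phaseSpace a b ∧ mom u ⬝ᵥ fa u = 0 ∧ mom u ⬝ᵥ fb u = 0 ∧ f u = 0)
    (hs : ∀ u ∈ Z, ∃ m n, m ⬝ᵥ fa u = 0 ∧ m ⬝ᵥ fb u = 0 ∧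
      fderiv ℝ f u (tangentVec (m + mom u ⨯₃ n) n u) ≠ 0) : dimH Z ≤ 3 := by
  have hda : ContDiff ℝ 1 fun u => mom u ⬝ᵥ fa u := by
    simp only [dotProduct, Fin.sum_univ_three]; fun_prop
  have hdb : ContDiff ℝ 1 fun u => mom u ⬝ᵥ fb u := by
    simp only [dotProduct, Fin.sum_univ_three]; fun_prop
  refine dimH_le_three (g := fun u => (mom u ⬝ᵥ fa u, mom u ⬝ᵥ fb u, f u)) (by simp)
    (hda.prodMk (hdb.prodMk hf)) ha hb (fun u hu => ⟨(hZ u hu).1, Prod.ext (hZ u hu).2.1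
      (Prod.ext (hZ u hu).2.2.1 (hZ u hu).2.2.2)⟩) fun u hu z => ?_
  obtain ⟨m, n, hma, hmb, hne⟩ := hs u hu
  obtain ⟨hA, hB, hAB⟩ := mem_phaseSpace_iff.1 (hZ u hu).1
  set w := (z.1 / a ^ 2) • fa u + (z.2.1 / b ^ 2) • fb u with hw
  set k := (z.2.2 - fderiv ℝ f u (tangentVec (w + mom u ⨯₃ 0) 0 u)) /
    fderiv ℝ f u (tangentVec (m + mom u ⨯₃ n) n u) with hk
  refine ⟨tangentVec (w + mom u ⨯₃ 0) 0 u + k • tangentVec (m + mom u ⨯₃ n) n u, ?_, ?_⟩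
  · rw [map_add, map_smul, fderiv_casimir_tangentVec, fderiv_casimir_tangentVec, smul_zero,
      add_zero]
  · rw [DifferentiableAt.fderiv_prodMk (hda.differentiable one_ne_zero u)
      ((hdb.prodMk hf).differentiable one_ne_zero u), DifferentiableAt.fderiv_prodMk
      (hdb.differentiable one_ne_zero u) (hf.differentiable one_ne_zero u)]
    refine Prod.ext ?_ (Prod.ext ?_ ?_)
    · change fderiv ℝ (fun u => mom u ⬝ᵥ fa u) u _ = z.1
      rw [map_add, map_smul, fderiv_mom_dot_fa, fderiv_mom_dot_fa, hma, hw, add_dotProduct,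
        smul_dotProduct, smul_dotProduct, hA, dotProduct_comm (fb u), hAB]
      simp only [smul_eq_mul, mul_zero, add_zero]
      field_simp
    · change fderiv ℝ (fun u => mom u ⬝ᵥ fb u) u _ = z.2.1
      rw [map_add, map_smul, fderiv_mom_dot_fb, fderiv_mom_dot_fb, hmb, hw, add_dotProduct,
        smul_dotProduct, smul_dotProduct, hB, hAB]
      simp only [smul_eq_mul, mul_zero, add_zero, zero_add]
      field_simp
    · change fderiv ℝ f u _ = z.2.2
      rw [map_add, map_smul, smul_eq_mul, hk, div_mul_cancel₀ _ hne, add_sub_cancel]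

theorem dimH_rel_zero_of_mom_two_ne_zero (ha : a ≠ 0) (hb : b ≠ 0) :
    dimH {u | u ∈ phaseSpace a b ∧ Rel ε₁ lam 0 0 0 u ∧ redMom ε₁ lam u = 0 ∧ mom u 2 ≠ 0} ≤ 3 := by
  have hf : ContDiff ℝ 1 (redMom ε₁ lam) := by
    unfold redMom
    fun_prop
  refine dimH_le_three_of_mom_dot_eq_zero hf ha hb (fun u ⟨hp, h, hD, _⟩ =>
    ⟨hp, (rel_zero_iff.1 h).1, (rel_zero_iff.1 h).2, hD⟩) fun u ⟨_, h, _, hM⟩ =>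
    ⟨mom u, 0, (rel_zero_iff.1 h).1, (rel_zero_iff.1 h).2, ?_⟩
  simpa [fderiv_redMom, redMomVar, tangentVec, mom, fa, fb] using hM

theorem dimH_rel_zero_of_mom_two_eq_zero (ha : a ≠ 0) (hb : b ≠ 0) :
    dimH {u | u ∈ phaseSpace a b ∧ Rel ε₁ lam 0 0 0 u ∧ planarSq u ≠ 0 ∧ mom u 2 = 0} ≤ 3 := by
  refine dimH_le_three_of_mom_dot_eq_zero (f := fun u => mom u 2) (by fun_prop) ha hb
    (fun u ⟨hp, h, _, hM⟩ => ⟨hp, (rel_zero_iff.1 h).1, (rel_zero_iff.1 h).2, hM⟩)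
    fun u ⟨_, _, hW, _⟩ =>
    ⟨0, ![-mom u 1, mom u 0, 0], zero_dotProduct _, zero_dotProduct _, ?_⟩
  rw [fderiv_mom_apply, zero_add]
  convert hW using 1
  simp only [tangentVec, mom, planarSq, cross_apply, Matrix.cons_val]
  ring

theorem mom_eq_zero_or_of_mem_setM₃ {u : Phase} (hu : u ∈ setM₃ ε₀ ε₁ lam a b)
    (hW : planarSq u = 0) : mom u = 0 ∨ fb u 2 = 0 ∨ redMom ε₁ lam u = 0 := by
  obtain ⟨h0, h1⟩ := planarSq_eq_zero_iff.1 hW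
  have hM : mom u 2 = 0 → mom u = 0 := fun h2 => by
    ext i
    fin_cases i
    exacts [h0, h1, h2]
  rcases eq_or_ne ε₀ 0 with rfl | hε
  · have hc : IsClosed {u : Phase | redMom ε₁ lam u * (mom u ⬝ᵥ fb u) = 0} := by
      simp only [redMom, dotProduct, Fin.sum_univ_three]
      exact isClosed_eq (by fun_prop) continuous_const
    have h : redMom ε₁ lam u * (mom u ⬝ᵥ fb u) = 0 := closure_minimal (fun v hv => ?_) hc hu
    · simp only [dotProduct, Fin.sum_univ_three, h0, h1, zero_mul, zero_add, mul_eq_zero] at h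
      tauto
    · obtain ⟨-, -, S, hS⟩ := mem_relationSet_iff_exists_rel.1 hv
      obtain ⟨-, hB, -, hy, -⟩ := rel_iff_coord.1 hS
      simp only [Set.mem_ofPred_eq, dotProduct, Fin.sum_univ_three]
      linear_combination redMom ε₁ lam v * hB + hy
  · have hc : IsClosed {u : Phase | ε₀ * (mom u 1 * (fa u 2 * fb u 0 - fa u 0 * fb u 2)
        + (mom u ⬝ᵥ fb u) * fb u 2) + redMom ε₁ lam u * (mom u ⬝ᵥ fb u) * mom u 1 = 0} := by
      simp only [redMom, dotProduct, Fin.sum_univ_three]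
      exact isClosed_eq (by fun_prop) continuous_const
    have h := closure_minimal (fun v hv => ?_) hc hu
    · simp only [Set.mem_ofPred_eq, dotProduct, Fin.sum_univ_three, h0, h1, zero_mul, zero_add,
        mul_zero, add_zero, mul_eq_zero, hε, false_or] at h
      tauto
    · obtain ⟨-, -, S, hS⟩ := mem_relationSet_iff_exists_rel.1 hv
      obtain ⟨-, hB, -, hy, -⟩ := rel_iff_coord.1 hS
      simp only [Set.mem_ofPred_eq, dotProduct, Fin.sum_univ_three]
      linear_combination (redMom ε₁ lam v * mom v 1 + ε₀ * fb v 2) * hB + mom v 1 * hy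

theorem dimH_not_isSmoothPoint (hb : 0 < b) (hab : b < a) :
    dimH {u | u ∈ setM₃ ε₀ ε₁ lam a b ∧ ¬ IsSmoothPoint (setM₃ ε₀ ε₁ lam a b) 4 u} ≤ 3 := by
  have hb' := hb.ne'
  have ha' := (hb.trans hab).ne'
  have hunion {X Y : Set Phase} (hX : dimH X ≤ 3) (hY : dimH Y ≤ 3) : dimH (X ∪ Y) ≤ 3 :=
    (dimH_union X Y).trans_le (max_le hX hY)
  have hvert := hunion (dimH_mom_eq_zero ha' hb') (hunion
    (dimH_mom_eq_zero_fb_eq_zero (i := 0) (j := 1) (by decide) ha' hb')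
    (dimH_redMom_eq_zero (ε₁ := ε₁) (lam := lam) ha' hb'))
  have hsing := hunion (dimH_foldSet (ε₁ := ε₁) (lam := lam) ha' hb')
    (dimH_mom_eq_zero_fb_eq_zero (i := 0) (j := 2) (by decide) ha' hb')
  have hzero := hunion (dimH_rel_zero_of_mom_two_ne_zero (ε₁ := ε₁) (lam := lam) ha' hb')
    (dimH_rel_zero_of_mom_two_eq_zero (ε₁ := ε₁) (lam := lam) ha' hb')
  refine (dimH_mono ?_).trans (hunion hvert (hunion hsing hzero))
  rintro u ⟨hu, hns⟩
  have hp := mem_phaseSpace_of_mem_setM₃ hu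
  by_cases hW : planarSq u = 0
  · obtain ⟨h0, h1⟩ := planarSq_eq_zero_iff.1 hW
    rcases mom_eq_zero_or_of_mem_setM₃ hu hW with h | h | h
    · exact .inl (.inl ⟨hp, h⟩)
    · exact .inl (.inr (.inl ⟨hp, h0, h1, h⟩))
    · exact .inl (.inr (.inr ⟨hp, h0, h1, h⟩))
  · rcases isSmoothPoint_or hb hab (mem_relationSet_of_mem_setM₃ hu hW) with
      h | ⟨S, hS, ⟨-, -, -, hfold⟩ | ⟨-, -, hax⟩ | ⟨rfl, rfl, hD⟩⟩
    · exact absurd h hns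
    · exact .inr (.inl (.inl ⟨hp, hfold⟩))
    · exact .inr (.inl (.inr ⟨hp, hax.mom_zero, hax.mom_two, congrFun hax.shiftB_eq_zero 2⟩))
    · by_cases hM : mom u 2 = 0
      · exact .inr (.inr (.inr ⟨hp, hS, hW, hM⟩))
      · exact .inr (.inr (.inl ⟨hp, hS, hD, hM⟩))

theorem hausdorffMeasure_not_isSmoothPoint (hb : 0 < b) (hab : b < a) :
    MeasureTheory.Measure.hausdorffMeasure 4
      {u | u ∈ setM₃ ε₀ ε₁ lam a b ∧ ¬ IsSmoothPoint (setM₃ ε₀ ε₁ lam a b) 4 u} = 0 := by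
  have h : dimH {u | u ∈ setM₃ ε₀ ε₁ lam a b ∧ ¬ IsSmoothPoint (setM₃ ε₀ ε₁ lam a b) 4 u}
      < ((4 : NNReal) : ENNReal) :=
    (dimH_not_isSmoothPoint hb hab).trans_lt (by norm_num)
  simpa using hausdorffMeasure_of_dimH_lt h

end Dimension

/-! ### Non-emptiness and the values of the integrals -/

theorem relationSet_nonempty (ε₀ ε₁ lam : ℝ) {a b : ℝ} (ha : a ≠ 0) (hb : b ≠ 0) :
    (relationSet ε₀ ε₁ lam a b).Nonempty := by
  rcases eq_or_ne ε₀ 0 with rfl | hε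
  · refine ⟨(![a * b, 0, 0], ![0, a, 0], ![0, 0, b]), mem_relationSet_iff_exists_rel.2
      ⟨mem_phaseSpace_iff_coord.2 ?_, ?_, 0, rel_zero_iff.2 ⟨?_, ?_⟩⟩⟩
    · simp [fa, fb]
    · simp [planarSq, mom, ha, hb]
    · simp [mom, fa]
    · simp [mom, fb]
  · obtain ⟨S, hS, hSε⟩ := exists_sq_eq_one_mul_nonneg ε₀
    have hS0 : S ≠ 0 := fun h => by simp [h] at hS
    obtain ⟨μ, hμ, hμ2⟩ := exists_sq_eq_two_mul_add (lam + ε₁ * a)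
      (hSε.lt_of_ne' (mul_ne_zero hS0 hε))
    refine ⟨(![μ * (a * b), -(μ * S * b), μ], ![0, a, 0], ![0, 0, b]),
      mem_relationSet_iff_exists_rel.2
      ⟨mem_phaseSpace_iff_coord.2 ?_, ?_, S, rel_iff_coord.2 ⟨?_, ?_, ?_, ?_, ?_⟩⟩⟩
    · simp [fa, fb]
    · have : 0 < (μ * S * b) ^ 2 := by positivity
      simp only [planarSq, mom, Matrix.cons_val]
      nlinarith [sq_nonneg (μ * (a * b))]
    all_goals simp only [redMom, mom, fa, fb, Matrix.cons_val]
    · ring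
    · linear_combination -μ * b * hS
    · linear_combination -(a * b * S) * hμ2 / 2 - ε₀ * a * b * hS
    · linear_combination b * S ^ 2 * hμ2 / 2 + ε₀ * b * S * hS
    · linear_combination -S * hμ2 / 2

theorem integrals_eq_of_mem_setM₃ {ε₀ ε₁ lam a b p r : ℝ} (ha : a ≠ 0) (hb : b ≠ 0)
    (hp : p ^ 2 = a ^ 2 + b ^ 2) (hr : r ^ 2 = a ^ 2 - b ^ 2) {u : Phase}
    (hu : u ∈ setM₃ ε₀ ε₁ lam a b) (hw : w₁ u * w₂ u ≠ 0) (hd : denT ε₀ ε₁ u ≠ 0) :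
    (hamH ε₀ ε₁ lam u : ℂ) =
        ε₀ * intS u + ε₀ / (2 * intS u) * ((p : ℂ) ^ 2 - intT ε₀ ε₁ u)
          - (ε₁ : ℂ) ^ 2 * intT ε₀ ε₁ u + (lam : ℂ) ^ 2 / 2 ∧
      (intK ε₀ ε₁ lam u : ℂ) =
        ((ε₀ : ℂ) + 2 * (ε₁ : ℂ) ^ 2 * intS u) ^ 2 *
          ((r : ℂ) ^ 4 + intT ε₀ ε₁ u *
            (intT ε₀ ε₁ u + 4 * intS u ^ 2 - 2 * (p : ℂ) ^ 2)) / (4 * intS u ^ 2) ∧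
      (intG ε₀ ε₁ lam u : ℂ) =
        ε₀ * ((p : ℂ) ^ 4 - (r : ℂ) ^ 4 + 2 * (p : ℂ) ^ 2 * intS u ^ 2) / (4 * intS u)
          - 1 / 2 * intS u * ((ε₀ : ℂ) + 2 * (ε₁ : ℂ) ^ 2 * intS u) * intT ε₀ ε₁ u := by
  have hW := w₁_mul_w₂_ne_zero_iff.1 hw
  obtain ⟨hps, -, S, hS⟩ := mem_relationSet_iff_exists_rel.1 (mem_relationSet_of_mem_setM₃ hu hW)
  obtain ⟨δ, rfl, hδ⟩ := hS.exists_div hps ha hb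
  have hSe := intS_eq_of_dot_shift hW hS.dot_shiftA hS.dot_shiftB
  rw [denT_eq hSe, Complex.ofReal_ne_zero, mul_ne_zero_iff] at hd
  exact hδ.integrals_eq hps hW hd.1 hd.2 hp hr

theorem intS_ne_zero_of_mem_setM₃ {ε₀ ε₁ lam a b : ℝ} (ha : a ≠ 0) (hb : b ≠ 0) (hε : ε₀ ≠ 0)
    {u : Phase} (hu : u ∈ setM₃ ε₀ ε₁ lam a b) (hw : w₁ u * w₂ u ≠ 0) : intS u ≠ 0 := by
  have hW := w₁_mul_w₂_ne_zero_iff.1 hw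
  obtain ⟨hps, -, S, hS⟩ := mem_relationSet_iff_exists_rel.1 (mem_relationSet_of_mem_setM₃ hu hW)
  rw [intS_eq_of_dot_shift hW hS.dot_shiftA hS.dot_shiftB]
  exact Complex.ofReal_ne_zero.2 (hS.ne_zero hps ha hb hε)

end GTFG

end

open GTFG MeasureTheory in
theorem theorem3_general (ε₀ ε₁ lam a b : ℝ) (hb : 0 < b) (hab : b < a) :
    (setM₃ ε₀ ε₁ lam a b).Nonempty ∧
    setM₃ ε₀ ε₁ lam a b ⊆ phaseSpace a b ∧
    IsInvariantSet (gyroField ε₀ ε₁ lam) (setM₃ ε₀ ε₁ lam a b) ∧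
    (∀ u ∈ setM₃ ε₀ ε₁ lam a b, IsCriticalPoint ε₀ ε₁ lam u) ∧
    (setM₃ ε₀ ε₁ lam a b ⊆
      closure {u | IsSmoothPoint (setM₃ ε₀ ε₁ lam a b) 4 u}) ∧
    Measure.hausdorffMeasure 4
      {u | u ∈ setM₃ ε₀ ε₁ lam a b ∧ ¬ IsSmoothPoint (setM₃ ε₀ ε₁ lam a b) 4 u} = 0 ∧
    (∀ (I : Set ℝ) (γ : ℝ → Phase), I.OrdConnected →
      IsTrajectoryOn (gyroField ε₀ ε₁ lam) I γ →
      ∀ t₁ ∈ I, ∀ t₂ ∈ I, γ t₁ ∈ setM₃ ε₀ ε₁ lam a b →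
        w₁ (γ t₁) * w₂ (γ t₁) ≠ 0 → w₁ (γ t₂) * w₂ (γ t₂) ≠ 0 →
        intS (γ t₁) = intS (γ t₂) ∧
        (denT ε₀ ε₁ (γ t₁) ≠ 0 → intT ε₀ ε₁ (γ t₁) = intT ε₀ ε₁ (γ t₂))) ∧
    (ε₀ ≠ 0 → ∀ u ∈ setM₃ ε₀ ε₁ lam a b, w₁ u * w₂ u ≠ 0 → intS u ≠ 0) ∧
    (∀ p r : ℝ, p ^ 2 = a ^ 2 + b ^ 2 → r ^ 2 = a ^ 2 - b ^ 2 →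
      ∀ u ∈ setM₃ ε₀ ε₁ lam a b, w₁ u * w₂ u ≠ 0 → denT ε₀ ε₁ u ≠ 0 →
        (hamH ε₀ ε₁ lam u : ℂ) =
          ε₀ * intS u + ε₀ / (2 * intS u) * ((p : ℂ) ^ 2 - intT ε₀ ε₁ u)
            - (ε₁ : ℂ) ^ 2 * intT ε₀ ε₁ u + (lam : ℂ) ^ 2 / 2 ∧
        (intK ε₀ ε₁ lam u : ℂ) =
          ((ε₀ : ℂ) + 2 * (ε₁ : ℂ) ^ 2 * intS u) ^ 2 *
            ((r : ℂ) ^ 4 + intT ε₀ ε₁ u *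
              (intT ε₀ ε₁ u + 4 * intS u ^ 2 - 2 * (p : ℂ) ^ 2)) / (4 * intS u ^ 2) ∧
        (intG ε₀ ε₁ lam u : ℂ) =
          ε₀ * ((p : ℂ) ^ 4 - (r : ℂ) ^ 4 + 2 * (p : ℂ) ^ 2 * intS u ^ 2) / (4 * intS u)
            - 1 / 2 * intS u * ((ε₀ : ℂ) + 2 * (ε₁ : ℂ) ^ 2 * intS u)
              * intT ε₀ ε₁ u) := by
  have hb' := hb.ne'
  have ha' := (hb.trans hab).ne'
  exact ⟨(relationSet_nonempty ε₀ ε₁ lam ha' hb').closure,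
    fun _ hu => mem_phaseSpace_of_mem_setM₃ hu,
    isInvariantSet_setM₃ ε₀ ε₁ lam a b,
    fun _ hu => isCriticalPoint_of_mem_setM₃ ha' hb' hu,
    setM₃_subset_closure_isSmoothPoint hb hab,
    hausdorffMeasure_not_isSmoothPoint hb hab,
    fun _ _ hI h _ ht₁ _ ht₂ hu hw₁ hw₂ => intS_intT_const ha' hb' hI h ht₁ ht₂
      (mem_relationSet_of_mem_setM₃ hu (w₁_mul_w₂_ne_zero_iff.1 hw₁))
      (w₁_mul_w₂_ne_zero_iff.1 hw₂),
    fun hε _ hu hw => intS_ne_zero_of_mem_setM₃ ha' hb' hε hu hw,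
    fun _ _ hp hr _ hu hw hd => integrals_eq_of_mem_setM₃ ha' hb' hp hr hu hw hd⟩

open GTFG MeasureTheory in
theorem theorem3 (ε₀ ε₁ lam a b : ℝ) (hε₀ : 0 ≤ ε₀) (hb : 0 < b) (hab : b < a) :
    -- the closure is a non-empty invariant set of the system in the phase space
    (setM₃ ε₀ ε₁ lam a b).Nonempty ∧
    setM₃ ε₀ ε₁ lam a b ⊆ phaseSpace a b ∧
    IsInvariantSet (gyroField ε₀ ε₁ lam) (setM₃ ε₀ ε₁ lam a b) ∧
    -- it consists of critical points of the integral map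
    (∀ u ∈ setM₃ ε₀ ε₁ lam a b, IsCriticalPoint ε₀ ε₁ lam u) ∧
    -- it is almost everywhere a smooth 4-dimensional manifold
    (setM₃ ε₀ ε₁ lam a b ⊆
      closure {u | IsSmoothPoint (setM₃ ε₀ ε₁ lam a b) 4 u}) ∧
    Measure.hausdorffMeasure 4
      {u | u ∈ setM₃ ε₀ ε₁ lam a b ∧ ¬ IsSmoothPoint (setM₃ ε₀ ε₁ lam a b) 4 u} = 0 ∧
    -- `S` and `T`, where defined, are constant along the trajectories in the closure
    (∀ (I : Set ℝ) (γ : ℝ → Phase), I.OrdConnected →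
      IsTrajectoryOn (gyroField ε₀ ε₁ lam) I γ →
      ∀ t₁ ∈ I, ∀ t₂ ∈ I, γ t₁ ∈ setM₃ ε₀ ε₁ lam a b →
        w₁ (γ t₁) * w₂ (γ t₁) ≠ 0 → w₁ (γ t₂) * w₂ (γ t₂) ≠ 0 →
        intS (γ t₁) = intS (γ t₂) ∧
        (denT ε₀ ε₁ (γ t₁) ≠ 0 → intT ε₀ ε₁ (γ t₁) = intT ε₀ ε₁ (γ t₂))) ∧
    -- `S` does not vanish if `ε₀ > 0`
    (0 < ε₀ → ∀ u ∈ setM₃ ε₀ ε₁ lam a b, w₁ u * w₂ u ≠ 0 → intS u ≠ 0) ∧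
    -- the general integrals in terms of `S` and `T`, with `p² = a² + b²`, `r² = a² - b²`
    (∀ p r : ℝ, p ^ 2 = a ^ 2 + b ^ 2 → r ^ 2 = a ^ 2 - b ^ 2 →
      ∀ u ∈ setM₃ ε₀ ε₁ lam a b, w₁ u * w₂ u ≠ 0 → intS u ≠ 0 → denT ε₀ ε₁ u ≠ 0 →
        (hamH ε₀ ε₁ lam u : ℂ) =
          ε₀ * intS u + ε₀ / (2 * intS u) * ((p : ℂ) ^ 2 - intT ε₀ ε₁ u)
            - (ε₁ : ℂ) ^ 2 * intT ε₀ ε₁ u + (lam : ℂ) ^ 2 / 2 ∧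
        (intK ε₀ ε₁ lam u : ℂ) =
          ((ε₀ : ℂ) + 2 * (ε₁ : ℂ) ^ 2 * intS u) ^ 2 *
            ((r : ℂ) ^ 4 + intT ε₀ ε₁ u *
              (intT ε₀ ε₁ u + 4 * intS u ^ 2 - 2 * (p : ℂ) ^ 2)) / (4 * intS u ^ 2) ∧
        (intG ε₀ ε₁ lam u : ℂ) =
          ε₀ * ((p : ℂ) ^ 4 - (r : ℂ) ^ 4 + 2 * (p : ℂ) ^ 2 * intS u ^ 2) / (4 * intS u)
            - 1 / 2 * intS u * ((ε₀ : ℂ) + 2 * (ε₁ : ℂ) ^ 2 * intS u)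
              * intT ε₀ ε₁ u) := by
  obtain ⟨h₁, h₂, h₃, h₄, h₅, h₆, h₇, h₈, h₉⟩ := theorem3_general ε₀ ε₁ lam a b hb hab
  exact ⟨h₁, h₂, h₃, h₄, h₅, h₆, h₇, fun h => h₈ h.ne',
    fun p r hp hr u hu hw _ => h₉ p r hp hr u hu hw⟩
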